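/- Setting. Let $T>0$ and let $\Gamma(t)=\Phi(\Gamma_0,t)\subset\mathbb R^3$, $t\in[0,T]$, be a $C^2$ evolving surface: $\Gamma_0$ is a closed, connected, oriented $C^2$ surface, each $\Phi(\cdot,t)$ is a $C^2$ diffeomorphism of $\Gamma_0$ onto $\Gamma(t)$, $\Phi(\cdot,0)=\mathrm{id}$ and $\partial_t\Phi(x,t)=V(\Phi(x,t),t)$ with $V\in C^1([0,T];C^2(\mathbb R^3;\mathbb R^3))$. Let $\varepsilon>0$, $\theta\in(0,1)$. Evolving triangulations. An evolving triangulated surface $\Gamma_h(t)=\bigcup_{K(t)\in\mathcal T_h(t)}K(t)$ is a conforming union of non-degenerate triangles whose nodes $x_i(t)$ start on $\Gamma_0$ and are transported by $V$; $h=\sup_{t}\max_K \operatorname{diam}K(t)$; $\phi_i(\cdot,t)$ are the nodal basis functions, $S_h(t)$ is the space of continuous functions on $\Gamma_h(t)$ that are affine on each triangle, $I_h$ is the Lagrange interpolation into $S_h(t)$, $V_h=\sum_i V(x_i(t),t)\phi_i$ is the discrete velocity, and $\partial_h^\bullet$ is the time derivative along the flow of $V_h$. Fix $\rho>0$. The triangulation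 is called *good* if for all $t\in[0,T]$: every $K(t)$ contains a two-dimensional ball of diameter at least $\rho h$; $\Gamma_h(t)$ lies in a tubular neighbourhood of $\Gamma(t)$ and the normal projection $p$ maps it bijectively onto $\Gamma(t)$ (exactness); all angles of all triangles are at most $\pi/2$; and $\nabla_{\Gamma_h}\cdot V_h\ge 0$. For $\eta$ on $\Gamma_h(0)$ the lift $\eta^\ell$ on $\Gamma_0$ is given by $\eta^\ell(p(x))=\eta(x)$. Let $\tilde S_h^T$ be the space of continuous functions $z_h$ on $\bigcup_{t\in[0,T]}\Gamma_h(t)\times\{t\}$ with $z_h(\cdot,t)\in S_h(t)$ for all $t$, and $S_h^T$ the subspace of those for which $\partial_h^\bullet z_h$ exists and is continuous. Put $$\bar m_h(\eta,\zeta)=\int_{\Gamma_h(t)}I_h(\eta\zeta),\quad a_h(\eta,\zeta)=\int_{\Gamma_h(t)}\nabla_{\Gamma_h}\eta\cdot\nabla_{\Gamma_h}\zeta,\quad g_h(\eta,\zeta)=\int_{\Gamma_h(t)}\eta\,\zeta\,\nabla_{\Gamma_h}\cdot V_h .$$ Potentials. Let $F_{\log}(r)=(1-r)\log(1-r)+(1+r)\log(1+r)$,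 $F(r)=\frac\theta2F_{\log}(r)+\frac{1-r^2}2$. For $\delta\in(0,1)$ let $F^\delta_{\log}$ be the $C^2$ function on $\mathbb R$ that equals $F_{\log}$ for $|r|<1-\delta$ and its second-order Taylor polynomial at $\pm(1-\delta)$ for $\pm r\ge 1-\delta$. Let $F^\delta(r)=\frac\theta2F^\delta_{\log}(r)+\frac{1-r^2}2$, $f^\delta=(F^\delta_{\log})'$ and $$E_h^{CH,\delta}[U;t]=\int_{\Gamma_h(t)}\frac{\varepsilon|\nabla_{\Gamma_h}U|^2}{2}+\frac1\varepsilon I_hF^\delta(U).$$ Let $\mathcal I_{h,0}$ be the set of $\eta\in S_h(0)$ with $|\eta|\le1$ a.e., finite energy $\int_{\Gamma_h(0)}\frac{\varepsilon|\nabla_{\Gamma_h}\eta|^2}{2}+\frac1\varepsilon I_hF(\eta)<\infty$, and $\bigl|\frac1{|\Gamma_h(0)|}\int_{\Gamma_h(0)}\eta\bigr|<1$. Let $\mathcal I_0$ be the set of $u_0\in H^1(\Gamma_0)$ with $|u_0|\le1$ a.e., finite energy $\int_{\Gamma_0}\frac{\varepsilon|\nabla_\Gamma u_0|^2}{2}+\frac1\varepsilon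 F(u_0)<\infty$, and $\frac{1}{|\Gamma(t)|}\bigl|\int_{\Gamma_0}u_0\bigr|<1$ for all $t\in[0,T]$. Claim (existence and uniqueness). For every good triangulation, every $\delta\in(0,1)$ and every $U_{h,0}\in\mathcal I_{h,0}$ there is a unique pair $(U_h^\delta,W_h^\delta)\in S_h^T\times\tilde S_h^T$ such that $U_h^\delta(0)=U_{h,0}$ and, for all $t\in[0,T]$ and all $\phi_h\in S_h(t)$, $$\bar m_h(\partial_h^\bullet U_h^\delta,\phi_h)+g_h(I_h(U_h^\delta\phi_h),1)+a_h(W_h^\delta,\phi_h)=0,$$ $$\bar m_h(W_h^\delta,\phi_h)=\varepsilon a_h(U_h^\delta,\phi_h)+\frac{\theta}{2\varepsilon}\bar m_h(I_hf^\delta(U_h^\delta),\phi_h)-\frac1\varepsilon\bar m_h(U_h^\delta,\phi_h).$$ Claim (uniform bound). There is $h_0>0$, depending only on the evolving surface (including $V$ and $T$) and on $\rho$, such that for all $\varepsilon>0$, $\theta\in(0,1)$, $u_0\in\mathcal I_0$ and $C_0\in\mathbb R$ there is a constant $C$ with the following property. For every good triangulation with $h<h_0$, every $U_{h,0}\in\mathcal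 I_{h,0}$ with $$\|u_0-U_{h,0}^\ell\|_{L^2(\Gamma_0)}+h\|u_0-U_{h,0}^\ell\|_{H^1(\Gamma_0)}\le C_0h^2,$$ and every $\delta\in(0,1)$, the function $t\mapsto\|\nabla_{\Gamma_h}W_h^\delta(t)\|^2_{L^2(\Gamma_h(t))}$ is integrable on $[0,T]$ and $$\sup_{t\in[0,T]}E_h^{CH,\delta}[U_h^\delta(t);t]+\int_0^T\|\nabla_{\Gamma_h}W_h^\delta(t)\|^2_{L^2(\Gamma_h(t))}\,dt\le C .$$ In particular $C$ is independent of $\delta$, of $h$ and of the triangulation. -/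

import Mathlib

open MeasureTheory Set Filter Topology

noncomputable section

namespace ESFEM

/-- The ambient space `ℝ³` with its Euclidean structure. -/
abbrev E3 : Type := EuclideanSpace ℝ (Fin 3)

/-! ### The logarithmic potential and its regularisation -/

/-- `F_log(r) = (1 - r) log (1 - r) + (1 + r) log (1 + r)`; at `r = ±1` the convention
`0 log 0 = 0` is the one of `Real.log`. -/
def Flog (r : ℝ) : ℝ := (1 - r) * Real.log (1 - r) + (1 + r) * Real.log (1 + r)

/-- `F(r) = (θ / 2) F_log(r) + (1 - r²) / 2`, used for `|r| ≤ 1` only. -/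
def potential (θ r : ℝ) : ℝ := θ / 2 * Flog r + (1 - r ^ 2) / 2

/-- The regularised logarithmic potential `F_log^δ`. -/
def FlogReg (δ r : ℝ) : ℝ :=
  if 1 - δ ≤ r then
    (1 - r) * Real.log δ + (1 + r) * Real.log (2 - δ)
      + (1 - r) ^ 2 / (2 * δ) + (1 + r) ^ 2 / (2 * (2 - δ)) - 1
  else if r ≤ -1 + δ then
    (1 + r) * Real.log δ + (1 - r) * Real.log (2 - δ)
      + (1 + r) ^ 2 / (2 * δ) + (1 - r) ^ 2 / (2 * (2 - δ)) - 1
  else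
    (1 + r) * Real.log (1 + r) + (1 - r) * Real.log (1 - r)

/-- `F^δ(r) = (θ / 2) F_log^δ(r) + (1 - r²) / 2`. -/
def potentialReg (θ δ r : ℝ) : ℝ := θ / 2 * FlogReg δ r + (1 - r ^ 2) / 2

/-- `f^δ = (F_log^δ)'`. -/
def fReg (δ r : ℝ) : ℝ := deriv (FlogReg δ) r

/-! ### Closed surfaces -/

/-- The surface measure: the two-dimensional Hausdorff measure on `ℝ³`, normalised to be
the area on planes. -/
abbrev area : Measure E3 := Measure.euclideanHausdorffMeasure 2

/-- A closed, connected, oriented `C²` surface in `ℝ³`: a compact connected set that is locally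
the zero set of a `C²` function `g` with non-vanishing gradient; the unit normal field that
orients it is `∇g / |∇g|`. -/
structure Surface where
  carrier : Set E3
  normal : E3 → E3
  isCompact : IsCompact carrier
  isConnected : IsConnected carrier
  local_eq : ∀ x ∈ carrier, ∃ (O : Set E3) (g : E3 → ℝ), IsOpen O ∧ x ∈ O ∧ ContDiffOn ℝ 2 g O ∧
    carrier ∩ O = {y ∈ O | g y = 0} ∧
    ∀ y ∈ carrier ∩ O, gradient g y ≠ 0 ∧ normal y = ‖gradient g y‖⁻¹ • gradient g y

/-- The tangential gradient `∇φ - (∇φ · ν) ν` of a function that is differentiable near `x`. -/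
def Surface.tangentialGradient (Γ : Surface) (φ : E3 → ℝ) (x : E3) : E3 :=
  gradient φ x - (inner ℝ (gradient φ x) (Γ.normal x)) • Γ.normal x

/-- The surface measure restricted to `Γ`. -/
def Surface.measure (Γ : Surface) : Measure E3 := area.restrict Γ.carrier

/-- `f ∈ H¹(Γ)` with weak tangential gradient `G`. Here `H¹(Γ)` is the completion of the `C¹`
functions in the norm of `H¹(Γ)`: `f` and `G` are the limits in `L²(Γ)` of `C¹` functions and of
their tangential gradients. -/
def Surface.HasWeakGradient (Γ : Surface) (f : E3 → ℝ) (G : E3 → E3) : Prop :=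
  MemLp f 2 Γ.measure ∧ MemLp G 2 Γ.measure ∧
  ∃ φ : ℕ → E3 → ℝ, (∀ n, ContDiff ℝ 1 (φ n)) ∧
    Tendsto (fun n => eLpNorm (fun x => f x - φ n x) 2 Γ.measure) atTop (𝓝 0) ∧
    Tendsto (fun n => eLpNorm (fun x => G x - Γ.tangentialGradient (φ n) x) 2 Γ.measure)
      atTop (𝓝 0)

/-- The norm of `L²(Γ)`, used for square integrable functions and vector fields only. -/
def Surface.normL2 (Γ : Surface) {F : Type*} [NormedAddCommGroup F] (f : E3 → F) : ℝ :=
  (eLpNorm f 2 Γ.measure).toReal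

/-- The norm of `H¹(Γ)` of a function `f` with weak tangential gradient `G`. -/
def Surface.normH1 (Γ : Surface) (f : E3 → ℝ) (G : E3 → E3) : ℝ :=
  Real.sqrt (Γ.normL2 f ^ 2 + Γ.normL2 G ^ 2)

/-- `x` has distance less than `r` to `X`. -/
def tube (X : Set E3) (r : ℝ) : Set E3 := {x | Metric.infDist x X < r}

/-- The `r`-neighbourhood of `X` is a tubular neighbourhood: the nearest point in `X` of each of
its points is unique. -/
def IsTubular (X : Set E3) (r : ℝ) : Prop :=
  0 < r ∧ ∀ x ∈ tube X r, ∃! y, y ∈ X ∧ dist x y = Metric.infDist x X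

open Classical in
/-- The normal projection `p` onto `X`: the nearest point (junk where there is none). -/
def proj (X : Set E3) (x : E3) : E3 :=
  if h : ∃ y, y ∈ X ∧ dist x y = Metric.infDist x X then h.choose else 0

/-! ### Evolving surfaces -/

/-- `V ∈ C¹([0,T]; C²(ℝ³; ℝ³))`, the space `C²(ℝ³; ℝ³)` having the topology of locally uniform
convergence of derivatives up to order two; `V'` is the time derivative. -/
def IsC1InTimeC2InSpace (T : ℝ) (V : ℝ → E3 → E3) : Prop :=
  ∃ V' : ℝ → E3 → E3,
    (∀ t ∈ Icc 0 T, ContDiff ℝ 2 (V t) ∧ ContDiff ℝ 2 (V' t)) ∧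
    (∀ k : ℕ, k ≤ 2 →
      ContinuousOn (fun q : ℝ × E3 => iteratedFDeriv ℝ k (V q.1) q.2) (Icc 0 T ×ˢ univ) ∧
      ContinuousOn (fun q : ℝ × E3 => iteratedFDeriv ℝ k (V' q.1) q.2) (Icc 0 T ×ˢ univ)) ∧
    ∀ t ∈ Icc 0 T, ∀ x, HasDerivWithinAt (fun s => V s x) (V' t x) (Icc 0 T) t

/-- `φ` is a `C²` diffeomorphism of `X ⊆ ℝ³` onto its image: `φ` on `X` and its inverse on `φ(X)`
are restrictions of `C²` maps. -/
def IsC2Diffeo (X : Set E3) (φ : E3 → E3) : Prop :=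
  ∃ Ψ Ψ' : E3 → E3, ContDiff ℝ 2 Ψ ∧ ContDiff ℝ 2 Ψ' ∧ ∀ x ∈ X, Ψ x = φ x ∧ Ψ' (φ x) = x

/-- A `C²` evolving surface `(Γ(t))_{t ∈ [0,T]}`, `Γ(t) = Φ(Γ₀, t)`, moving with velocity `V`. -/
structure EvolvingSurface (T : ℝ) where
  initial : Surface
  flow : E3 → ℝ → E3
  velocity : ℝ → E3 → E3
  velocity_regular : IsC1InTimeC2InSpace T velocity
  flow_diffeo : ∀ t ∈ Icc 0 T, IsC2Diffeo initial.carrier (fun x => flow x t)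
  flow_zero : ∀ x ∈ initial.carrier, flow x 0 = x
  flow_deriv : ∀ x ∈ initial.carrier, ∀ t ∈ Icc 0 T,
    HasDerivWithinAt (flow x) (velocity t (flow x t)) (Icc 0 T) t

/-- `Γ(t)`. -/
def EvolvingSurface.at {T : ℝ} (S : EvolvingSurface T) (t : ℝ) : Set E3 :=
  (fun x => S.flow x t) '' S.initial.carrier

/-- The set `𝓘₀` of admissible initial data for the Cahn-Hilliard equation: `u₀ ∈ H¹(Γ₀)` with
`|u₀| ≤ 1` a.e., finite energy, and `|∫_{Γ₀} u₀| / |Γ(t)| < 1` for all `t ∈ [0,T]`. -/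
def EvolvingSurface.IsAdmissibleDatum {T : ℝ} (S : EvolvingSurface T) (ε θ : ℝ) (u₀ : E3 → ℝ) :
    Prop :=
  (∃ G : E3 → E3, S.initial.HasWeakGradient u₀ G ∧
    Integrable (fun x => ε * ‖G x‖ ^ 2 / 2 + 1 / ε * potential θ (u₀ x)) S.initial.measure) ∧
  (∀ᵐ x ∂S.initial.measure, |u₀ x| ≤ 1) ∧
  ∀ t ∈ Icc 0 T, |∫ x, u₀ x ∂S.initial.measure| / (area (S.at t)).toReal < 1

/-! ### Evolving triangulated surfaces -/

/-- Diameter `ρ_K` of the largest two-dimensional ball contained in the planar set `K`. -/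
def inDiameter (K : Set E3) : ℝ :=
  sSup {d | ∃ c ∈ affineSpan ℝ K, ∃ r : ℝ, 0 ≤ r ∧ d = 2 * r ∧
    Metric.closedBall c r ∩ (affineSpan ℝ K : Set E3) ⊆ K}

/-- An evolving triangulated surface `Γ_h(t)`: finitely many nodes on `Γ₀` that are transported by
the flow, and a fixed set of triples of nodes, which span at each time non-degenerate closed
triangles, any two of which meet in the convex hull of their common nodes (nothing, a node or an
edge). -/
structure Mesh {T : ℝ} (S : EvolvingSurface T) where
  numNodes : ℕ
  node₀ : Fin numNodes → E3
  triangles : Finset (Finset (Fin numNodes))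
  node₀_mem : ∀ i, node₀ i ∈ S.initial.carrier
  card_triangle : ∀ K ∈ triangles, K.card = 3
  node_used : ∀ i, ∃ K ∈ triangles, i ∈ K
  nondegenerate : ∀ t ∈ Icc 0 T, ∀ K ∈ triangles,
    AffineIndependent ℝ (fun i : K => S.flow (node₀ i) t)
  conforming : ∀ t ∈ Icc 0 T, ∀ K ∈ triangles, ∀ L ∈ triangles,
    convexHull ℝ ((fun i => S.flow (node₀ i) t) '' (K : Set (Fin numNodes))) ∩
      convexHull ℝ ((fun i => S.flow (node₀ i) t) '' (L : Set (Fin numNodes))) =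
    convexHull ℝ ((fun i => S.flow (node₀ i) t) '' ((K ∩ L : Finset _) : Set (Fin numNodes)))

namespace Mesh

variable {T : ℝ} {S : EvolvingSurface T} (M : Mesh S)

/-- The node `x_i(t)`, the solution of `x_i' = V(x_i, t)`. -/
def node (t : ℝ) (i : Fin M.numNodes) : E3 := S.flow (M.node₀ i) t

/-- The triangle `K(t)`. -/
def cell (t : ℝ) (K : Finset (Fin M.numNodes)) : Set E3 :=
  convexHull ℝ (M.node t '' (K : Set (Fin M.numNodes)))

/-- `Γ_h(t)`, the union of the triangles. -/
def surface (t : ℝ) : Set E3 := ⋃ K ∈ M.triangles, M.cell t K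

/-- The discrete space-time surface, with the time as first coordinate. -/
def spaceTime : Set (ℝ × E3) := {q | q.1 ∈ Icc 0 T ∧ q.2 ∈ M.surface q.1}

/-- The mesh size `h = sup_t max_K diam K(t)`. -/
def size : ℝ := sSup {d | ∃ t ∈ Icc 0 T, ∃ K ∈ M.triangles, d = Metric.diam (M.cell t K)}

/-- `w` is a vector of barycentric coordinates with respect to the nodes of some triangle. -/
def IsWeight (w : Fin M.numNodes → ℝ) : Prop :=
  (∀ i, 0 ≤ w i) ∧ ∑ i, w i = 1 ∧ ∃ K ∈ M.triangles, ∀ i, i ∉ K → w i = 0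

open Classical in
/-- The nodal basis functions: `M.basis t x i = φ_i(x, t)`. For `x ∈ Γ_h(t)` these are the
barycentric coordinates of `x` in a triangle that contains it (they are unique). -/
def basis (t : ℝ) (x : E3) : Fin M.numNodes → ℝ :=
  if h : ∃ w, M.IsWeight w ∧ ∑ i, w i • M.node t i = x then h.choose else 0

/-- The Lagrange interpolation operator `I_h`. -/
def interp (t : ℝ) (η : E3 → ℝ) (x : E3) : ℝ := ∑ i, η (M.node t i) * M.basis t x i

/-- The discrete velocity `V_h = ∑ V(x_i(t), t) φ_i`. -/
def discreteVelocity (t : ℝ) (x : E3) : E3 := ∑ i, M.basis t x i • S.velocity t (M.node t i)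

/-- The discrete flow from `Γ_h(t)` to `Γ_h(s)`: the position at time `s` of the material point
that is at `x` at time `t`. -/
def discreteFlow (t s : ℝ) (x : E3) : E3 := ∑ i, M.basis t x i • M.node s i

/-- The discrete material derivative: the time derivative along the discrete flow. -/
def matDeriv (U : ℝ → E3 → ℝ) (t : ℝ) (x : E3) : ℝ :=
  derivWithin (fun s => U s (M.discreteFlow t s x)) (Icc 0 T) t

/-- The finite element space `S_h(t)`. -/
def IsFE (t : ℝ) (η : E3 → ℝ) : Prop :=
  ContinuousOn η (M.surface t) ∧
    ∀ K ∈ M.triangles, ∃ l : E3 →ᵃ[ℝ] ℝ, EqOn η l (M.cell t K)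

/-- The space of `z_h ∈ C(𝒮_{h,T})` with `z_h(t) ∈ S_h(t)` for all `t ∈ [0,T]`. -/
def IsContinuousFE (z : ℝ → E3 → ℝ) : Prop :=
  ContinuousOn (fun q : ℝ × E3 => z q.1 q.2) M.spaceTime ∧ ∀ t ∈ Icc 0 T, M.IsFE t (z t)

/-- The subspace of those `z_h` whose discrete material derivative exists and is continuous. -/
def IsC1FE (z : ℝ → E3 → ℝ) : Prop :=
  M.IsContinuousFE z ∧
  (∀ t ∈ Icc 0 T, ∀ x ∈ M.surface t,
    DifferentiableWithinAt ℝ (fun s => z s (M.discreteFlow t s x)) (Icc 0 T) t) ∧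
  ContinuousOn (fun q : ℝ × E3 => M.matDeriv z q.1 q.2) M.spaceTime

open Classical in
/-- The tangential gradient on `K(t)` of a function that is affine on `K(t)`: the vector `g`
parallel to the plane of `K(t)` with `η(y) - η(x) = g · (y - x)` (it is unique). -/
def grad (t : ℝ) (K : Finset (Fin M.numNodes)) (η : E3 → ℝ) : E3 :=
  if h : ∃ g ∈ (affineSpan ℝ (M.cell t K)).direction,
      ∀ x ∈ M.cell t K, ∀ y ∈ M.cell t K, η y - η x = inner ℝ g (y - x)
  then h.choose else 0

/-- The tangential divergence of the discrete velocity on `K(t)`. -/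
def divVelocity (t : ℝ) (K : Finset (Fin M.numNodes)) : ℝ :=
  ∑ j : Fin 3, (M.grad t K (fun x => M.discreteVelocity t x j)) j

/-- The integral over `Γ_h(t)` of an elementwise defined function. -/
def integral (t : ℝ) (f : Finset (Fin M.numNodes) → E3 → ℝ) : ℝ :=
  ∑ K ∈ M.triangles, ∫ x in M.cell t K, f K x ∂area

/-- `m̄_h(η, ζ) = ∫ I_h(η ζ)`. -/
def mLumped (t : ℝ) (η ζ : E3 → ℝ) : ℝ :=
  M.integral t fun _ x => M.interp t (fun y => η y * ζ y) x

/-- `a_h(η, ζ) = ∫ ∇η · ∇ζ`. -/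
def a (t : ℝ) (η ζ : E3 → ℝ) : ℝ :=
  M.integral t fun K _ => inner ℝ (M.grad t K η) (M.grad t K ζ)

/-- `g_h(η, ζ) = ∫ η ζ ∇·V_h`. -/
def g (t : ℝ) (η ζ : E3 → ℝ) : ℝ :=
  M.integral t fun K x => η x * ζ x * M.divVelocity t K

/-- The regularised discrete Ginzburg-Landau energy. -/
def energyReg (ε θ δ t : ℝ) (U : E3 → ℝ) : ℝ :=
  M.integral t fun K x =>
    ε * ‖M.grad t K U‖ ^ 2 / 2 + 1 / ε * M.interp t (fun y => potentialReg θ δ (U y)) x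

/-- The set `𝓘_{h,0}` of admissible discrete initial data. -/
def IsAdmissibleDatum (ε θ : ℝ) (U₀ : E3 → ℝ) : Prop :=
  M.IsFE 0 U₀ ∧
  (∀ᵐ x ∂area.restrict (M.surface 0), |U₀ x| ≤ 1) ∧
  (∀ K ∈ M.triangles, IntegrableOn (fun x =>
    ε * ‖M.grad 0 K U₀‖ ^ 2 / 2 + 1 / ε * M.interp 0 (fun y => potential θ (U₀ y)) x)
    (M.cell 0 K) area) ∧
  |(M.integral 0 fun _ x => U₀ x) / (M.integral 0 fun _ _ => 1)| < 1

/-- The lift `η^ℓ` onto `Γ(t)` of a function `η` on `Γ_h(t)`: `η^ℓ(p(x)) = η(x)`. -/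
def lift (t : ℝ) (η : E3 → ℝ) (y : E3) : ℝ :=
  η (Function.invFunOn (proj (S.at t)) (M.surface t) y)

/-- `‖u₀ - U₀^ℓ‖_{L²(Γ₀)} + h ‖u₀ - U₀^ℓ‖_{H¹(Γ₀)} ≤ C₀ h²`. -/
def Approximates (C₀ : ℝ) (u₀ U₀ : E3 → ℝ) : Prop :=
  ∃ G : E3 → E3, S.initial.HasWeakGradient (fun y => u₀ y - M.lift 0 U₀ y) G ∧
    S.initial.normL2 (fun y => u₀ y - M.lift 0 U₀ y)
      + M.size * S.initial.normH1 (fun y => u₀ y - M.lift 0 U₀ y) G ≤ C₀ * M.size ^ 2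

/-- The standing assumptions on the evolving triangulation, for all `t ∈ [0,T]`. -/
structure Assumptions (ρ : ℝ) : Prop where
  /-- uniform quasi-uniformity -/
  quasiUniform : ∀ t ∈ Icc 0 T, ∀ K ∈ M.triangles, ρ * M.size ≤ inDiameter (M.cell t K)
  /-- `Γ_h(t)` lies in a tubular neighbourhood of `Γ(t)` -/
  tubular : ∀ t ∈ Icc 0 T, ∃ r, IsTubular (S.at t) r ∧ M.surface t ⊆ tube (S.at t) r
  /-- exactness: the lifted triangles form a conforming subdivision of `Γ(t)`, that is, the normal
  projection maps `Γ_h(t)` bijectively onto `Γ(t)` -/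
  exact : ∀ t ∈ Icc 0 T, BijOn (proj (S.at t)) (M.surface t) (S.at t)
  /-- no angle of a triangle exceeds `π / 2` -/
  acute : ∀ t ∈ Icc 0 T, ∀ K ∈ M.triangles, ∀ i ∈ K, ∀ j ∈ K, ∀ k ∈ K, i ≠ j → j ≠ k → i ≠ k →
    EuclideanGeometry.angle (M.node t i) (M.node t j) (M.node t k) ≤ Real.pi / 2
  /-- the discrete velocity has non-negative tangential divergence -/
  expanding : ∀ t ∈ Icc 0 T, ∀ K ∈ M.triangles, 0 ≤ M.divVelocity t K

/-- `(U, W)` solves the regularised semi-discrete problem on `[0,T]` with initial datum `U₀`. -/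
structure IsSolution (ε θ δ : ℝ) (U₀ : E3 → ℝ) (U W : ℝ → E3 → ℝ) : Prop where
  regular_U : M.IsC1FE U
  regular_W : M.IsContinuousFE W
  eq_U : ∀ t ∈ Icc 0 T, ∀ φ, M.IsFE t φ →
    M.mLumped t (M.matDeriv U t) φ + M.g t (M.interp t fun y => U t y * φ y) (fun _ => 1)
      + M.a t (W t) φ = 0
  eq_W : ∀ t ∈ Icc 0 T, ∀ φ, M.IsFE t φ →
    M.mLumped t (W t) φ = ε * M.a t (U t) φ
      + θ / (2 * ε) * M.mLumped t (M.interp t fun y => fReg δ (U t y)) φ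
      - 1 / ε * M.mLumped t (U t) φ
  initial : EqOn (U 0) U₀ (M.surface 0)

end Mesh

end ESFEM

end

/-!
# The semi-discrete Cahn-Hilliard equation on an evolving triangulated surface

A finite element function is determined by its nodal values, and in terms of these the lumped mass
form is diagonal (`Mesh.mLumped_eq`, `Mesh.g_eq`). So the problem is equivalent to the system
`m_i u_i' = -m_i' u_i - a(w, e_i)`, `m_i w_i = ε a(u, e_i) + m_i (θ / (2ε) f^δ(u_i) - u_i / ε)`,
where `m_i' = ∫ φ_i ∇·V_h` is the derivative of the lumped mass `m_i` (`Mesh.IsSolution.nodal_eq`,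
`Mesh.isSolution_of_nodal`). The coefficients are continuous in time and `f^δ` is globally
Lipschitz, so this system has exactly one solution on `[0, T]` (`Mesh.exists_unique_solution`).

**Energy estimate.** Differentiating `ε/2 a(u, u) + 1/ε ∑ m_i F^δ(u_i)` along the solution gives
`-a(w, w)` and three terms to be estimated uniformly in `δ`.
* The time derivative of the form `a` is bounded by `a` itself, since the velocity is Lipschitz
  and the triangles are shape regular (`Mesh.ShapeBounds.hasDerivWithinAt_triangle`).
* The term `1/ε ∑ m_i' (F^δ(u_i) - u_i (F^δ)'(u_i))` is not absolutely bounded as `δ → 0`, but the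
  convexity of `F_log^δ` gives `F^δ(r) - r (F^δ)'(r) ≤ (1 + r²) / 2`, and `m_i' ≥ 0` because the
  divergence is non-negative.
* The term `-ε a(u, q u)` with `q_i = m_i' / m_i`. As `q_i` is a mean of the divergences on the
  triangles around the node `i`, it suffices that these differ by `O(h)`; then `∇(q u)` is `q ∇u`
  up to `O(|u|)` on each triangle, and `q ≥ 0` (`Mesh.ShapeBounds.energyBounds`).

Adding `1/ε ∑ m_i u_i²` makes the energy coercive, and Gronwall's inequality closes the estimate
(`Mesh.energy_le_of_energyBounds`).

**The divergence varies by `O(h)`.** On a triangle at the node `i` it is, up to `O(h)`, the trace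
of `DV(x_i)` over the plane of the triangle, so it suffices that neighbouring planes make an angle
`O(h)`. This is not read off from `Γ(t)`: the determinant of three edge vectors at `x_i` is
`O(h⁴)` at time `0`, because the nodes lie on the `C²` surface `Γ₀`, and it satisfies a linear
differential inequality along the flow (`Mesh.abs_inner_cross_edge_le`,
`Mesh.exists_shapeBounds`).

**The initial energy.** At the nodes `|U₀| ≤ 1`, so the potential energy is bounded by the area,
and only the Dirichlet energy remains. For small `h` the normal projection is bi-Lipschitz on each
initial triangle (`Mesh.exists_isBiLipschitzProj`). A difference of two nodal values of `U₀` is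
compared, along segments of half the length of the edge, with that of a smooth function `φ` which
is `h`-close to `u₀` in `L²` and has a comparable Dirichlet energy. The error is
`h⁻² ‖U₀^ℓ - φ‖² = O(1)`, and `φ` contributes the integral of its squared tangential gradient over
the projected triangles, which are disjoint (`Mesh.exists_stiff_le`).
-/

noncomputable section

namespace ESFEM

/-! ### The regularised logarithmic potential -/

/-- The nearest point of `[-(1 - δ), 1 - δ]` to `r`. -/
def clampReg (δ r : ℝ) : ℝ := max (-(1 - δ)) (min (1 - δ) r)

/-- `f^δ` in closed form: the derivative of `F_log` at the clamped point, continued linearly with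
the slope `F_log''(1 - δ) = 1 / δ + 1 / (2 - δ)`. -/
def fRegExplicit (δ r : ℝ) : ℝ :=
  (Real.log (1 + clampReg δ r) - Real.log (1 - clampReg δ r))
    + (1 / δ + 1 / (2 - δ)) * (r - clampReg δ r)

lemma clampReg_of_mem {δ r : ℝ} (h1 : -(1 - δ) ≤ r) (h2 : r ≤ 1 - δ) : clampReg δ r = r := by
  unfold clampReg; rw [min_eq_right h2, max_eq_right h1]

lemma clampReg_of_ge {δ r : ℝ} (hδ : δ ∈ Ioo (0 : ℝ) 1) (h : 1 - δ ≤ r) : clampReg δ r = 1 - δ := by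
  unfold clampReg; rw [min_eq_left h, max_eq_right (by linarith [hδ.2])]

lemma clampReg_of_le {δ r : ℝ} (h : r ≤ -(1 - δ)) : clampReg δ r = -(1 - δ) := by
  unfold clampReg; rw [max_eq_left]; exact (min_le_right _ _).trans h

lemma clampReg_mem {δ : ℝ} (hδ : δ ∈ Ioo (0 : ℝ) 1) (r : ℝ) :
    clampReg δ r ∈ Icc (-(1 - δ)) (1 - δ) :=
  ⟨le_max_left _ _, max_le (by linarith [hδ.2]) (min_le_left _ _)⟩

lemma clampReg_mono (δ : ℝ) : Monotone (clampReg δ) := fun _ _ h =>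
  max_le_max le_rfl (min_le_min le_rfl h)

lemma clampReg_sub_le {δ r s : ℝ} (h : r ≤ s) : clampReg δ s - clampReg δ r ≤ s - r := by
  unfold clampReg
  rcases max_cases (-(1 - δ)) (min (1 - δ) s) with ⟨h1, h2⟩ | ⟨h1, h2⟩ <;>
  rcases max_cases (-(1 - δ)) (min (1 - δ) r) with ⟨h3, h4⟩ | ⟨h3, h4⟩ <;>
  rcases min_cases (1 - δ) s with ⟨h5, h6⟩ | ⟨h5, h6⟩ <;>
  rcases min_cases (1 - δ) r with ⟨h7, h8⟩ | ⟨h7, h8⟩ <;> linarith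

lemma hasDerivAt_of_ge_of_le {f g k : ℝ → ℝ} {a d : ℝ} (hg : HasDerivAt g d a)
    (hk : HasDerivAt k d a) (h1 : ∀ x, a ≤ x → f x = g x) (h2 : ∀ᶠ x in 𝓝[≤] a, f x = k x) :
    HasDerivAt f d a := by
  have e1 : HasDerivWithinAt f d (Ici a) a :=
    hg.hasDerivWithinAt.congr (fun x hx => h1 x hx) (h1 a le_rfl)
  have e2 : HasDerivWithinAt f d (Iic a) a :=
    hk.hasDerivWithinAt.congr_of_eventuallyEq h2 (h2.self_of_nhdsWithin (mem_Iic.2 le_rfl))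
  have := e2.union e1
  rwa [Iic_union_Ici, hasDerivWithinAt_univ] at this

lemma hasDerivAt_log_branch {r : ℝ} (h1 : -1 < r) (h2 : r < 1) :
    HasDerivAt (fun r => (1 + r) * Real.log (1 + r) + (1 - r) * Real.log (1 - r))
      (Real.log (1 + r) - Real.log (1 - r)) r := by
  have a1 : HasDerivAt (fun r : ℝ => 1 + r) 1 r := by simpa using (hasDerivAt_id r).const_add 1
  have a2 : HasDerivAt (fun r : ℝ => 1 - r) (-1) r := by simpa using (hasDerivAt_id r).const_sub 1
  have n1 : (1 + r) ≠ 0 := by linarith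
  have n2 : (1 - r) ≠ 0 := by linarith
  have b1 := a1.mul (a1.log n1)
  have b2 := a2.mul (a2.log n2)
  refine (b1.add b2).congr_deriv ?_
  field_simp; ring

lemma hasDerivAt_upper_branch (δ r : ℝ) :
    HasDerivAt (fun r => (1 - r) * Real.log δ + (1 + r) * Real.log (2 - δ)
      + (1 - r) ^ 2 / (2 * δ) + (1 + r) ^ 2 / (2 * (2 - δ)) - 1)
      (-Real.log δ + Real.log (2 - δ) - (1 - r) / δ + (1 + r) / (2 - δ)) r := by
  have a1 : HasDerivAt (fun r : ℝ => 1 + r) 1 r := by simpa using (hasDerivAt_id r).const_add 1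
  have a2 : HasDerivAt (fun r : ℝ => 1 - r) (-1) r := by simpa using (hasDerivAt_id r).const_sub 1
  have := ((((a2.mul_const (Real.log δ)).add (a1.mul_const (Real.log (2 - δ)))).add
    ((a2.pow 2).div_const (2 * δ))).add ((a1.pow 2).div_const (2 * (2 - δ)))).sub_const 1
  refine this.congr_deriv ?_
  push_cast
  rw [show (2 * (1 - r) ^ (2 - 1) * -1 : ℝ) = 2 * -(1 - r) by ring,
    show (2 * (1 + r) ^ (2 - 1) * 1 : ℝ) = 2 * (1 + r) by ring,
    mul_div_mul_left _ _ two_ne_zero, mul_div_mul_left _ _ two_ne_zero]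
  ring

lemma hasDerivAt_lower_branch (δ r : ℝ) :
    HasDerivAt (fun r => (1 + r) * Real.log δ + (1 - r) * Real.log (2 - δ)
      + (1 + r) ^ 2 / (2 * δ) + (1 - r) ^ 2 / (2 * (2 - δ)) - 1)
      (-(-Real.log δ + Real.log (2 - δ) - (1 + r) / δ + (1 - r) / (2 - δ))) r := by
  have h := (hasDerivAt_upper_branch δ (-r)).scomp r (hasDerivAt_neg r)
  have e : ((fun r => (1 - r) * Real.log δ + (1 + r) * Real.log (2 - δ)
      + (1 - r) ^ 2 / (2 * δ) + (1 + r) ^ 2 / (2 * (2 - δ)) - 1) ∘ Neg.neg) = (fun r : ℝ =>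
      (1 + r) * Real.log δ + (1 - r) * Real.log (2 - δ)
      + (1 + r) ^ 2 / (2 * δ) + (1 - r) ^ 2 / (2 * (2 - δ)) - 1) := by
    funext x; simp only [Function.comp]; ring_nf
  rw [e] at h
  refine h.congr_deriv ?_
  simp only [smul_eq_mul]; ring

/-- At the points `±(1 - δ)`, where two branches meet, the one-sided derivatives agree. -/
theorem hasDerivAt_FlogReg {δ : ℝ} (hδ : δ ∈ Ioo (0 : ℝ) 1) (r : ℝ) :
    HasDerivAt (FlogReg δ) (fRegExplicit δ r) r := by
  obtain ⟨h0, h1⟩ := hδ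
  have n0 : δ ≠ 0 := h0.ne'
  have n2 : 2 - δ ≠ 0 := by linarith
  rcases lt_trichotomy r (1 - δ) with h | h | h
  · rcases lt_trichotomy r (-(1 - δ)) with g | g | g
    · have e : fRegExplicit δ r =
          -(-Real.log δ + Real.log (2 - δ) - (1 + r) / δ + (1 - r) / (2 - δ)) := by
        unfold fRegExplicit
        rw [clampReg_of_le g.le]
        rw [show 1 + -(1 - δ) = δ by ring, show 1 - -(1 - δ) = 2 - δ by ring]
        field_simp; ring
      rw [e]
      refine (hasDerivAt_lower_branch δ r).congr_of_eventuallyEq ?_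
      filter_upwards [Iio_mem_nhds g] with x hx
      have hx : x < -(1 - δ) := hx
      unfold FlogReg
      rw [if_neg (by linarith), if_pos (by linarith)]
    · have e : fRegExplicit δ r = Real.log (1 + r) - Real.log (1 - r) := by
        unfold fRegExplicit
        rw [clampReg_of_mem g.ge h.le]; ring
      rw [e]
      refine hasDerivAt_of_ge_of_le (f := FlogReg δ)
        (g := fun x => if x < 1 - δ then
          (1 + x) * Real.log (1 + x) + (1 - x) * Real.log (1 - x) else FlogReg δ x)
        ((hasDerivAt_log_branch (by linarith) (by linarith)).congr_of_eventuallyEq ?_)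
        (k := _) (by
          refine (hasDerivAt_lower_branch δ r).congr_deriv ?_
          rw [g, show 1 + -(1 - δ) = δ by ring, show 1 - -(1 - δ) = 2 - δ by ring]
          field_simp; ring) ?_ ?_
      · filter_upwards [Iio_mem_nhds h] with x hx
        exact if_pos hx
      · intro x hx
        split_ifs with hh
        · unfold FlogReg
          rw [if_neg (by linarith)]
          split_ifs with h3
          · have : x = -(1 - δ) := by linarith
            rw [this, show 1 + -(1 - δ) = δ by ring, show 1 - -(1 - δ) = 2 - δ by ring]
            field_simp; ring
          · rfl
        · rfl
      · filter_upwards [self_mem_nhdsWithin] with x hx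
        have hx : x ≤ r := hx
        unfold FlogReg
        rw [if_neg (by linarith), if_pos (by linarith)]
    · have e : fRegExplicit δ r = Real.log (1 + r) - Real.log (1 - r) := by
        unfold fRegExplicit
        rw [clampReg_of_mem g.le h.le]; ring
      rw [e]
      refine (hasDerivAt_log_branch (by linarith) (by linarith)).congr_of_eventuallyEq ?_
      filter_upwards [Iio_mem_nhds h, Ioi_mem_nhds g] with x hx hx'
      have hx : x < 1 - δ := hx
      have hx' : -(1 - δ) < x := hx'
      unfold FlogReg
      rw [if_neg (by linarith), if_neg (by linarith)]
  · have e : fRegExplicit δ r = Real.log (1 + r) - Real.log (1 - r) := by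
      unfold fRegExplicit
      rw [clampReg_of_mem (by linarith) h.le]; ring
    rw [e]
    refine hasDerivAt_of_ge_of_le (f := FlogReg δ) (g := _) (by
          refine (hasDerivAt_upper_branch δ r).congr_deriv ?_
          rw [h, show 1 + (1 - δ) = 2 - δ by ring, show 1 - (1 - δ) = δ by ring]
          field_simp; ring) (hasDerivAt_log_branch (by linarith) (by linarith)) ?_ ?_
    · intro x hx
      unfold FlogReg
      rw [if_pos (by linarith)]
    · filter_upwards [self_mem_nhdsWithin,
        mem_nhdsWithin_of_mem_nhds (Ioi_mem_nhds (show -(1 - δ) < r by linarith))] with x hx hx'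
      have hx : x ≤ r := hx
      have hx' : -(1 - δ) < x := hx'
      unfold FlogReg
      split_ifs with h3 h4
      · have : x = 1 - δ := by linarith
        rw [this, show 1 + (1 - δ) = 2 - δ by ring, show 1 - (1 - δ) = δ by ring]
        field_simp; ring
      · linarith
      · rfl
  · have e : fRegExplicit δ r =
        -Real.log δ + Real.log (2 - δ) - (1 - r) / δ + (1 + r) / (2 - δ) := by
      unfold fRegExplicit
      rw [clampReg_of_ge ⟨h0, h1⟩ h.le]
      rw [show 1 + (1 - δ) = 2 - δ by ring, show 1 - (1 - δ) = δ by ring]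
      field_simp; ring
    rw [e]
    refine (hasDerivAt_upper_branch δ r).congr_of_eventuallyEq ?_
    filter_upwards [Ioi_mem_nhds h] with x hx
    have hx : 1 - δ < x := hx
    unfold FlogReg
    rw [if_pos (by linarith)]

lemma fReg_eq {δ : ℝ} (hδ : δ ∈ Ioo (0 : ℝ) 1) (r : ℝ) : fReg δ r = fRegExplicit δ r :=
  (hasDerivAt_FlogReg hδ r).deriv

lemma hasDerivAt_FlogReg' {δ : ℝ} (hδ : δ ∈ Ioo (0 : ℝ) 1) (r : ℝ) :
    HasDerivAt (FlogReg δ) (fReg δ r) r := by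
  rw [fReg_eq hδ]; exact hasDerivAt_FlogReg hδ r

/-- `f^δ` is non-decreasing, since `F_log^δ` is convex, and Lipschitz, since its logarithms are only
evaluated on `[δ, ∞)`. -/
lemma fReg_sub {δ : ℝ} (hδ : δ ∈ Ioo (0 : ℝ) 1) {r s : ℝ} (h : r ≤ s) :
    0 ≤ fReg δ s - fReg δ r ∧ fReg δ s - fReg δ r ≤ 4 / δ * (s - r) := by
  have ⟨h0, h1⟩ := hδ
  rw [fReg_eq hδ, fReg_eq hδ]
  unfold fRegExplicit
  have hc1 := clampReg_mem hδ r
  have hc2 := clampReg_mem hδ s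
  have hm := clampReg_mono δ h
  have hl := clampReg_sub_le (δ := δ) h
  set c := clampReg δ r
  set d := clampReg δ s
  have p1 : δ ≤ 1 + c := by linarith [hc1.1]
  have p2 : δ ≤ 1 + d := by linarith [hc2.1]
  have p3 : δ ≤ 1 - c := by linarith [hc1.2]
  have p4 : δ ≤ 1 - d := by linarith [hc2.2]
  have key : ∀ a b : ℝ, δ ≤ a → a ≤ b → 0 ≤ Real.log b - Real.log a ∧
      Real.log b - Real.log a ≤ 1 / δ * (b - a) := by
    intro a b ha hab
    have ha0 : 0 < a := h0.trans_le ha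
    have hb0 : 0 < b := ha0.trans_le hab
    refine ⟨sub_nonneg.2 (Real.log_le_log ha0 hab), ?_⟩
    rw [← Real.log_div hb0.ne' ha0.ne']
    have := Real.log_le_sub_one_of_pos (div_pos hb0 ha0)
    have e : b / a - 1 = (b - a) / a := by field_simp
    rw [e] at this
    refine this.trans ?_
    rw [one_div, inv_mul_eq_div]
    exact div_le_div_of_nonneg_left (by linarith) h0 ha
  obtain ⟨k1, k2⟩ := key (1 + c) (1 + d) p1 (by linarith)
  obtain ⟨k3, k4⟩ := key (1 - d) (1 - c) p4 (by linarith)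
  have hi : 1 / (2 - δ) ≤ 1 / δ := one_div_le_one_div_of_le h0 (by linarith)
  have hi0 : 0 < 1 / (2 - δ) := by apply one_div_pos.2; linarith
  have hi1 : 0 < 1 / δ := one_div_pos.2 h0
  have e4 : 4 / δ = 4 * (1 / δ) := by ring
  rw [e4]
  set a := 1 / δ
  set b := 1 / (2 - δ)
  constructor
  · nlinarith [mul_nonneg (add_pos hi1 hi0).le (sub_nonneg.2 hl)]
  · nlinarith [mul_nonneg (sub_nonneg.2 hi) (sub_nonneg.2 hl), mul_nonneg hi1.le (sub_nonneg.2 hl),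
      mul_nonneg hi1.le (sub_nonneg.2 hm), mul_nonneg hi1.le (sub_nonneg.2 h)]

lemma abs_fReg_sub_le {δ : ℝ} (hδ : δ ∈ Ioo (0 : ℝ) 1) (r s : ℝ) :
    |fReg δ s - fReg δ r| ≤ 4 / δ * |s - r| := by
  rcases le_total r s with h | h
  · have := fReg_sub hδ h
    rw [abs_of_nonneg this.1, abs_of_nonneg (sub_nonneg.2 h)]
    exact this.2
  · have := fReg_sub hδ h
    rw [abs_sub_comm, abs_sub_comm s, abs_of_nonneg this.1, abs_of_nonneg (sub_nonneg.2 h)]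
    exact this.2

lemma continuous_fReg {δ : ℝ} (hδ : δ ∈ Ioo (0 : ℝ) 1) : Continuous (fReg δ) := by
  refine (LipschitzWith.of_dist_le_mul (K := (4 / δ).toNNReal) fun x y => ?_).continuous
  rw [Real.coe_toNNReal _ (by have := hδ.1; positivity), Real.dist_eq, Real.dist_eq]
  exact abs_fReg_sub_le hδ _ _

lemma fReg_zero {δ : ℝ} (hδ : δ ∈ Ioo (0 : ℝ) 1) : fReg δ 0 = 0 := by
  rw [fReg_eq hδ]; unfold fRegExplicit
  rw [clampReg_of_mem (by linarith [hδ.2]) (by linarith [hδ.2])]; simp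

lemma FlogReg_zero {δ : ℝ} (hδ : δ ∈ Ioo (0 : ℝ) 1) : FlogReg δ 0 = 0 := by
  unfold FlogReg
  rw [if_neg (by linarith [hδ.2]), if_neg (by linarith [hδ.2])]; simp

/-- `F_log^δ` is convex with the minimum `0` at `0`; the upper bound
compares it at `0` with its tangent at `r`. -/
theorem FlogReg_nonneg_and_le {δ : ℝ} (hδ : δ ∈ Ioo (0 : ℝ) 1) (r : ℝ) :
    0 ≤ FlogReg δ r ∧ FlogReg δ r ≤ r * fReg δ r := by
  have hc : Continuous (FlogReg δ) :=
    continuous_iff_continuousAt.2 fun x => (hasDerivAt_FlogReg' hδ x).continuousAt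
  rcases lt_trichotomy r 0 with h | h | h
  · obtain ⟨ξ, hξ, e⟩ := exists_hasDerivAt_eq_slope (FlogReg δ) (fReg δ) h hc.continuousOn
      fun x _ => hasDerivAt_FlogReg' hδ x
    rw [FlogReg_zero hδ, eq_div_iff (by linarith)] at e
    have m1 := (fReg_sub hδ hξ.1.le).1
    have m2 := (fReg_sub hδ hξ.2.le).1
    rw [fReg_zero hδ] at m2
    constructor <;> nlinarith
  · rw [h, FlogReg_zero hδ]; simp
  · obtain ⟨ξ, hξ, e⟩ := exists_hasDerivAt_eq_slope (FlogReg δ) (fReg δ) h hc.continuousOn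
      fun x _ => hasDerivAt_FlogReg' hδ x
    rw [FlogReg_zero hδ, eq_div_iff (by linarith)] at e
    have m1 := (fReg_sub hδ hξ.1.le).1
    have m2 := (fReg_sub hδ hξ.2.le).1
    rw [fReg_zero hδ] at m1
    constructor <;> nlinarith

/-- On `[-1, 1]` the regularised potential is bounded uniformly in `δ`: the terms `(1 - r)² / (2δ)`
only occur where `1 - r ≤ δ`, and likewise near `-1`. -/
lemma FlogReg_le_of_abs_le {δ : ℝ} (hδ : δ ∈ Ioo (0 : ℝ) 1) {r : ℝ} (hr : |r| ≤ 1) :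
    FlogReg δ r ≤ 5 := by
  obtain ⟨h0, h1⟩ := hδ
  obtain ⟨r1, r2⟩ := abs_le.1 hr
  have l0 : Real.log δ ≤ 0 := Real.log_nonpos h0.le h1.le
  have l1 : Real.log (2 - δ) ≤ 1 := by
    have := Real.log_le_sub_one_of_pos (show 0 < 2 - δ by linarith); linarith
  have l2 : 0 ≤ Real.log (2 - δ) := Real.log_nonneg (by linarith)
  have main : ∀ s : ℝ, 1 - δ ≤ s → s ≤ 1 → (1 - s) * Real.log δ + (1 + s) * Real.log (2 - δ)
      + (1 - s) ^ 2 / (2 * δ) + (1 + s) ^ 2 / (2 * (2 - δ)) - 1 ≤ 5 := by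
    intro s s1 s2
    have a1 : (1 - s) * Real.log δ ≤ 0 := mul_nonpos_of_nonneg_of_nonpos (by linarith) l0
    have a2 : (1 + s) * Real.log (2 - δ) ≤ 2 := by nlinarith
    have a3 : (1 - s) ^ 2 / (2 * δ) ≤ 1 := by
      rw [div_le_one (by linarith)]; nlinarith
    have a4 : (1 + s) ^ 2 / (2 * (2 - δ)) ≤ 2 := by
      rw [div_le_iff₀ (by linarith)]; nlinarith
    linarith
  unfold FlogReg
  split_ifs with g1 g2
  · exact main r g1 r2
  · have := main (-r) (by linarith) (by linarith)
    simp only [sub_neg_eq_add, ← sub_eq_add_neg] at this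
    exact this
  · have b1 : (1 + r) * Real.log (1 + r) ≤ 2 := by
      have := Real.log_le_sub_one_of_pos (show 0 < 1 + r by linarith)
      nlinarith
    have b2 : (1 - r) * Real.log (1 - r) ≤ 2 := by
      have := Real.log_le_sub_one_of_pos (show 0 < 1 - r by linarith)
      nlinarith
    linarith

/-! ### Ordinary differential equations on a compact time interval -/

lemma hasDerivWithinAt_Ici_of_Icc {E : Type*} [NormedAddCommGroup E] [NormedSpace ℝ E]
    {f : ℝ → E} {f' : E} {a b t : ℝ} (ht : t ∈ Ico a b) (h : HasDerivWithinAt f f' (Icc a b) t) :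
    HasDerivWithinAt f f' (Ici t) t :=
  h.mono_of_mem_nhdsWithin (Icc_mem_nhdsGE_of_mem ht)

/-- Gronwall's inequality for a vector valued function on `[0, T]`, with an explicit bound. -/
lemma norm_le_of_norm_deriv_le {E : Type*} [NormedAddCommGroup E] [NormedSpace ℝ E]
    {f f' : ℝ → E} {T K δ η : ℝ} (hK : 0 ≤ K) (hδ : 0 ≤ δ) (hη : 0 ≤ η)
    (hf : ∀ t ∈ Icc 0 T, HasDerivWithinAt f (f' t) (Icc 0 T) t) (h0 : ‖f 0‖ ≤ δ)
    (hb : ∀ t ∈ Icc 0 T, ‖f' t‖ ≤ K * ‖f t‖ + η) :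
    ∀ t ∈ Icc 0 T, ‖f t‖ ≤ (δ + η * T) * Real.exp ((K + 1) * T) := by
  intro t ht
  have hT : 0 ≤ T := ht.1.trans ht.2
  have h := norm_le_gronwallBound_of_norm_deriv_right_le (f := f) (f' := f') (δ := δ)
    (K := K + 1) (ε := η) (a := 0) (b := T) (fun t ht => (hf t ht).continuousWithinAt)
    (fun t ht => hasDerivWithinAt_Ici_of_Icc ht (hf t ⟨ht.1, ht.2.le⟩)) h0
    (fun t ht => (hb t ⟨ht.1, ht.2.le⟩).trans (by nlinarith [norm_nonneg (f t)])) t ht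
  refine h.trans ?_
  rw [gronwallBound_of_K_ne_0 (by linarith), sub_zero]
  have e1 : Real.exp ((K + 1) * t) ≤ Real.exp ((K + 1) * T) :=
    Real.exp_le_exp.2 (by nlinarith [ht.2])
  have e2 : Real.exp ((K + 1) * t) - 1 ≤ (K + 1) * t * Real.exp ((K + 1) * t) := by
    have := Real.add_one_le_exp (-((K + 1) * t))
    have p := Real.exp_pos ((K + 1) * t)
    have q : Real.exp ((K + 1) * t) * Real.exp (-((K + 1) * t)) = 1 := by
      rw [← Real.exp_add]; simp
    nlinarith
  have e3 : η / (K + 1) * (Real.exp ((K + 1) * t) - 1) ≤ η * T * Real.exp ((K + 1) * T) := by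
    have hK1 : 0 < K + 1 := by linarith
    rw [div_mul_eq_mul_div, div_le_iff₀ hK1]
    calc η * (Real.exp ((K + 1) * t) - 1) ≤ η * ((K + 1) * t * Real.exp ((K + 1) * t)) := by gcongr
      _ ≤ η * ((K + 1) * T * Real.exp ((K + 1) * T)) := by
          have := ht.2
          gcongr
      _ = _ := by ring
  nlinarith

/-- Gronwall's inequality for a differential inequality `Z' ≤ C (1 + Z)` on `[0, T]`. -/
lemma one_add_le_of_deriv_le {Z Z' : ℝ → ℝ} {T C : ℝ}
    (hZ : ∀ t ∈ Icc 0 T, HasDerivWithinAt Z (Z' t) (Icc 0 T) t)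
    (hb : ∀ t ∈ Icc 0 T, Z' t ≤ C * (1 + Z t)) :
    ∀ t ∈ Icc 0 T, 1 + Z t ≤ (1 + Z 0) * Real.exp (C * t) := by
  intro t ht
  have hc : ∀ x ∈ Icc 0 T, HasDerivWithinAt (fun t => (1 + Z t) * Real.exp (-(C * t)))
      ((Z' x) * Real.exp (-(C * x)) + (1 + Z x) * (Real.exp (-(C * x)) * (-C))) (Icc 0 T) x := by
    intro x hx
    have a : HasDerivAt (fun x : ℝ => -(C * x)) (-C) x := by
      exact (((hasDerivAt_id x).const_mul C).neg).congr_deriv (by simp)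
    exact ((hZ x hx).const_add 1).mul a.exp.hasDerivWithinAt
  have hanti : AntitoneOn (fun t => (1 + Z t) * Real.exp (-(C * t))) (Icc 0 T) := by
    refine antitoneOn_of_deriv_nonpos (convex_Icc 0 T)
      (fun x hx => (hc x hx).continuousWithinAt) ?_ ?_
    · intro x hx
      rw [interior_Icc] at hx ⊢
      exact ((hc x ⟨hx.1.le, hx.2.le⟩).hasDerivAt
        (Icc_mem_nhds hx.1 hx.2)).differentiableAt.differentiableWithinAt
    · intro x hx
      rw [interior_Icc] at hx
      rw [((hc x ⟨hx.1.le, hx.2.le⟩).hasDerivAt (Icc_mem_nhds hx.1 hx.2)).deriv]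
      nlinarith [hb x ⟨hx.1.le, hx.2.le⟩, Real.exp_pos (-(C * x))]
  have h := hanti ⟨le_rfl, ht.1.trans ht.2⟩ ht ht.1
  simp only [mul_zero, neg_zero, Real.exp_zero, mul_one] at h
  rw [Real.exp_neg, ← div_eq_mul_inv, div_le_iff₀ (Real.exp_pos _)] at h
  exact h

/-- A vector field on `ℝⁿ` that is globally Lipschitz in space and continuous in time has solutions
on the whole time interval: it is truncated outside a ball that Gronwall's inequality shows the
solution of the truncated equation does not leave. -/
theorem exists_solution_of_lipschitz {n : ℕ} {f : ℝ → (Fin n → ℝ) → (Fin n → ℝ)} {T K : ℝ}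
    (hT : 0 < T) (hK : 0 ≤ K)
    (hl : ∀ t ∈ Icc 0 T, ∀ x y, ‖f t x - f t y‖ ≤ K * ‖x - y‖)
    (hc : ∀ x, ContinuousOn (fun t => f t x) (Icc 0 T)) (x₀ : Fin n → ℝ) :
    ∃ α : ℝ → Fin n → ℝ, α 0 = x₀ ∧
      ∀ t ∈ Icc 0 T, HasDerivWithinAt α (f t (α t)) (Icc 0 T) t := by
  obtain ⟨M, hM⟩ : ∃ M, ∀ t ∈ Icc 0 T, ‖f t 0‖ ≤ M :=
    isCompact_Icc.exists_bound_of_continuousOn (hc 0)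
  have hM0 : 0 ≤ M := (norm_nonneg _).trans (hM 0 ⟨le_rfl, hT.le⟩)
  have hf : ∀ t ∈ Icc 0 T, ∀ x, ‖f t x‖ ≤ K * ‖x‖ + M := fun t ht x => by
    have := hl t ht x 0
    rw [sub_zero] at this
    calc ‖f t x‖ = ‖(f t x - f t 0) + f t 0‖ := by rw [sub_add_cancel]
      _ ≤ _ := (norm_add_le _ _).trans (add_le_add this (hM t ht))
  set R : ℝ := (‖x₀‖ + M * T) * Real.exp ((K + 1) * T) with hR
  have hR0 : 0 ≤ R := by positivity
  let c : (Fin n → ℝ) → (Fin n → ℝ) := fun x i => max (-R) (min R (x i))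
  have hcl : ∀ x y, ‖c x - c y‖ ≤ ‖x - y‖ := by
    intro x y
    rw [pi_norm_le_iff_of_nonneg (norm_nonneg _)]
    intro i
    refine le_trans ?_ (norm_le_pi_norm (x - y) i)
    simp only [Pi.sub_apply, Real.norm_eq_abs, c]
    refine (abs_max_sub_max_le_max _ _ _ _).trans ?_
    simp only [sub_self, abs_zero]
    refine max_le (abs_nonneg _) ((abs_min_sub_min_le_max _ _ _ _).trans ?_)
    simp
  have hcn : ∀ x, ‖c x‖ ≤ R := by
    intro x
    rw [pi_norm_le_iff_of_nonneg hR0]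
    intro i
    simp only [c, Real.norm_eq_abs, abs_le]
    exact ⟨le_max_left _ _, max_le (by linarith) (min_le_left _ _)⟩
  have hcn' : ∀ x, ‖c x‖ ≤ ‖x‖ := by
    intro x
    have h0 : c 0 = 0 := by
      funext i; simp only [c, Pi.zero_apply]; rw [min_eq_right hR0, max_eq_right (by linarith)]
    have := hcl x 0
    rwa [h0, sub_zero, sub_zero] at this
  have hci : ∀ x, ‖x‖ ≤ R → c x = x := by
    intro x hx
    funext i
    have := (norm_le_pi_norm x i).trans hx
    rw [Real.norm_eq_abs, abs_le] at this
    simp only [c]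
    rw [min_eq_right this.2, max_eq_right this.1]
  have hPL : IsPicardLindelof (fun t x => f t (c x)) (tmin := 0) (tmax := T) ⟨0, le_rfl, hT.le⟩ x₀
      (((K * R + M) * T).toNNReal) 0 (K * R + M).toNNReal K.toNNReal := by
    refine ⟨?_, ?_, ?_, ?_⟩
    · intro t ht
      refine LipschitzOnWith.of_dist_le_mul fun x _ y _ => ?_
      rw [dist_eq_norm, dist_eq_norm, Real.coe_toNNReal _ hK]
      exact (hl t ht _ _).trans (mul_le_mul_of_nonneg_left (hcl x y) hK)
    · intro x _
      exact hc _
    · intro t ht x _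
      rw [Real.coe_toNNReal _ (by positivity)]
      refine (hf t ht _).trans ?_
      have := hcn x
      gcongr
    · simp only [sub_zero, sub_self]
      rw [max_eq_left hT.le, Real.coe_toNNReal _ (by positivity),
        Real.coe_toNNReal _ (by positivity)]
      simp
  obtain ⟨α, h0, hα⟩ := hPL.exists_eq_forall_mem_Icc_hasDerivWithinAt₀
  refine ⟨α, h0, fun t ht => ?_⟩
  have hb := norm_le_of_norm_deriv_le hK (norm_nonneg x₀) hM0 hα (by rw [← h0]) (fun t ht =>
    (hf t ht _).trans (by have := hcn' (α t); gcongr)) t ht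
  have := hα t ht
  rwa [hci _ hb] at this

/-- Solutions of an equation with a globally Lipschitz right hand side are unique. -/
theorem solution_unique_of_lipschitz {n : ℕ} {f : ℝ → (Fin n → ℝ) → (Fin n → ℝ)} {T K : ℝ}
    (hK : 0 ≤ K) (hl : ∀ t ∈ Icc 0 T, ∀ x y, ‖f t x - f t y‖ ≤ K * ‖x - y‖)
    {α β : ℝ → Fin n → ℝ} (h0 : α 0 = β 0)
    (hα : ∀ t ∈ Icc 0 T, HasDerivWithinAt α (f t (α t)) (Icc 0 T) t)
    (hβ : ∀ t ∈ Icc 0 T, HasDerivWithinAt β (f t (β t)) (Icc 0 T) t) :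
    EqOn α β (Icc 0 T) := by
  intro t ht
  have h := norm_le_of_norm_deriv_le (δ := 0) (η := 0) hK le_rfl le_rfl
    (fun t ht => (hα t ht).sub (hβ t ht)) (by simp [h0])
    (fun t ht => by simpa using hl t ht _ _) t ht
  simpa [sub_eq_zero] using h

/-! ### Geometry of a single triangle -/

/-- The Gram determinant of two vectors, the square of the area of the parallelogram. -/
def gramDet (e f : E3) : ℝ := ‖e‖ ^ 2 * ‖f‖ ^ 2 - inner ℝ e f ^ 2

/-- The vector in the plane of `e` and `f` that is orthogonal to `f` and has inner product `1` with
`e`: the gradient of the barycentric coordinate of the vertex `x + e` in the triangle with vertices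
`x`, `x + e`, `x + f`. -/
def dualVec (e f : E3) : E3 := (gramDet e f)⁻¹ • (‖f‖ ^ 2 • e - inner ℝ e f • f)

lemma gramDet_comm (e f : E3) : gramDet e f = gramDet f e := by
  unfold gramDet; rw [real_inner_comm]; ring

lemma inner_dualVec_left {e f : E3} (h : gramDet e f ≠ 0) : inner ℝ (dualVec e f) e = 1 := by
  unfold dualVec
  rw [inner_smul_left, inner_sub_left, inner_smul_left, inner_smul_left, real_inner_self_eq_norm_sq,
    real_inner_comm e f]
  simp only [conj_trivial]
  rw [inv_mul_eq_div, div_eq_one_iff_eq h]; unfold gramDet; ring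

lemma inner_dualVec_right (e f : E3) : inner ℝ (dualVec e f) f = 0 := by
  unfold dualVec
  rw [inner_smul_left, inner_sub_left, inner_smul_left, inner_smul_left, real_inner_self_eq_norm_sq]
  simp only [conj_trivial]
  ring

lemma gramDet_pos {e f : E3} (h : ∀ a b : ℝ, a • e + b • f = 0 → a = 0 ∧ b = 0) :
    0 < gramDet e f := by
  have hf : f ≠ 0 := by
    rintro rfl
    have := (h 0 1 (by simp)).2
    norm_num at this
  have hf' : 0 < ‖f‖ ^ 2 := by positivity
  have hv : ‖f‖ ^ 2 • e - inner ℝ e f • f ≠ 0 := by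
    intro h0
    have := (h (‖f‖ ^ 2) (-inner ℝ e f) (by rw [← h0]; module)).1
    exact hf'.ne' this
  have e1 : ‖‖f‖ ^ 2 • e - inner ℝ e f • f‖ ^ 2 = ‖f‖ ^ 2 * gramDet e f := by
    rw [← real_inner_self_eq_norm_sq]
    simp only [inner_sub_left, inner_sub_right, inner_smul_left, inner_smul_right,
      real_inner_self_eq_norm_sq, conj_trivial, real_inner_comm e f]
    unfold gramDet; ring
  have : 0 < ‖f‖ ^ 2 * gramDet e f := by rw [← e1]; positivity
  exact (mul_pos_iff_of_pos_left hf').1 this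

/-- The plane `ℝ²` of reference. -/
abbrev E2 : Type := EuclideanSpace ℝ (Fin 2)

/-- The reference triangle. -/
def refTriangle : Set E2 := {p | 0 ≤ p 0 ∧ 0 ≤ p 1 ∧ p 0 + p 1 ≤ 1}

/-- The linear map of `ℝ²` to `ℝ³` that sends the unit vectors to `e` and `f`. -/
def planeMap (e f : E3) : E2 →ₗ[ℝ] E3 :=
  { toFun := fun p => p 0 • e + p 1 • f
    map_add' := fun p q => by simp only [PiLp.add_apply]; module
    map_smul' := fun c p => by simp only [PiLp.smul_apply, smul_eq_mul, RingHom.id_apply]; module }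

lemma planeMap_apply (e f : E3) (p : E2) : planeMap e f p = p 0 • e + p 1 • f := rfl

lemma normDet_planeMap (e f : E3) : (planeMap e f).normDet = Real.sqrt (gramDet e f) := by
  have h := (planeMap e f).normDet_sq_eq_det_gram (EuclideanSpace.basisFun (Fin 2) ℝ)
  rw [Matrix.det_fin_two] at h
  simp only [Matrix.gram_apply, EuclideanSpace.basisFun_apply, planeMap_apply] at h
  simp only [PiLp.single_apply] at h
  norm_num at h
  have e : gramDet e f = (planeMap e f).normDet ^ 2 := by
    rw [h]; unfold gramDet; rw [real_inner_comm e f]; ring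
  rw [e, Real.sqrt_sq (LinearMap.normDet_nonneg _)]

/-- The affine parametrisation of the triangle with vertices `x`, `x + e`, `x + f`. -/
def triMap (x e f : E3) (p : E2) : E3 := x + (p 0 • e + p 1 • f)

lemma inner_triMap {x e f : E3} (h : gramDet e f ≠ 0) (p : E2) :
    inner ℝ (dualVec e f) (triMap x e f p - x) = p 0 ∧
      inner ℝ (dualVec f e) (triMap x e f p - x) = p 1 := by
  unfold triMap
  rw [add_sub_cancel_left, inner_add_right, inner_add_right, inner_smul_right, inner_smul_right,
    inner_smul_right, inner_smul_right, inner_dualVec_left h, inner_dualVec_right,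
    inner_dualVec_left (by rwa [gramDet_comm]), inner_dualVec_right]
  simp

lemma continuous_triMap (x e f : E3) : Continuous (triMap x e f) := by
  unfold triMap; fun_prop

lemma measurableEmbedding_triMap {x e f : E3} (h : gramDet e f ≠ 0) :
    MeasurableEmbedding (triMap x e f) := by
  have hi : Function.Injective (triMap x e f) := by
    intro p q hpq
    have h1 := inner_triMap (x := x) h p
    have h2 := inner_triMap (x := x) h q
    rw [hpq] at h1
    ext i
    fin_cases i
    · exact h1.1.symm.trans h2.1
    · exact h1.2.symm.trans h2.2
  exact (continuous_triMap x e f).measurableEmbedding hi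

lemma area_image_triMap (x e f : E3) (s : Set E2) :
    area (triMap x e f '' s) = ENNReal.ofReal (Real.sqrt (gramDet e f)) * volume s := by
  have h := (planeMap e f).euclideanHausdorffMeasure_image_eq_normDet_mul_volume s
  rw [normDet_planeMap, finrank_euclideanSpace, Fintype.card_fin] at h
  rw [← h]
  have e1 : triMap x e f '' s = (fun y => x + y) '' (planeMap e f '' s) := by
    rw [image_image]; rfl
  rw [e1]
  exact (IsometryEquiv.addLeft x).isometry.euclideanHausdorffMeasure_image _

lemma area_restrict_image_triMap {x e f : E3} (h : gramDet e f ≠ 0) {s : Set E2} :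
    area.restrict (triMap x e f '' s) = ENNReal.ofReal (Real.sqrt (gramDet e f)) •
      (volume.restrict s).map (triMap x e f) := by
  ext B hB
  have hm := measurableEmbedding_triMap (x := x) h
  rw [Measure.restrict_apply hB, Measure.smul_apply, hm.map_apply,
    Measure.restrict_apply (hm.measurable hB), smul_eq_mul, ← area_image_triMap x e f]
  congr 1
  rw [image_preimage_inter]

lemma setIntegral_image_triMap {x e f : E3} (h : gramDet e f ≠ 0) (s : Set E2) (F : E3 → ℝ) :
    ∫ y in triMap x e f '' s, F y ∂area =
      Real.sqrt (gramDet e f) * ∫ p in s, F (triMap x e f p) := by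
  rw [area_restrict_image_triMap h, integral_smul_measure,
    (measurableEmbedding_triMap h).integral_map, ENNReal.toReal_ofReal (Real.sqrt_nonneg _),
    smul_eq_mul]

lemma convexHull_triple_eq_image (x e f : E3) :
    convexHull ℝ {x, x + e, x + f} = triMap x e f '' refTriangle := by
  rw [convexHull_insert (by simp)]
  rw [convexHull_pair]
  ext y
  simp only [mem_convexJoin, mem_singleton_iff, exists_eq_left, mem_image, segment, mem_ofPred_eq]
  constructor
  · rintro ⟨z, ⟨a, b, ha, hb, hab, rfl⟩, c, d, hc, hd, hcd, rfl⟩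
    refine ⟨!₂[d * a, d * b], ⟨?_, ?_, ?_⟩, ?_⟩
    · simpa using mul_nonneg hd ha
    · simpa using mul_nonneg hd hb
    · simp only [Matrix.cons_val_zero, Matrix.cons_val_one]
      rw [← mul_add, hab]; linarith
    · unfold triMap
      simp only [Matrix.cons_val_zero, Matrix.cons_val_one]
      have hc' : c = 1 - d := by linarith
      have ha' : a = 1 - b := by linarith
      subst hc' ha'
      module
  · rintro ⟨p, ⟨h0, h1, h2⟩, rfl⟩
    rcases eq_or_lt_of_le (add_nonneg h0 h1) with h | h
    · have e0 : p 0 = 0 := by linarith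
      have e1 : p 1 = 0 := by linarith
      refine ⟨x + e, ⟨1, 0, by norm_num, le_rfl, by norm_num, by simp⟩, 1, 0, by norm_num, le_rfl,
        by norm_num, ?_⟩
      simp [triMap, e0, e1]
    · refine ⟨_, ⟨p 0 / (p 0 + p 1), p 1 / (p 0 + p 1), by positivity, by positivity,
        by field_simp, rfl⟩, 1 - (p 0 + p 1), p 0 + p 1, by linarith, h.le, by ring, ?_⟩
      rw [smul_add, smul_smul, smul_smul, mul_div_cancel₀ _ h.ne', mul_div_cancel₀ _ h.ne']
      unfold triMap
      module

lemma isCompact_refTriangle : IsCompact refTriangle := by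
  refine Metric.isCompact_of_isClosed_isBounded ?_ ?_
  · exact (isClosed_le (f := fun _ : E2 => (0 : ℝ)) (g := fun p => p 0) (by fun_prop)
      (by fun_prop)).inter ((isClosed_le (f := fun _ : E2 => (0 : ℝ)) (g := fun p => p 1)
      (by fun_prop) (by fun_prop)).inter (isClosed_le (f := fun p : E2 => p 0 + p 1)
      (g := fun _ => (1 : ℝ)) (by fun_prop) (by fun_prop)))
  · refine (Metric.isBounded_closedBall (x := (0 : E2)) (r := 2)).subset ?_
    rintro p ⟨h0, h1, h2⟩
    rw [mem_closedBall_zero_iff, EuclideanSpace.norm_eq, Real.sqrt_le_left (by norm_num)]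
    simp only [Fin.sum_univ_two, Real.norm_eq_abs, sq_abs]
    nlinarith

/-- The area of the reference triangle. -/
def refArea : ℝ := (volume refTriangle).toReal

lemma volume_refTriangle_ne_top : volume refTriangle ≠ ⊤ := isCompact_refTriangle.measure_lt_top.ne

lemma refArea_pos : 0 < refArea := by
  refine ENNReal.toReal_pos ?_ volume_refTriangle_ne_top
  have hsub : {p : E2 | 0 < p 0} ∩ ({p : E2 | 0 < p 1} ∩ {p : E2 | p 0 + p 1 < 1}) ⊆ refTriangle :=
    fun p hp => ⟨le_of_lt hp.1, le_of_lt hp.2.1, le_of_lt hp.2.2⟩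
  have ho : IsOpen ({p : E2 | 0 < p 0} ∩ ({p : E2 | 0 < p 1} ∩ {p : E2 | p 0 + p 1 < 1})) :=
    (isOpen_lt continuous_const (by fun_prop)).inter ((isOpen_lt continuous_const
      (by fun_prop)).inter (isOpen_lt (by fun_prop) continuous_const))
  have hne : ({p : E2 | 0 < p 0} ∩ ({p : E2 | 0 < p 1} ∩ {p : E2 | p 0 + p 1 < 1})).Nonempty :=
    ⟨!₂[1/4, 1/4], by refine ⟨?_, ?_, ?_⟩ <;> norm_num⟩
  exact ((ho.measure_pos volume hne).trans_le (measure_mono hsub)).ne'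

/-- The integral of the first coordinate over the reference triangle. Its value is not needed: it
drops out because the three barycentric coordinates have the same integral and add up to `1`. -/
def refMoment : ℝ := ∫ p in refTriangle, p 0

lemma triangle_eq (x y z : E3) :
    convexHull ℝ {x, y, z} = triMap x (y - x) (z - x) '' refTriangle := by
  rw [← convexHull_triple_eq_image]; simp

lemma area_triangle (x y z : E3) :
    area (convexHull ℝ {x, y, z}) =
      ENNReal.ofReal (refArea * Real.sqrt (gramDet (y - x) (z - x))) := by
  rw [triangle_eq, area_image_triMap, mul_comm, ENNReal.ofReal_mul refArea_pos.le, refArea,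
    ENNReal.ofReal_toReal volume_refTriangle_ne_top]

lemma area_triangle_toReal (x y z : E3) :
    (area (convexHull ℝ {x, y, z})).toReal =
      refArea * Real.sqrt (gramDet (y - x) (z - x)) := by
  rw [area_triangle, ENNReal.toReal_ofReal (mul_nonneg refArea_pos.le (Real.sqrt_nonneg _))]

/-- The integral over a triangle of the barycentric coordinate of its second vertex. -/
lemma setIntegral_triangle_inner {x y z : E3} (h : gramDet (y - x) (z - x) ≠ 0) :
    ∫ p in convexHull ℝ {x, y, z}, inner ℝ (dualVec (y - x) (z - x)) (p - x) ∂area =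
      refMoment * Real.sqrt (gramDet (y - x) (z - x)) := by
  rw [triangle_eq, setIntegral_image_triMap h, mul_comm]
  congr 1
  refine integral_congr_ae (Eventually.of_forall fun p => ?_)
  exact (inner_triMap h p).1

namespace Mesh

variable {T : ℝ} {S : EvolvingSurface T} {M : Mesh S}

/-! ### Barycentric coordinates and nodal basis functions -/

variable (M) in
/-- The combination of the nodes at time `t` with coefficients `w`. -/
def comb (t : ℝ) (w : Fin M.numNodes → ℝ) : E3 := ∑ i, w i • M.node t i

lemma comb_sub (t : ℝ) (w z : Fin M.numNodes → ℝ) :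
    M.comb t (w - z) = M.comb t w - M.comb t z := by
  unfold comb; simp only [Pi.sub_apply, sub_smul, Finset.sum_sub_distrib]

lemma comb_single (t : ℝ) (i : Fin M.numNodes) : M.comb t (Pi.single i 1) = M.node t i := by
  unfold comb
  rw [Finset.sum_eq_single i]
  · simp
  · intro j _ hj; simp [hj]
  · simp

lemma mem_cell_iff {t : ℝ} {K : Finset (Fin M.numNodes)} {x : E3} :
    x ∈ M.cell t K ↔ ∃ w : Fin M.numNodes → ℝ, (∀ i, 0 ≤ w i) ∧ ∑ i, w i = 1 ∧
      (∀ i, i ∉ K → w i = 0) ∧ M.comb t w = x := by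
  constructor
  · intro hx
    have hc : Convex ℝ {x | ∃ w : Fin M.numNodes → ℝ, (∀ i, 0 ≤ w i) ∧ ∑ i, w i = 1 ∧
      (∀ i, i ∉ K → w i = 0) ∧ M.comb t w = x} := by
      rintro _ ⟨w, h1, h2, h3, rfl⟩ _ ⟨z, g1, g2, g3, rfl⟩ a b ha hb hab
      refine ⟨a • w + b • z, fun i => ?_, ?_, fun i hi => ?_, ?_⟩
      · simp only [Pi.add_apply, Pi.smul_apply, smul_eq_mul]
        exact add_nonneg (mul_nonneg ha (h1 i)) (mul_nonneg hb (g1 i))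
      · simp only [Pi.add_apply, Pi.smul_apply, smul_eq_mul, Finset.sum_add_distrib,
          ← Finset.mul_sum, h2, g2, mul_one, hab]
      · simp [h3 i hi, g3 i hi]
      · unfold comb
        simp only [Pi.add_apply, Pi.smul_apply, smul_eq_mul, add_smul, Finset.sum_add_distrib,
          mul_smul, Finset.smul_sum]
    refine convexHull_min ?_ hc hx
    rintro _ ⟨i, hi, rfl⟩
    refine ⟨Pi.single i 1, fun j => ?_, by simp, fun j hj => ?_, comb_single t i⟩
    · by_cases h : j = i
      · subst h; simp
      · simp [h]
    · have : j ≠ i := fun h => hj (h ▸ hi)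
      simp [this]
  · rintro ⟨w, h1, h2, h3, rfl⟩
    have e1 : ∑ i ∈ K, w i • M.node t i = M.comb t w :=
      Finset.sum_subset (Finset.subset_univ K) fun i _ hi => by rw [h3 i hi, zero_smul]
    have e2 : ∑ i ∈ K, w i = 1 := by
      rw [← h2]; exact Finset.sum_subset (Finset.subset_univ K) fun i _ hi => h3 i hi
    rw [← e1]
    exact (convex_convexHull ℝ _).sum_mem (fun i _ => h1 i) e2
      fun i hi => subset_convexHull ℝ _ ⟨i, hi, rfl⟩

lemma eq_zero_of_comb_eq_zero {t : ℝ} (ht : t ∈ Icc 0 T) {K : Finset (Fin M.numNodes)}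
    (hK : K ∈ M.triangles) {w : Fin M.numNodes → ℝ} (h1 : ∑ i, w i = 0)
    (h2 : ∀ i, i ∉ K → w i = 0) (h3 : M.comb t w = 0) : w = 0 := by
  have e1 : ∑ i : K, w i • M.node t i = 0 := by
    rw [← h3]; unfold comb
    rw [Finset.sum_coe_sort K (fun i => w i • M.node t i)]
    exact Finset.sum_subset (Finset.subset_univ K) fun i _ hi => by rw [h2 i hi, zero_smul]
  have e2 : ∑ i : K, w i = 0 := by
    rw [← h1, Finset.sum_coe_sort K w]
    exact Finset.sum_subset (Finset.subset_univ K) fun i _ hi => h2 i hi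
  have := (affineIndependent_iff.1 (M.nondegenerate t ht K hK)) Finset.univ (fun i => w i) e2 e1
  funext i
  by_cases hi : i ∈ K
  · exact this ⟨i, hi⟩ (Finset.mem_univ _)
  · exact h2 i hi

/-- Barycentric coordinates on the triangulation are unique, since two triangles meet in the convex
hull of their common nodes. -/
lemma weight_unique {t : ℝ} (ht : t ∈ Icc 0 T) {w z : Fin M.numNodes → ℝ} (hw : M.IsWeight w)
    (hz : M.IsWeight z) (h : M.comb t w = M.comb t z) : w = z := by
  obtain ⟨w1, w2, K, hK, w3⟩ := hw
  obtain ⟨z1, z2, L, hL, z3⟩ := hz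
  have hx : M.comb t w ∈ M.cell t K ∩ M.cell t L :=
    ⟨mem_cell_iff.2 ⟨w, w1, w2, w3, rfl⟩, mem_cell_iff.2 ⟨z, z1, z2, z3, h.symm⟩⟩
  have hx' : M.comb t w ∈ M.cell t (K ∩ L) := by
    have := M.conforming t ht K hK L hL
    unfold cell node at hx ⊢
    rwa [this] at hx
  obtain ⟨v, v1, v2, v3, hv⟩ := mem_cell_iff.1 hx'
  have a1 : w - v = 0 := by
    refine eq_zero_of_comb_eq_zero ht hK (by simp [w2, v2]) (fun i hi => ?_) (by
      rw [comb_sub, hv, sub_self])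
    simp [w3 i hi, v3 i (fun hh => hi (Finset.mem_inter.1 hh).1)]
  have a2 : z - v = 0 := by
    refine eq_zero_of_comb_eq_zero ht hL (by simp [z2, v2]) (fun i hi => ?_) (by
      rw [comb_sub, hv, h, sub_self])
    simp [z3 i hi, v3 i (fun hh => hi (Finset.mem_inter.1 hh).2)]
  rw [sub_eq_zero.1 a1, sub_eq_zero.1 a2]

lemma mem_surface_iff {t : ℝ} {x : E3} :
    x ∈ M.surface t ↔ ∃ w, M.IsWeight w ∧ M.comb t w = x := by
  unfold surface
  simp only [mem_iUnion, mem_cell_iff, IsWeight, exists_prop]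
  constructor
  · rintro ⟨K, hK, w, h1, h2, h3, h4⟩; exact ⟨w, ⟨h1, h2, K, hK, h3⟩, h4⟩
  · rintro ⟨w, ⟨h1, h2, K, hK, h3⟩, h4⟩; exact ⟨K, hK, w, h1, h2, h3, h4⟩

lemma cell_subset_surface {t : ℝ} {K : Finset (Fin M.numNodes)} (hK : K ∈ M.triangles) :
    M.cell t K ⊆ M.surface t := subset_biUnion_of_mem (u := fun K => M.cell t K) hK

lemma basis_spec {t : ℝ} {x : E3} (hx : x ∈ M.surface t) :
    M.IsWeight (M.basis t x) ∧ M.comb t (M.basis t x) = x := by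
  have h : ∃ w, M.IsWeight w ∧ ∑ i, w i • M.node t i = x := mem_surface_iff.1 hx
  unfold basis
  rw [dif_pos h]
  exact h.choose_spec

lemma basis_comb {t : ℝ} (ht : t ∈ Icc 0 T) {w : Fin M.numNodes → ℝ} (hw : M.IsWeight w) :
    M.basis t (M.comb t w) = w := by
  have hs := basis_spec (mem_surface_iff.2 ⟨w, hw, rfl⟩ : M.comb t w ∈ M.surface t)
  exact weight_unique ht hs.1 hw hs.2

lemma isWeight_single (i : Fin M.numNodes) : M.IsWeight (Pi.single i 1) := by
  obtain ⟨K, hK, hi⟩ := M.node_used i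
  refine ⟨fun j => ?_, by simp, K, hK, fun j hj => ?_⟩
  · by_cases h : j = i
    · subst h; simp
    · simp [h]
  · have : j ≠ i := fun h => hj (h ▸ hi)
    simp [this]

lemma basis_node {t : ℝ} (ht : t ∈ Icc 0 T) (i : Fin M.numNodes) :
    M.basis t (M.node t i) = Pi.single i 1 := by
  rw [← comb_single t i, basis_comb ht (isWeight_single i)]

lemma node_mem_surface (t : ℝ) (i : Fin M.numNodes) : M.node t i ∈ M.surface t :=
  mem_surface_iff.2 ⟨_, isWeight_single i, comb_single t i⟩

lemma node_mem_cell (t : ℝ) {K : Finset (Fin M.numNodes)} {i : Fin M.numNodes} (hi : i ∈ K) :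
    M.node t i ∈ M.cell t K := subset_convexHull ℝ _ ⟨i, hi, rfl⟩

lemma basis_eq_zero_of_notMem {t : ℝ} (ht : t ∈ Icc 0 T) {K : Finset (Fin M.numNodes)}
    (hK : K ∈ M.triangles) {x : E3} (hx : x ∈ M.cell t K) {i : Fin M.numNodes} (hi : i ∉ K) :
    M.basis t x i = 0 := by
  obtain ⟨w, h1, h2, h3, rfl⟩ := mem_cell_iff.1 hx
  rw [basis_comb ht ⟨h1, h2, K, hK, h3⟩]
  exact h3 i hi

lemma exists_triple {K : Finset (Fin M.numNodes)} (hK : K ∈ M.triangles) {i : Fin M.numNodes}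
    (hi : i ∈ K) : ∃ j k, i ≠ j ∧ i ≠ k ∧ j ≠ k ∧ K = {i, j, k} := by
  have h := Finset.card_erase_of_mem hi
  rw [M.card_triangle K hK] at h
  obtain ⟨j, k, hjk, e⟩ := Finset.card_eq_two.1 h
  have e' : K = {i, j, k} := by rw [← Finset.insert_erase hi, e]
  have hj : j ∈ K.erase i := by rw [e]; simp
  have hk : k ∈ K.erase i := by rw [e]; simp
  exact ⟨j, k, (Finset.ne_of_mem_erase hj).symm, (Finset.ne_of_mem_erase hk).symm, hjk, e'⟩

lemma exists_triple' {K : Finset (Fin M.numNodes)} (hK : K ∈ M.triangles) :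
    ∃ i j k, i ≠ j ∧ i ≠ k ∧ j ≠ k ∧ K = {i, j, k} := by
  have : 0 < K.card := by rw [M.card_triangle K hK]; norm_num
  obtain ⟨i, hi⟩ := Finset.card_pos.1 this
  exact ⟨i, exists_triple hK hi⟩

variable (M) in
/-- The edge vector from the node `i` to the node `j`. -/
def edge (t : ℝ) (i j : Fin M.numNodes) : E3 := M.node t j - M.node t i

lemma gramDet_edge_pos {t : ℝ} (ht : t ∈ Icc 0 T) {i j k : Fin M.numNodes} (hij : i ≠ j)
    (hik : i ≠ k) (hjk : j ≠ k) (hK : {i, j, k} ∈ M.triangles) :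
    0 < gramDet (M.edge t i j) (M.edge t i k) := by
  refine gramDet_pos fun a b hab => ?_
  have h := eq_zero_of_comb_eq_zero (M := M) ht hK
    (w := a • Pi.single j 1 + b • Pi.single k 1 - (a + b) • Pi.single i 1) ?_ ?_ ?_
  · have h1 := congrFun h j
    have h2 := congrFun h k
    simp [hij.symm, hik.symm, hjk, hjk.symm] at h1 h2
    exact ⟨h1, h2⟩
  · simp [Finset.sum_add_distrib, Finset.sum_sub_distrib, ← Finset.mul_sum]
  · intro l hl
    simp only [Finset.mem_insert, Finset.mem_singleton, not_or] at hl
    simp [hl.1, hl.2.1, hl.2.2]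
  · have e : M.comb t (a • Pi.single j 1 + b • Pi.single k 1 - (a + b) • Pi.single i 1) =
        a • M.comb t (Pi.single j 1) + b • M.comb t (Pi.single k 1)
          - (a + b) • M.comb t (Pi.single i 1) := by
      unfold comb
      simp only [Pi.sub_apply, Pi.add_apply, Pi.smul_apply, sub_smul, add_smul,
        Finset.sum_sub_distrib, Finset.sum_add_distrib, smul_assoc, ← Finset.smul_sum]
    rw [e, comb_single, comb_single, comb_single, ← hab]
    unfold edge; module

lemma sum_triple {E : Type*} [AddCommGroup E] {i j k : Fin M.numNodes} (hij : i ≠ j)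
    (hik : i ≠ k) (hjk : j ≠ k) {f : Fin M.numNodes → E}
    (hf : ∀ l, l ∉ ({i, j, k} : Finset (Fin M.numNodes)) → f l = 0) :
    ∑ l, f l = f i + f j + f k := by
  rw [← Finset.sum_subset (Finset.subset_univ {i, j, k}) (fun l _ hl => hf l hl),
    Finset.sum_insert (by simp [hij, hik]), Finset.sum_insert (by simp [hjk]),
    Finset.sum_singleton, add_assoc]

/-- On a triangle with vertices `i`, `j`, `k` the basis function of `j` is affine, and its gradient
is a dual vector. -/
lemma basis_eq_inner {t : ℝ} (ht : t ∈ Icc 0 T) {i j k : Fin M.numNodes} (hij : i ≠ j)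
    (hik : i ≠ k) (hjk : j ≠ k) (hK : {i, j, k} ∈ M.triangles) {x : E3}
    (hx : x ∈ M.cell t {i, j, k}) :
    M.basis t x j = inner ℝ (dualVec (M.edge t i j) (M.edge t i k)) (x - M.node t i) := by
  have hb := basis_spec (cell_subset_surface hK hx)
  have h0 : ∀ l, l ∉ ({i, j, k} : Finset (Fin M.numNodes)) → M.basis t x l = 0 :=
    fun l hl => basis_eq_zero_of_notMem ht hK hx hl
  have hs := hb.1.2.1
  rw [sum_triple hij hik hjk h0] at hs
  have hc := hb.2
  unfold comb at hc
  rw [sum_triple hij hik hjk (fun l hl => by rw [h0 l hl, zero_smul])] at hc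
  have e : x - M.node t i = M.basis t x j • M.edge t i j + M.basis t x k • M.edge t i k := by
    nth_rewrite 1 [← hc]
    have : M.basis t x i = 1 - M.basis t x j - M.basis t x k := by linarith
    rw [this]; unfold edge; module
  rw [e, inner_add_right, inner_smul_right, inner_smul_right,
    inner_dualVec_left (gramDet_edge_pos ht hij hik hjk hK).ne', inner_dualVec_right]
  ring

lemma cell_triple (t : ℝ) (i j k : Fin M.numNodes) :
    M.cell t {i, j, k} = convexHull ℝ {M.node t i, M.node t j, M.node t k} := by
  unfold cell
  congr 1
  simp [image_insert_eq]

lemma isCompact_cell (t : ℝ) (K : Finset (Fin M.numNodes)) : IsCompact (M.cell t K) :=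
  ((K.finite_toSet.image _).isCompact_convexHull ℝ)

/-! ### Finite element functions -/

lemma hasDerivWithinAt_node {t : ℝ} (ht : t ∈ Icc 0 T) (i : Fin M.numNodes) :
    HasDerivWithinAt (fun s => M.node s i) (S.velocity t (M.node t i)) (Icc 0 T) t :=
  S.flow_deriv _ (M.node₀_mem i) t ht

lemma continuousOn_node (i : Fin M.numNodes) : ContinuousOn (fun s => M.node s i) (Icc 0 T) :=
  fun _ ht => (hasDerivWithinAt_node ht i).continuousWithinAt

variable (M) in
lemma isCompact_weights : IsCompact {w | M.IsWeight w} := by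
  have e : {w | M.IsWeight w} = ⋃ K ∈ M.triangles,
      (stdSimplex ℝ (Fin M.numNodes) ∩ {w | ∀ i, i ∉ K → w i = 0}) := by
    ext w
    simp only [IsWeight, mem_ofPred_eq, mem_iUnion, mem_inter_iff, stdSimplex, exists_prop]
    constructor
    · rintro ⟨h1, h2, K, hK, h3⟩; exact ⟨K, hK, ⟨h1, h2⟩, h3⟩
    · rintro ⟨K, hK, ⟨h1, h2⟩, h3⟩; exact ⟨h1, h2, K, hK, h3⟩
  rw [e]
  refine M.triangles.isCompact_biUnion fun K _ => (isCompact_stdSimplex ℝ _).inter_right ?_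
  have : {w : Fin M.numNodes → ℝ | ∀ i, i ∉ K → w i = 0} = ⋂ i, ⋂ (_ : i ∉ K), {w | w i = 0} := by
    ext w; simp
  rw [this]
  exact isClosed_iInter fun i => isClosed_iInter fun _ =>
    isClosed_eq (continuous_apply i) continuous_const

/-- The basis functions are jointly continuous in time and space: they invert the continuous
bijection of the compact set of pairs of times and barycentric coordinates onto the discrete
space-time surface. -/
lemma continuousOn_basis :
    ContinuousOn (fun q : ℝ × E3 => M.basis q.1 q.2) M.spaceTime := by
  let P : Set (ℝ × (Fin M.numNodes → ℝ)) := Icc 0 T ×ˢ {w | M.IsWeight w}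
  have hP : IsCompact P := isCompact_Icc.prod (isCompact_weights M)
  have hF : ∀ p ∈ P, (p.1, M.comb p.1 p.2) ∈ M.spaceTime := fun p hp =>
    ⟨hp.1, mem_surface_iff.2 ⟨p.2, hp.2, rfl⟩⟩
  let F : P → M.spaceTime := fun p => ⟨(p.1.1, M.comb p.1.1 p.1.2), hF _ p.2⟩
  have hFc : Continuous F := by
    refine Continuous.subtype_mk ?_ _
    have : ContinuousOn (fun p : ℝ × (Fin M.numNodes → ℝ) => (p.1, M.comb p.1 p.2)) P := by
      refine continuousOn_fst.prodMk ?_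
      unfold comb
      refine continuousOn_finsetSum _ fun i _ => ContinuousOn.fun_smul ?_ ?_
      · exact ((continuous_apply i).comp continuous_snd).continuousOn
      · exact (continuousOn_node i).comp continuousOn_fst fun p hp => hp.1
    exact continuousOn_iff_continuous_domRestrict.1 this
  have hFs : Function.Surjective F := by
    rintro ⟨⟨t, x⟩, ht, hx⟩
    have hb := basis_spec hx
    exact ⟨⟨(t, M.basis t x), ht, hb.1⟩, Subtype.ext (Prod.ext rfl hb.2)⟩
  have : CompactSpace P := isCompact_iff_compactSpace.1 hP
  have hq : IsQuotientMap F := hFc.isClosedMap.isQuotientMap hFc hFs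
  rw [continuousOn_iff_continuous_domRestrict, hq.continuous_iff]
  have : (M.spaceTime.domRestrict fun q : ℝ × E3 => M.basis q.1 q.2) ∘ F = fun p : P => p.1.2 := by
    funext p
    exact basis_comb p.2.1 p.2.2
  rw [this]
  exact continuous_snd.comp continuous_subtype_val

lemma continuousOn_basis_apply {t : ℝ} (ht : t ∈ Icc 0 T) (i : Fin M.numNodes) :
    ContinuousOn (fun x => M.basis t x i) (M.surface t) := by
  have h : ContinuousOn (fun x => M.basis t x) (M.surface t) :=
    (continuousOn_basis (M := M)).comp (f := fun x => (t, x))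
      (by fun_prop) fun x hx => ⟨ht, hx⟩
  exact (continuous_apply i).comp_continuousOn h

variable (M) in
/-- The finite element function at time `t` with nodal values `u`. -/
def fe (t : ℝ) (u : Fin M.numNodes → ℝ) (x : E3) : ℝ := ∑ i, u i * M.basis t x i

lemma interp_eq_fe (t : ℝ) (η : E3 → ℝ) : M.interp t η = M.fe t fun i => η (M.node t i) := rfl

lemma fe_node {t : ℝ} (ht : t ∈ Icc 0 T) (u : Fin M.numNodes → ℝ) (i : Fin M.numNodes) :
    M.fe t u (M.node t i) = u i := by
  unfold fe; rw [basis_node ht, Finset.sum_eq_single i]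
  · simp
  · intro j _ hj; simp [hj]
  · simp

lemma affine_comb (l : E3 →ᵃ[ℝ] ℝ) (t : ℝ) {w : Fin M.numNodes → ℝ} (hw : ∑ i, w i = 1) :
    l (M.comb t w) = ∑ i, l (M.node t i) * w i := by
  have h : ∀ x, l x = l.linear x + l 0 := fun x => by
    have := congrFun l.decomp x; simpa using this
  rw [h]; unfold comb
  rw [map_sum]
  simp only [map_smul, smul_eq_mul]
  have e : ∑ i, l (M.node t i) * w i = ∑ i, (w i * l.linear (M.node t i) + l 0 * w i) :=
    Finset.sum_congr rfl fun i _ => by rw [h (M.node t i)]; ring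
  rw [e, Finset.sum_add_distrib, ← Finset.mul_sum, hw, mul_one]

lemma eq_fe_of_affine {t : ℝ} (ht : t ∈ Icc 0 T) {K : Finset (Fin M.numNodes)}
    (hK : K ∈ M.triangles) {η : E3 → ℝ} (hη : ∃ l : E3 →ᵃ[ℝ] ℝ, EqOn η l (M.cell t K)) {x : E3}
    (hx : x ∈ M.cell t K) : η x = M.fe t (fun i => η (M.node t i)) x := by
  obtain ⟨l, hl⟩ := hη
  have hb := basis_spec (cell_subset_surface hK hx)
  rw [hl hx, ← hb.2, affine_comb l t hb.1.2.1, hb.2]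
  unfold fe
  refine Finset.sum_congr rfl fun i _ => ?_
  by_cases hi : i ∈ K
  · simp only [hl (node_mem_cell t hi)]
  · rw [basis_eq_zero_of_notMem ht hK hx hi]; simp

lemma IsFE.eq_fe {t : ℝ} (ht : t ∈ Icc 0 T) {η : E3 → ℝ} (hη : M.IsFE t η) {x : E3}
    (hx : x ∈ M.surface t) : η x = M.fe t (fun i => η (M.node t i)) x := by
  unfold surface at hx
  simp only [mem_iUnion, exists_prop] at hx
  obtain ⟨K, hK, hx⟩ := hx
  exact eq_fe_of_affine ht hK (hη.2 K hK) hx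

/-- The gradient on the triangle `i`, `j`, `k` of the function with nodal values `u`. -/
def triGrad (M : Mesh S) (t : ℝ) (i j k : Fin M.numNodes) (u : Fin M.numNodes → ℝ) : E3 :=
  (u j - u i) • dualVec (M.edge t i j) (M.edge t i k)
    + (u k - u i) • dualVec (M.edge t i k) (M.edge t i j)

lemma fe_eq_inner {t : ℝ} (ht : t ∈ Icc 0 T) {i j k : Fin M.numNodes} (hij : i ≠ j)
    (hik : i ≠ k) (hjk : j ≠ k) (hK : {i, j, k} ∈ M.triangles) {x : E3}
    (hx : x ∈ M.cell t {i, j, k}) (u : Fin M.numNodes → ℝ) :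
    M.fe t u x = u i + inner ℝ (M.triGrad t i j k u) (x - M.node t i) := by
  have hb := basis_spec (cell_subset_surface hK hx)
  have h0 : ∀ l, l ∉ ({i, j, k} : Finset (Fin M.numNodes)) → M.basis t x l = 0 :=
    fun l hl => basis_eq_zero_of_notMem ht hK hx hl
  have hs := hb.1.2.1
  rw [sum_triple hij hik hjk h0] at hs
  have hj := basis_eq_inner ht hij hik hjk hK hx
  have hKe : ({i, j, k} : Finset (Fin M.numNodes)) = {i, k, j} := by
    rw [Finset.pair_comm]
  have hk := basis_eq_inner ht hik hij hjk.symm (hKe ▸ hK) (hKe ▸ hx)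
  unfold fe triGrad
  rw [sum_triple hij hik hjk (fun l hl => by rw [h0 l hl, mul_zero]), inner_add_left,
    inner_smul_left, inner_smul_left, ← hj, ← hk]
  simp only [conj_trivial]
  have : M.basis t x i = 1 - M.basis t x j - M.basis t x k := by linarith
  rw [this]; ring

lemma exists_affine_fe {t : ℝ} (ht : t ∈ Icc 0 T) {K : Finset (Fin M.numNodes)}
    (hK : K ∈ M.triangles) (u : Fin M.numNodes → ℝ) :
    ∃ l : E3 →ᵃ[ℝ] ℝ, EqOn (M.fe t u) l (M.cell t K) := by
  obtain ⟨i, j, k, hij, hik, hjk, rfl⟩ := exists_triple' hK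
  refine ⟨(innerSL ℝ (M.triGrad t i j k u)).toLinearMap.toAffineMap +
    AffineMap.const ℝ E3 (u i - inner ℝ (M.triGrad t i j k u) (M.node t i)), fun x hx => ?_⟩
  rw [fe_eq_inner ht hij hik hjk hK hx]
  simp only [AffineMap.coe_add, Pi.add_apply, LinearMap.coe_toAffineMap,
    ContinuousLinearMap.coe_coe, innerSL_apply_apply, AffineMap.const_apply, inner_sub_right]
  ring

lemma isFE_fe {t : ℝ} (ht : t ∈ Icc 0 T) (u : Fin M.numNodes → ℝ) : M.IsFE t (M.fe t u) :=
  ⟨continuousOn_finsetSum _ fun i _ => continuousOn_const.mul (continuousOn_basis_apply ht i),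
    fun _ hK => exists_affine_fe ht hK u⟩

/-- The gradient of a function that is affine on a triangle, in terms of its nodal values. -/
lemma grad_eq_triGrad {t : ℝ} (ht : t ∈ Icc 0 T) {i j k : Fin M.numNodes} (hij : i ≠ j)
    (hik : i ≠ k) (hjk : j ≠ k) (hK : {i, j, k} ∈ M.triangles) {η : E3 → ℝ}
    (hη : ∃ l : E3 →ᵃ[ℝ] ℝ, EqOn η l (M.cell t {i, j, k})) :
    M.grad t {i, j, k} η = M.triGrad t i j k fun l => η (M.node t l) := by
  set g := M.triGrad t i j k fun l => η (M.node t l) with hg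
  have hD : (affineSpan ℝ (M.cell t {i, j, k})).direction = vectorSpan ℝ (M.cell t {i, j, k}) :=
    direction_affineSpan ℝ _
  have he : M.edge t i j ∈ vectorSpan ℝ (M.cell t {i, j, k}) :=
    vsub_mem_vectorSpan ℝ (node_mem_cell t (by simp)) (node_mem_cell t (by simp))
  have hf : M.edge t i k ∈ vectorSpan ℝ (M.cell t {i, j, k}) :=
    vsub_mem_vectorSpan ℝ (node_mem_cell t (by simp)) (node_mem_cell t (by simp))
  have hdual : ∀ a b : E3, a ∈ vectorSpan ℝ (M.cell t {i, j, k}) →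
      b ∈ vectorSpan ℝ (M.cell t {i, j, k}) → dualVec a b ∈ vectorSpan ℝ (M.cell t {i, j, k}) :=
    fun a b ha hb => Submodule.smul_mem _ _ (Submodule.sub_mem _ (Submodule.smul_mem _ _ ha)
      (Submodule.smul_mem _ _ hb))
  have hgm : g ∈ vectorSpan ℝ (M.cell t {i, j, k}) :=
    Submodule.add_mem _ (Submodule.smul_mem _ _ (hdual _ _ he hf))
      (Submodule.smul_mem _ _ (hdual _ _ hf he))
  have hgs : ∀ x ∈ M.cell t {i, j, k}, ∀ y ∈ M.cell t {i, j, k},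
      η y - η x = inner ℝ g (y - x) := by
    intro x hx y hy
    rw [eq_fe_of_affine ht hK hη hx, eq_fe_of_affine ht hK hη hy,
      fe_eq_inner ht hij hik hjk hK hx, fe_eq_inner ht hij hik hjk hK hy, ← hg]
    simp only [inner_sub_right]; ring
  have hex : ∃ g ∈ (affineSpan ℝ (M.cell t {i, j, k})).direction,
      ∀ x ∈ M.cell t {i, j, k}, ∀ y ∈ M.cell t {i, j, k}, η y - η x = inner ℝ g (y - x) :=
    ⟨g, hD ▸ hgm, hgs⟩
  unfold grad
  rw [dif_pos hex]
  obtain ⟨h1, h2⟩ := hex.choose_spec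
  set g' := hex.choose
  rw [hD] at h1
  have hsub : g' - g ∈ vectorSpan ℝ (M.cell t {i, j, k}) := Submodule.sub_mem _ h1 hgm
  have horth : ∀ v ∈ vectorSpan ℝ (M.cell t {i, j, k}), inner ℝ (g' - g) v = 0 := by
    intro v hv
    rw [vectorSpan_def] at hv
    induction hv using Submodule.span_induction with
    | mem v hv =>
      obtain ⟨y, hy, x, hx, rfl⟩ := hv
      simp only [vsub_eq_sub]
      rw [inner_sub_left, ← h2 x hx y hy, ← hgs x hx y hy, sub_self]
    | zero => simp
    | add v w _ _ h3 h4 => rw [inner_add_right, h3, h4, add_zero]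
    | smul c v _ h3 => rw [inner_smul_right, h3, mul_zero]
  exact sub_eq_zero.1 (inner_self_eq_zero.1 (horth _ hsub))

lemma grad_fe {t : ℝ} (ht : t ∈ Icc 0 T) {i j k : Fin M.numNodes} (hij : i ≠ j)
    (hik : i ≠ k) (hjk : j ≠ k) (hK : {i, j, k} ∈ M.triangles) (u : Fin M.numNodes → ℝ) :
    M.grad t {i, j, k} (M.fe t u) = M.triGrad t i j k u := by
  rw [grad_eq_triGrad ht hij hik hjk hK (exists_affine_fe ht hK u)]
  congr 1; funext l; exact fe_node ht u l

lemma grad_eq_grad_fe {t : ℝ} (ht : t ∈ Icc 0 T) {K : Finset (Fin M.numNodes)}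
    (hK : K ∈ M.triangles) {η : E3 → ℝ} (hη : M.IsFE t η) :
    M.grad t K η = M.grad t K (M.fe t fun l => η (M.node t l)) := by
  obtain ⟨i, j, k, hij, hik, hjk, rfl⟩ := exists_triple' hK
  rw [grad_fe ht hij hik hjk hK, grad_eq_triGrad ht hij hik hjk hK (hη.2 _ hK)]

lemma divVelocity_eq {t : ℝ} (ht : t ∈ Icc 0 T) {i j k : Fin M.numNodes} (hij : i ≠ j)
    (hik : i ≠ k) (hjk : j ≠ k) (hK : {i, j, k} ∈ M.triangles) :
    M.divVelocity t {i, j, k} =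
      inner ℝ (dualVec (M.edge t i j) (M.edge t i k))
        (S.velocity t (M.node t j) - S.velocity t (M.node t i))
      + inner ℝ (dualVec (M.edge t i k) (M.edge t i j))
        (S.velocity t (M.node t k) - S.velocity t (M.node t i)) := by
  unfold divVelocity
  have e : ∀ c : Fin 3, (fun x => M.discreteVelocity t x c) =
      M.fe t fun l => S.velocity t (M.node t l) c := by
    intro c; funext x
    unfold discreteVelocity fe
    simp [mul_comm]
  simp only [e, grad_fe ht hij hik hjk hK, triGrad, PiLp.inner_apply, Fin.sum_univ_three,
    PiLp.add_apply, PiLp.smul_apply, smul_eq_mul, PiLp.sub_apply, RCLike.inner_apply, conj_trivial]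
  ring

/-! ### Integrals over the discrete surface in terms of nodal values -/

variable (M) in
/-- The area of the triangle `K(t)`. -/
def cellArea (t : ℝ) (K : Finset (Fin M.numNodes)) : ℝ := (area (M.cell t K)).toReal

lemma cellArea_triple (t : ℝ) (i j k : Fin M.numNodes) :
    M.cellArea t {i, j, k} =
      refArea * Real.sqrt (gramDet (M.edge t i j) (M.edge t i k)) := by
  unfold cellArea
  rw [cell_triple, area_triangle_toReal]; rfl

lemma area_cell_ne_top (t : ℝ) {K : Finset (Fin M.numNodes)} (hK : K ∈ M.triangles) :
    area (M.cell t K) ≠ ⊤ := by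
  obtain ⟨i, j, k, -, -, -, rfl⟩ := exists_triple' hK
  rw [cell_triple, area_triangle]; exact ENNReal.ofReal_ne_top

lemma cellArea_nonneg (t : ℝ) (K : Finset (Fin M.numNodes)) : 0 ≤ M.cellArea t K :=
  ENNReal.toReal_nonneg

lemma cellArea_pos {t : ℝ} (ht : t ∈ Icc 0 T) {K : Finset (Fin M.numNodes)}
    (hK : K ∈ M.triangles) : 0 < M.cellArea t K := by
  obtain ⟨i, j, k, hij, hik, hjk, rfl⟩ := exists_triple' hK
  rw [cellArea_triple]
  exact mul_pos refArea_pos (Real.sqrt_pos.2 (gramDet_edge_pos ht hij hik hjk hK))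

lemma integrableOn_basis {t : ℝ} (ht : t ∈ Icc 0 T) {K : Finset (Fin M.numNodes)}
    (hK : K ∈ M.triangles) (i : Fin M.numNodes) :
    IntegrableOn (fun x => M.basis t x i) (M.cell t K) area := by
  have : IsFiniteMeasure (area.restrict (M.cell t K)) :=
    ⟨by rw [Measure.restrict_apply_univ]; exact (area_cell_ne_top t hK).lt_top⟩
  have hm := (isCompact_cell t K).measurableSet
  refine Integrable.of_bound
    (((continuousOn_basis_apply ht i).mono (cell_subset_surface hK)).aestronglyMeasurable hm) 1 ?_
  filter_upwards [ae_restrict_mem hm] with x hx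
  have hb := (basis_spec (cell_subset_surface hK hx)).1
  rw [Real.norm_eq_abs, abs_of_nonneg (hb.1 i), ← hb.2.1]
  exact Finset.single_le_sum (fun j _ => hb.1 j) (Finset.mem_univ i)

lemma integral_basis_eq_moment {t : ℝ} (ht : t ∈ Icc 0 T) {K : Finset (Fin M.numNodes)}
    (hK : K ∈ M.triangles) {j : Fin M.numNodes} (hj : j ∈ K) :
    ∫ x in M.cell t K, M.basis t x j ∂area = refMoment / refArea * M.cellArea t K := by
  obtain ⟨i, k, hji, hjk, hik, e⟩ := exists_triple hK hj
  have e' : K = {i, j, k} := by rw [e, Finset.insert_comm]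
  subst e'
  rw [setIntegral_congr_fun (isCompact_cell t _).measurableSet
    (fun x hx => basis_eq_inner ht hji.symm hik hjk hK hx), cellArea_triple]
  have := setIntegral_triangle_inner (gramDet_edge_pos ht hji.symm hik hjk hK).ne'
  rw [cell_triple]
  refine this.trans ?_
  have := refArea_pos.ne'
  field_simp
  rfl

/-- The three basis functions of a triangle have the same integral, a third of the area. -/
lemma integral_basis {t : ℝ} (ht : t ∈ Icc 0 T) {K : Finset (Fin M.numNodes)}
    (hK : K ∈ M.triangles) (i : Fin M.numNodes) :
    ∫ x in M.cell t K, M.basis t x i ∂area = if i ∈ K then M.cellArea t K / 3 else 0 := by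
  have hm := (isCompact_cell (M := M) t K).measurableSet
  have h0 : ∀ j, j ∉ K → ∫ x in M.cell t K, M.basis t x j ∂area = 0 := fun j hj => by
    rw [setIntegral_congr_fun hm (fun x hx => basis_eq_zero_of_notMem ht hK hx hj)]; simp
  split_ifs with hi
  · have hsum : ∑ j, ∫ x in M.cell t K, M.basis t x j ∂area = M.cellArea t K := by
      rw [← integral_finsetSum _ fun j _ => integrableOn_basis ht hK j,
        setIntegral_congr_fun hm (g := fun _ => (1 : ℝ))
          (fun x hx => (basis_spec (cell_subset_surface hK hx)).1.2.1)]
      simp [cellArea, Measure.real]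
    rw [← Finset.sum_subset (Finset.subset_univ K) (fun j _ hj => h0 j hj),
      Finset.sum_congr rfl (fun j hj => integral_basis_eq_moment ht hK hj), Finset.sum_const,
      M.card_triangle K hK, nsmul_eq_mul] at hsum
    rw [integral_basis_eq_moment ht hK hi]
    push_cast at hsum
    linarith
  · exact h0 i hi

lemma integral_fe_mul {t : ℝ} (ht : t ∈ Icc 0 T) {K : Finset (Fin M.numNodes)}
    (hK : K ∈ M.triangles) (u : Fin M.numNodes → ℝ) (c : ℝ) :
    ∫ x in M.cell t K, M.fe t u x * c ∂area =
      ∑ i, u i * ((if i ∈ K then M.cellArea t K / 3 else 0) * c) := by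
  rw [integral_mul_const]
  unfold fe
  rw [integral_finsetSum _ fun j _ => (integrableOn_basis ht hK j).const_mul _, Finset.sum_mul]
  refine Finset.sum_congr rfl fun i _ => ?_
  rw [integral_const_mul, integral_basis ht hK, mul_assoc]

variable (M) in
/-- The lumped mass of the node `i`, the integral of its basis function. -/
def mass (t : ℝ) (i : Fin M.numNodes) : ℝ :=
  ∑ K ∈ M.triangles, if i ∈ K then M.cellArea t K / 3 else 0

variable (M) in
/-- The integral of the basis function of the node `i` against the divergence of the discrete
velocity; it is the time derivative of the lumped mass. -/
def massRate (t : ℝ) (i : Fin M.numNodes) : ℝ :=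
  ∑ K ∈ M.triangles, (if i ∈ K then M.cellArea t K / 3 else 0) * M.divVelocity t K

lemma mass_pos {t : ℝ} (ht : t ∈ Icc 0 T) (i : Fin M.numNodes) : 0 < M.mass t i := by
  obtain ⟨K, hK, hi⟩ := M.node_used i
  refine Finset.sum_pos' (fun L _ => ?_) ⟨K, hK, ?_⟩
  · split_ifs
    · exact div_nonneg (cellArea_nonneg t L) (by norm_num)
    · exact le_rfl
  · rw [if_pos hi]; exact div_pos (cellArea_pos ht hK) (by norm_num)

lemma mLumped_eq {t : ℝ} (ht : t ∈ Icc 0 T) (η ζ : E3 → ℝ) :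
    M.mLumped t η ζ = ∑ i, M.mass t i * (η (M.node t i) * ζ (M.node t i)) := by
  unfold mLumped integral mass
  simp only [interp_eq_fe]
  have h : ∀ K ∈ M.triangles, ∫ x in M.cell t K,
      M.fe t (fun i => η (M.node t i) * ζ (M.node t i)) x ∂area = _ := fun K hK => by
    have := integral_fe_mul ht hK (fun i => η (M.node t i) * ζ (M.node t i)) 1
    simp only [mul_one] at this
    exact this
  rw [Finset.sum_congr rfl h, Finset.sum_comm]
  refine Finset.sum_congr rfl fun i _ => ?_
  rw [← Finset.mul_sum, mul_comm]

lemma g_eq {t : ℝ} (ht : t ∈ Icc 0 T) (η : E3 → ℝ) :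
    M.g t (M.interp t η) (fun _ => 1) = ∑ i, M.massRate t i * η (M.node t i) := by
  unfold g integral massRate
  simp only [interp_eq_fe, mul_one]
  rw [Finset.sum_congr rfl fun K hK => integral_fe_mul ht hK _ (M.divVelocity t K),
    Finset.sum_comm]
  refine Finset.sum_congr rfl fun i _ => ?_
  rw [← Finset.mul_sum, mul_comm]

lemma a_eq (t : ℝ) (η ζ : E3 → ℝ) :
    M.a t η ζ = ∑ K ∈ M.triangles, M.cellArea t K * inner ℝ (M.grad t K η) (M.grad t K ζ) := by
  unfold a integral
  refine Finset.sum_congr rfl fun K _ => ?_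
  rw [setIntegral_const, smul_eq_mul]; rfl

variable (M) in
/-- The stiffness form on nodal values. -/
def stiff (t : ℝ) (u v : Fin M.numNodes → ℝ) : ℝ := M.a t (M.fe t u) (M.fe t v)

lemma a_eq_stiff {t : ℝ} (ht : t ∈ Icc 0 T) {η ζ : E3 → ℝ} (hη : M.IsFE t η) (hζ : M.IsFE t ζ) :
    M.a t η ζ = M.stiff t (fun i => η (M.node t i)) (fun i => ζ (M.node t i)) := by
  unfold stiff
  rw [a_eq, a_eq]
  refine Finset.sum_congr rfl fun K hK => ?_
  rw [grad_eq_grad_fe ht hK hη, grad_eq_grad_fe ht hK hζ]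

lemma triGrad_add (t : ℝ) (i j k : Fin M.numNodes) (u v : Fin M.numNodes → ℝ) :
    M.triGrad t i j k (u + v) = M.triGrad t i j k u + M.triGrad t i j k v := by
  unfold triGrad; simp only [Pi.add_apply]; module

lemma triGrad_smul (t : ℝ) (i j k : Fin M.numNodes) (c : ℝ) (u : Fin M.numNodes → ℝ) :
    M.triGrad t i j k (c • u) = c • M.triGrad t i j k u := by
  unfold triGrad; simp only [Pi.smul_apply, smul_eq_mul]; module

lemma stiff_add {t : ℝ} (ht : t ∈ Icc 0 T) (u v w : Fin M.numNodes → ℝ) :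
    M.stiff t (u + v) w = M.stiff t u w + M.stiff t v w := by
  unfold stiff
  rw [a_eq, a_eq, a_eq, ← Finset.sum_add_distrib]
  refine Finset.sum_congr rfl fun K hK => ?_
  obtain ⟨i, j, k, hij, hik, hjk, rfl⟩ := exists_triple' hK
  simp only [grad_fe ht hij hik hjk hK, triGrad_add, inner_add_left]
  ring

lemma stiff_smul {t : ℝ} (ht : t ∈ Icc 0 T) (c : ℝ) (u w : Fin M.numNodes → ℝ) :
    M.stiff t (c • u) w = c * M.stiff t u w := by
  unfold stiff
  rw [a_eq, a_eq, Finset.mul_sum]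
  refine Finset.sum_congr rfl fun K hK => ?_
  obtain ⟨i, j, k, hij, hik, hjk, rfl⟩ := exists_triple' hK
  simp only [grad_fe ht hij hik hjk hK, triGrad_smul, inner_smul_left, conj_trivial]
  ring

lemma stiff_comm (t : ℝ) (u w : Fin M.numNodes → ℝ) : M.stiff t u w = M.stiff t w u := by
  unfold stiff
  rw [a_eq, a_eq]
  exact Finset.sum_congr rfl fun K _ => by rw [real_inner_comm]

lemma stiff_self_nonneg (t : ℝ) (u : Fin M.numNodes → ℝ) : 0 ≤ M.stiff t u u := by
  unfold stiff
  rw [a_eq]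
  exact Finset.sum_nonneg fun K _ => mul_nonneg (cellArea_nonneg t K) real_inner_self_nonneg

/-- The stiffness form as a bilinear form. -/
def stiffForm (M : Mesh S) {t : ℝ} (ht : t ∈ Icc 0 T) :
    (Fin M.numNodes → ℝ) →ₗ[ℝ] (Fin M.numNodes → ℝ) →ₗ[ℝ] ℝ :=
  LinearMap.mk₂ ℝ (M.stiff t) (stiff_add ht) (stiff_smul ht)
    (fun u v w => by rw [stiff_comm, stiff_add ht, stiff_comm t v, stiff_comm t w])
    (fun c u v => by rw [stiff_comm, stiff_smul ht, stiff_comm t v]; rfl)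

lemma stiff_eq_sum {t : ℝ} (ht : t ∈ Icc 0 T) (u v : Fin M.numNodes → ℝ) :
    M.stiff t u v = ∑ i, M.stiff t u (Pi.single i 1) * v i := by
  have h : M.stiff t u v = M.stiffForm ht u v := rfl
  have hv : v = ∑ i, v i • (Pi.single i (1 : ℝ) : Fin M.numNodes → ℝ) := by
    funext j; simp [Finset.sum_apply, Pi.single_apply]
  rw [h]
  conv_lhs => rw [hv]
  rw [map_sum]
  refine Finset.sum_congr rfl fun i _ => ?_
  rw [map_smul, smul_eq_mul, mul_comm]; rfl

lemma energyReg_eq {t : ℝ} (ht : t ∈ Icc 0 T) (ε θ δ : ℝ) {U : E3 → ℝ} (hU : M.IsFE t U) :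
    M.energyReg ε θ δ t U =
      ε / 2 * M.stiff t (fun i => U (M.node t i)) (fun i => U (M.node t i))
        + 1 / ε * ∑ i, M.mass t i * potentialReg θ δ (U (M.node t i)) := by
  rw [← a_eq_stiff ht hU hU, a_eq]
  unfold energyReg integral mass
  simp only [interp_eq_fe]
  have h : ∀ K ∈ M.triangles, ∫ x in M.cell t K, (ε * ‖M.grad t K U‖ ^ 2 / 2 + 1 / ε *
      M.fe t (fun i => potentialReg θ δ (U (M.node t i))) x) ∂area =
      ε / 2 * (M.cellArea t K * inner ℝ (M.grad t K U) (M.grad t K U)) + 1 / ε *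
        ∑ i, potentialReg θ δ (U (M.node t i)) * (if i ∈ K then M.cellArea t K / 3 else 0) := by
    intro K hK
    rw [integral_add, setIntegral_const, integral_const_mul]
    · have := integral_fe_mul ht hK (fun i => potentialReg θ δ (U (M.node t i))) 1
      simp only [mul_one] at this
      rw [this, real_inner_self_eq_norm_sq, smul_eq_mul]
      unfold cellArea Measure.real
      ring
    · exact integrableOn_const (area_cell_ne_top t hK)
    · exact (integrable_finsetSum _ fun i _ =>
        (integrableOn_basis ht hK i).const_mul _).const_mul _
  rw [Finset.sum_congr rfl h, Finset.sum_add_distrib, ← Finset.mul_sum, ← Finset.mul_sum,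
    Finset.sum_comm]
  congr 2
  refine Finset.sum_congr rfl fun i _ => ?_
  rw [← Finset.mul_sum, mul_comm]

end Mesh

/-! ### Time derivatives of the discrete forms -/

lemma hasDerivWithinAt_gramDet {e f : ℝ → E3} {e' f' : E3} {s : Set ℝ} {t : ℝ}
    (he : HasDerivWithinAt e e' s t) (hf : HasDerivWithinAt f f' s t)
    (hD : gramDet (e t) (f t) ≠ 0) :
    HasDerivWithinAt (fun t => gramDet (e t) (f t)) (2 * gramDet (e t) (f t) *
      (inner ℝ (dualVec (e t) (f t)) e' + inner ℝ (dualVec (f t) (e t)) f')) s t := by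
  have h := ((he.norm_sq.mul hf.norm_sq).sub ((he.inner ℝ hf).pow 2))
  refine h.congr_deriv ?_
  unfold dualVec
  rw [gramDet_comm (f t) (e t)]
  simp only [inner_smul_left, inner_sub_left, conj_trivial, real_inner_comm (e t) (f t)]
  rw [real_inner_comm (f t) e']
  field_simp
  ring

lemma hasDerivWithinAt_sqrt_gramDet {e f : ℝ → E3} {e' f' : E3} {s : Set ℝ} {t : ℝ}
    (he : HasDerivWithinAt e e' s t) (hf : HasDerivWithinAt f f' s t)
    (hD : 0 < gramDet (e t) (f t)) :
    HasDerivWithinAt (fun t => Real.sqrt (gramDet (e t) (f t))) (Real.sqrt (gramDet (e t) (f t)) *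
      (inner ℝ (dualVec (e t) (f t)) e' + inner ℝ (dualVec (f t) (e t)) f')) s t := by
  refine ((hasDerivWithinAt_gramDet he hf hD.ne').sqrt hD.ne').congr_deriv ?_
  have hs := Real.sqrt_pos.2 hD
  rw [div_eq_iff (by positivity)]
  nth_rewrite 1 [← Real.sq_sqrt hD.le]
  ring

lemma continuousOn_dualVec {e f : ℝ → E3} {s : Set ℝ} (he : ContinuousOn e s)
    (hf : ContinuousOn f s) (hD : ∀ t ∈ s, gramDet (e t) (f t) ≠ 0) :
    ContinuousOn (fun t => dualVec (e t) (f t)) s := by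
  have h1 : ContinuousOn (fun t => gramDet (e t) (f t)) s :=
    ((he.norm.pow 2).mul (hf.norm.pow 2)).sub ((he.inner (𝕜 := ℝ) hf).pow 2)
  exact (h1.inv₀ hD).fun_smul (((hf.norm.pow 2).fun_smul he).fun_sub
    ((he.inner (𝕜 := ℝ) hf).fun_smul hf))

lemma IsC1InTimeC2InSpace.continuousOn {T : ℝ} {V : ℝ → E3 → E3}
    (h : IsC1InTimeC2InSpace T V) :
    ContinuousOn (fun q : ℝ × E3 => V q.1 q.2) (Icc 0 T ×ˢ univ) := by
  obtain ⟨V', -, h2, -⟩ := h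
  have := (h2 0 (by norm_num)).1
  have e : (fun q : ℝ × E3 => V q.1 q.2) =
      fun q : ℝ × E3 => (continuousMultilinearCurryFin0 ℝ E3 E3) (iteratedFDeriv ℝ 0 (V q.1) q.2) := by
    funext q; simp
  rw [e]
  exact (continuousMultilinearCurryFin0 ℝ E3 E3).continuous.comp_continuousOn this

namespace Mesh

variable {T : ℝ} {S : EvolvingSurface T} {M : Mesh S}

lemma hasDerivWithinAt_edge {t : ℝ} (ht : t ∈ Icc 0 T) (i j : Fin M.numNodes) :
    HasDerivWithinAt (fun s => M.edge s i j)
      (S.velocity t (M.node t j) - S.velocity t (M.node t i)) (Icc 0 T) t :=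
  (hasDerivWithinAt_node ht j).sub (hasDerivWithinAt_node ht i)

lemma continuousOn_edge (i j : Fin M.numNodes) :
    ContinuousOn (fun s => M.edge s i j) (Icc 0 T) :=
  fun _ ht => (hasDerivWithinAt_edge ht i j).continuousWithinAt

lemma continuousOn_velocity_node (i : Fin M.numNodes) :
    ContinuousOn (fun s => S.velocity s (M.node s i)) (Icc 0 T) :=
  S.velocity_regular.continuousOn.comp (f := fun s => (s, M.node s i))
    (continuousOn_id.prodMk (continuousOn_node i)) fun _ hs => ⟨hs, mem_univ _⟩

/-- The transport formula for the area of a triangle. -/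
lemma hasDerivWithinAt_cellArea {t : ℝ} (ht : t ∈ Icc 0 T) {K : Finset (Fin M.numNodes)}
    (hK : K ∈ M.triangles) :
    HasDerivWithinAt (fun s => M.cellArea s K) (M.cellArea t K * M.divVelocity t K)
      (Icc 0 T) t := by
  obtain ⟨i, j, k, hij, hik, hjk, rfl⟩ := exists_triple' hK
  simp only [cellArea_triple]
  rw [divVelocity_eq ht hij hik hjk hK, mul_assoc]
  exact (hasDerivWithinAt_sqrt_gramDet (hasDerivWithinAt_edge ht i j)
    (hasDerivWithinAt_edge ht i k) (gramDet_edge_pos ht hij hik hjk hK)).const_mul refArea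

lemma continuousOn_cellArea {K : Finset (Fin M.numNodes)} (hK : K ∈ M.triangles) :
    ContinuousOn (fun s => M.cellArea s K) (Icc 0 T) :=
  fun _ ht => (hasDerivWithinAt_cellArea ht hK).continuousWithinAt

lemma continuousOn_divVelocity {K : Finset (Fin M.numNodes)} (hK : K ∈ M.triangles) :
    ContinuousOn (fun s => M.divVelocity s K) (Icc 0 T) := by
  obtain ⟨i, j, k, hij, hik, hjk, rfl⟩ := exists_triple' hK
  refine ContinuousOn.congr ?_ fun t ht => divVelocity_eq ht hij hik hjk hK
  have hp := fun t ht => (gramDet_edge_pos (M := M) (t := t) ht hij hik hjk hK).ne'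
  have hp' : ∀ t ∈ Icc 0 T, gramDet (M.edge t i k) (M.edge t i j) ≠ 0 := fun t ht => by
    rw [gramDet_comm]; exact hp t ht
  exact ((continuousOn_dualVec (continuousOn_edge i j) (continuousOn_edge i k) hp).inner
    ((continuousOn_velocity_node j).sub (continuousOn_velocity_node i))).add
    ((continuousOn_dualVec (continuousOn_edge i k) (continuousOn_edge i j) hp').inner
    ((continuousOn_velocity_node k).sub (continuousOn_velocity_node i)))

lemma hasDerivWithinAt_mass {t : ℝ} (ht : t ∈ Icc 0 T) (i : Fin M.numNodes) :
    HasDerivWithinAt (fun s => M.mass s i) (M.massRate t i) (Icc 0 T) t := by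
  unfold mass massRate
  refine HasDerivWithinAt.fun_sum fun K hK => ?_
  split_ifs
  · refine ((hasDerivWithinAt_cellArea ht hK).div_const 3).congr_deriv ?_
    ring
  · simpa using hasDerivWithinAt_const t (Icc 0 T) (0 : ℝ)

lemma continuousOn_mass (i : Fin M.numNodes) : ContinuousOn (fun s => M.mass s i) (Icc 0 T) :=
  fun _ ht => (hasDerivWithinAt_mass ht i).continuousWithinAt

lemma continuousOn_massRate (i : Fin M.numNodes) :
    ContinuousOn (fun s => M.massRate s i) (Icc 0 T) := by
  unfold massRate
  refine continuousOn_finsetSum _ fun K hK => ?_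
  refine ContinuousOn.fun_mul ?_ (continuousOn_divVelocity hK)
  split_ifs
  · exact (continuousOn_cellArea hK).div_const 3
  · exact continuousOn_const

lemma continuousOn_triGrad {i j k : Fin M.numNodes} (hij : i ≠ j) (hik : i ≠ k) (hjk : j ≠ k)
    (hK : {i, j, k} ∈ M.triangles) {u : ℝ → Fin M.numNodes → ℝ} (hu : ContinuousOn u (Icc 0 T)) :
    ContinuousOn (fun s => M.triGrad s i j k (u s)) (Icc 0 T) := by
  have hp := fun t ht => (gramDet_edge_pos (M := M) (t := t) ht hij hik hjk hK).ne'
  have hp' : ∀ t ∈ Icc 0 T, gramDet (M.edge t i k) (M.edge t i j) ≠ 0 := fun t ht => by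
    rw [gramDet_comm]; exact hp t ht
  have hc : ∀ l, ContinuousOn (fun s => u s l) (Icc 0 T) := fun l =>
    (continuous_apply l).comp_continuousOn hu
  exact (((hc j).fun_sub (hc i)).fun_smul
    (continuousOn_dualVec (continuousOn_edge i j) (continuousOn_edge i k) hp)).fun_add
    (((hc k).fun_sub (hc i)).fun_smul
    (continuousOn_dualVec (continuousOn_edge i k) (continuousOn_edge i j) hp'))

lemma continuousOn_stiff {u v : ℝ → Fin M.numNodes → ℝ} (hu : ContinuousOn u (Icc 0 T))
    (hv : ContinuousOn v (Icc 0 T)) :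
    ContinuousOn (fun s => M.stiff s (u s) (v s)) (Icc 0 T) := by
  unfold stiff
  simp only [a_eq]
  refine continuousOn_finsetSum _ fun K hK => (continuousOn_cellArea hK).fun_mul ?_
  obtain ⟨i, j, k, hij, hik, hjk, rfl⟩ := exists_triple' hK
  refine ContinuousOn.congr ?_ fun t ht => by
    rw [grad_fe ht hij hik hjk hK, grad_fe ht hij hik hjk hK]
  exact (continuousOn_triGrad hij hik hjk hK hu).inner (continuousOn_triGrad hij hik hjk hK hv)

/-! ### The nodal system: existence and uniqueness -/

variable (M) in
/-- The chemical potential at the node `i` as a function of the nodal values of `U`. -/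
def nodalPotential (ε θ δ t : ℝ) (u : Fin M.numNodes → ℝ) (i : Fin M.numNodes) : ℝ :=
  ε * (M.stiff t u (Pi.single i 1) / M.mass t i) + θ / (2 * ε) * fReg δ (u i) - 1 / ε * u i

variable (M) in
/-- The right hand side of the ordinary differential equation for the nodal values of `U`. -/
def nodalField (ε θ δ t : ℝ) (u : Fin M.numNodes → ℝ) (i : Fin M.numNodes) : ℝ :=
  -(M.massRate t i / M.mass t i * u i
    + M.stiff t (M.nodalPotential ε θ δ t u) (Pi.single i 1) / M.mass t i)

lemma stiff_single_eq_sum {t : ℝ} (ht : t ∈ Icc 0 T) (u : Fin M.numNodes → ℝ)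
    (i : Fin M.numNodes) : M.stiff t u (Pi.single i 1) / M.mass t i =
      ∑ l, M.stiff t (Pi.single l 1) (Pi.single i 1) / M.mass t i * u l := by
  rw [stiff_comm, stiff_eq_sum ht, Finset.sum_div]
  refine Finset.sum_congr rfl fun l _ => ?_
  rw [stiff_comm]; ring

lemma exists_bound_coefficients (M : Mesh S) : ∃ C, ∀ t ∈ Icc 0 T, ∀ i,
    |M.massRate t i / M.mass t i| ≤ C ∧
      ∀ l, |M.stiff t (Pi.single l 1) (Pi.single i 1) / M.mass t i| ≤ C := by
  have h1 : ContinuousOn (fun t i => M.massRate t i / M.mass t i) (Icc 0 T) :=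
    continuousOn_pi.2 fun i => (continuousOn_massRate i).div (continuousOn_mass i)
      fun t ht => (mass_pos ht i).ne'
  have h2 : ContinuousOn (fun t i l =>
      M.stiff t (Pi.single l 1) (Pi.single i 1) / M.mass t i) (Icc 0 T) :=
    continuousOn_pi.2 fun i => continuousOn_pi.2 fun l =>
      (continuousOn_stiff continuousOn_const continuousOn_const).div (continuousOn_mass i)
      fun t ht => (mass_pos ht i).ne'
  obtain ⟨C1, hC1⟩ := isCompact_Icc.exists_bound_of_continuousOn h1
  obtain ⟨C2, hC2⟩ := isCompact_Icc.exists_bound_of_continuousOn h2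
  refine ⟨max C1 C2, fun t ht i => ⟨?_, fun l => ?_⟩⟩
  · exact ((norm_le_pi_norm _ i).trans (hC1 t ht)).trans (le_max_left _ _)
  · exact (((norm_le_pi_norm (fun l => M.stiff t (Pi.single l 1) (Pi.single i 1) / M.mass t i)
      l).trans (norm_le_pi_norm (fun i l => M.stiff t (Pi.single l 1) (Pi.single i 1) / M.mass t i)
      i)).trans (hC2 t ht)).trans (le_max_right _ _)

lemma abs_sum_mul_sub_le {n : ℕ} {a x y : Fin n → ℝ} {C D : ℝ} (hC : 0 ≤ C)
    (ha : ∀ l, |a l| ≤ C) (hD : ∀ l, |x l - y l| ≤ D) :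
    |∑ l, a l * x l - ∑ l, a l * y l| ≤ n * (C * D) := by
  rw [← Finset.sum_sub_distrib]
  refine (Finset.abs_sum_le_sum_abs _ _).trans ?_
  refine (Finset.sum_le_card_nsmul _ _ (C * D) fun l _ => ?_).trans (by simp)
  rw [← mul_sub, abs_mul]
  exact mul_le_mul (ha l) (hD l) (abs_nonneg _) hC

lemma exists_lipschitz_nodalField (M : Mesh S) {ε θ δ : ℝ} (hδ : δ ∈ Ioo (0 : ℝ) 1) :
    ∃ K, 0 ≤ K ∧ ∀ t ∈ Icc 0 T, ∀ u v,
      ‖M.nodalField ε θ δ t u - M.nodalField ε θ δ t v‖ ≤ K * ‖u - v‖ := by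
  obtain ⟨C, hC⟩ := M.exists_bound_coefficients
  set C' := max C 0
  have hC0 : 0 ≤ C' := le_max_right _ _
  set B : ℝ := |ε| * (M.numNodes * C') + |θ / (2 * ε)| * (4 / δ) + |1 / ε|
  have hδ0 := hδ.1
  have hB : 0 ≤ B := by positivity
  refine ⟨C' + M.numNodes * (C' * B), by positivity, fun t ht u v => ?_⟩
  have huv : ∀ l, |u l - v l| ≤ ‖u - v‖ := fun l => norm_le_pi_norm (u - v) l
  have hW : ∀ l, |M.nodalPotential ε θ δ t u l - M.nodalPotential ε θ δ t v l| ≤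
      B * ‖u - v‖ := by
    intro l
    unfold nodalPotential
    rw [stiff_single_eq_sum ht u, stiff_single_eq_sum ht v]
    have h1 := abs_sum_mul_sub_le (a := fun k =>
      M.stiff t (Pi.single k 1) (Pi.single l 1) / M.mass t l) hC0
      (fun k => ((hC t ht l).2 k).trans (le_max_left _ _)) huv
    have h2 := abs_fReg_sub_le hδ (v l) (u l)
    set s1 := ∑ k, M.stiff t (Pi.single k 1) (Pi.single l 1) / M.mass t l * u k
    set s2 := ∑ k, M.stiff t (Pi.single k 1) (Pi.single l 1) / M.mass t l * v k
    have e : ε * s1 + θ / (2 * ε) * fReg δ (u l) - 1 / ε * u l -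
        (ε * s2 + θ / (2 * ε) * fReg δ (v l) - 1 / ε * v l) =
        ε * (s1 - s2) + θ / (2 * ε) * (fReg δ (u l) - fReg δ (v l)) - 1 / ε * (u l - v l) := by
      ring
    rw [e]
    have h3 : |fReg δ (u l) - fReg δ (v l)| ≤ 4 / δ * ‖u - v‖ :=
      h2.trans (mul_le_mul_of_nonneg_left (huv l) (by positivity))
    calc _ ≤ |ε * (s1 - s2)| + |θ / (2 * ε) * (fReg δ (u l) - fReg δ (v l))|
          + |1 / ε * (u l - v l)| := (abs_sub _ _).trans (add_le_add_left (abs_add_le _ _) _)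
      _ ≤ |ε| * (M.numNodes * (C' * ‖u - v‖)) + |θ / (2 * ε)| * (4 / δ * ‖u - v‖)
          + |1 / ε| * ‖u - v‖ := by
          rw [abs_mul, abs_mul, abs_mul]
          gcongr
          exact huv l
      _ = B * ‖u - v‖ := by ring
  rw [pi_norm_le_iff_of_nonneg (by positivity)]
  intro i
  simp only [Pi.sub_apply, Real.norm_eq_abs]
  unfold nodalField
  rw [stiff_single_eq_sum ht (M.nodalPotential ε θ δ t u),
    stiff_single_eq_sum ht (M.nodalPotential ε θ δ t v)]
  have h1 := abs_sum_mul_sub_le (a := fun k =>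
      M.stiff t (Pi.single k 1) (Pi.single i 1) / M.mass t i) hC0
      (fun k => ((hC t ht i).2 k).trans (le_max_left _ _)) hW
  set s1 := ∑ k, M.stiff t (Pi.single k 1) (Pi.single i 1) / M.mass t i *
    M.nodalPotential ε θ δ t u k
  set s2 := ∑ k, M.stiff t (Pi.single k 1) (Pi.single i 1) / M.mass t i *
    M.nodalPotential ε θ δ t v k
  set c := M.massRate t i / M.mass t i
  have hc : |c| ≤ C' := (hC t ht i).1.trans (le_max_left _ _)
  have e : -(c * u i + s1) - -(c * v i + s2) = -(c * (u i - v i) + (s1 - s2)) := by ring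
  rw [e, abs_neg]
  calc _ ≤ |c * (u i - v i)| + |s1 - s2| := abs_add_le _ _
    _ ≤ C' * ‖u - v‖ + M.numNodes * (C' * (B * ‖u - v‖)) := by
        rw [abs_mul]
        gcongr
        exact huv i
    _ = _ := by ring

lemma continuousOn_nodalPotential {ε θ δ : ℝ} (hδ : δ ∈ Ioo (0 : ℝ) 1)
    {u : ℝ → Fin M.numNodes → ℝ} (hu : ContinuousOn u (Icc 0 T)) :
    ContinuousOn (fun t => M.nodalPotential ε θ δ t (u t)) (Icc 0 T) := by
  refine continuousOn_pi.2 fun i => ?_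
  have hui : ContinuousOn (fun t => u t i) (Icc 0 T) := (continuous_apply i).comp_continuousOn hu
  unfold nodalPotential
  exact ((continuousOn_const.fun_mul ((continuousOn_stiff hu continuousOn_const).div
    (continuousOn_mass i) fun t ht => (mass_pos ht i).ne')).fun_add
    (continuousOn_const.fun_mul ((continuous_fReg hδ).comp_continuousOn hui))).fun_sub
    (continuousOn_const.fun_mul hui)

lemma continuousOn_nodalField {ε θ δ : ℝ} (hδ : δ ∈ Ioo (0 : ℝ) 1)
    {u : ℝ → Fin M.numNodes → ℝ} (hu : ContinuousOn u (Icc 0 T)) :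
    ContinuousOn (fun t => M.nodalField ε θ δ t (u t)) (Icc 0 T) := by
  refine continuousOn_pi.2 fun i => ?_
  have hui : ContinuousOn (fun t => u t i) (Icc 0 T) := (continuous_apply i).comp_continuousOn hu
  unfold nodalField
  exact ((((continuousOn_massRate i).div (continuousOn_mass i)
    fun t ht => (mass_pos ht i).ne').fun_mul hui).fun_add
    ((continuousOn_stiff (continuousOn_nodalPotential hδ hu) continuousOn_const).div
      (continuousOn_mass i) fun t ht => (mass_pos ht i).ne')).fun_neg

lemma discreteFlow_node {t : ℝ} (ht : t ∈ Icc 0 T) (s : ℝ) (i : Fin M.numNodes) :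
    M.discreteFlow t s (M.node t i) = M.node s i := by
  unfold discreteFlow
  rw [basis_node ht]; exact comb_single s i

variable (M) in
/-- The nodal values of a time dependent function. -/
def nodal (U : ℝ → E3 → ℝ) (t : ℝ) (i : Fin M.numNodes) : ℝ := U t (M.node t i)

lemma IsC1FE.hasDerivWithinAt_nodal {U : ℝ → E3 → ℝ} (hU : M.IsC1FE U) {t : ℝ}
    (ht : t ∈ Icc 0 T) :
    HasDerivWithinAt (M.nodal U) (fun i => M.matDeriv U t (M.node t i)) (Icc 0 T) t := by
  refine hasDerivWithinAt_pi.2 fun i => ?_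
  have h := (hU.2.1 t ht _ (node_mem_surface t i)).hasDerivWithinAt
  have e : (fun s => U s (M.discreteFlow t s (M.node t i))) = fun s => M.nodal U s i := by
    funext s; rw [discreteFlow_node ht]; rfl
  unfold matDeriv
  rw [e] at h ⊢
  exact h

lemma sum_mul_single {n : ℕ} (a : Fin n → ℝ) (i : Fin n) :
    ∑ l, a l * (Pi.single i (1 : ℝ) : Fin n → ℝ) l = a i := by
  rw [Finset.sum_eq_single i]
  · simp
  · intro j _ hj; simp [hj]
  · simp

/-- The nodal values of a solution of the variational problem solve the nodal equations. -/
lemma IsSolution.nodal_eq {ε θ δ : ℝ} {U₀ : E3 → ℝ} {U W : ℝ → E3 → ℝ}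
    (h : M.IsSolution ε θ δ U₀ U W) {t : ℝ} (ht : t ∈ Icc 0 T) :
    M.nodal W t = M.nodalPotential ε θ δ t (M.nodal U t) ∧
      HasDerivWithinAt (M.nodal U) (M.nodalField ε θ δ t (M.nodal U t)) (Icc 0 T) t := by
  have hUf : M.IsFE t (U t) := h.regular_U.1.2 t ht
  have hWf : M.IsFE t (W t) := h.regular_W.2 t ht
  have hW : M.nodal W t = M.nodalPotential ε θ δ t (M.nodal U t) := by
    funext i
    have hφ := isFE_fe ht (Pi.single i (1 : ℝ) : Fin M.numNodes → ℝ)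
    have e := h.eq_W t ht _ hφ
    rw [mLumped_eq ht, mLumped_eq ht, mLumped_eq ht, a_eq_stiff ht hUf hφ] at e
    simp only [fe_node ht, interp_eq_fe, ← mul_assoc, sum_mul_single] at e
    have hm := mass_pos ht i
    unfold nodalPotential nodal
    field_simp at e ⊢
    linarith
  refine ⟨hW, (h.regular_U.hasDerivWithinAt_nodal ht).congr_deriv ?_⟩
  funext i
  have hφ := isFE_fe ht (Pi.single i (1 : ℝ) : Fin M.numNodes → ℝ)
  have e := h.eq_U t ht _ hφ
  have e2 := g_eq (M := M) ht (fun y => U t y * M.fe t (Pi.single i 1) y)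
  rw [mLumped_eq ht, e2, a_eq_stiff ht hWf hφ] at e
  simp only [fe_node ht, ← mul_assoc, sum_mul_single] at e
  have hm := mass_pos ht i
  unfold nodalField
  rw [← hW]
  unfold nodal
  field_simp
  linarith

lemma isContinuousFE_fe {u : ℝ → Fin M.numNodes → ℝ} (hu : ContinuousOn u (Icc 0 T)) :
    M.IsContinuousFE (fun t => M.fe t (u t)) := by
  refine ⟨?_, fun t ht => isFE_fe ht _⟩
  unfold fe
  refine continuousOn_finsetSum _ fun i _ => ContinuousOn.fun_mul ?_ ?_
  · exact ((continuous_apply i).comp_continuousOn hu).comp continuousOn_fst fun q hq => hq.1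
  · exact (continuous_apply i).comp_continuousOn continuousOn_basis

lemma hasDerivWithinAt_fe_discreteFlow {u : ℝ → Fin M.numNodes → ℝ} {u' : Fin M.numNodes → ℝ}
    {t : ℝ} (ht : t ∈ Icc 0 T) (hu : HasDerivWithinAt u u' (Icc 0 T) t) {x : E3}
    (hx : x ∈ M.surface t) :
    HasDerivWithinAt (fun s => M.fe s (u s) (M.discreteFlow t s x)) (M.fe t u' x)
      (Icc 0 T) t := by
  have hb := basis_spec hx
  have e : ∀ s ∈ Icc 0 T, M.fe s (u s) (M.discreteFlow t s x) = ∑ i, u s i * M.basis t x i := by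
    intro s hs
    unfold fe
    have : M.basis s (M.discreteFlow t s x) = M.basis t x := basis_comb hs hb.1
    rw [this]
  refine HasDerivWithinAt.congr ?_ e (e t ht)
  exact HasDerivWithinAt.fun_sum fun i _ => (hasDerivWithinAt_pi.1 hu i).mul_const _

lemma isSolution_of_nodal (hT : 0 < T) {ε θ δ : ℝ} (hε : 0 < ε) (hδ : δ ∈ Ioo (0 : ℝ) 1)
    {U₀ : E3 → ℝ} (hU₀ : M.IsFE 0 U₀) {u : ℝ → Fin M.numNodes → ℝ}
    (h0 : u 0 = fun i => U₀ (M.node 0 i))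
    (hu : ∀ t ∈ Icc 0 T, HasDerivWithinAt u (M.nodalField ε θ δ t (u t)) (Icc 0 T) t) :
    M.IsSolution ε θ δ U₀ (fun t => M.fe t (u t))
      (fun t => M.fe t (M.nodalPotential ε θ δ t (u t))) := by
  have huc : ContinuousOn u (Icc 0 T) := fun t ht => (hu t ht).continuousWithinAt
  have h00 : (0 : ℝ) ∈ Icc 0 T := ⟨le_rfl, hT.le⟩
  have hmat : ∀ t ∈ Icc 0 T, ∀ x ∈ M.surface t,
      M.matDeriv (fun t => M.fe t (u t)) t x = M.fe t (M.nodalField ε θ δ t (u t)) x := by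
    intro t ht x hx
    exact (hasDerivWithinAt_fe_discreteFlow ht (hu t ht) hx).derivWithin
      (uniqueDiffOn_Icc hT t ht)
  refine ⟨⟨isContinuousFE_fe huc, fun t ht x hx =>
    (hasDerivWithinAt_fe_discreteFlow ht (hu t ht) hx).differentiableWithinAt, ?_⟩,
    isContinuousFE_fe (continuousOn_nodalPotential hδ huc), ?_, ?_, ?_⟩
  · exact (isContinuousFE_fe (continuousOn_nodalField hδ huc)).1.congr
      fun q hq => hmat q.1 hq.1 q.2 hq.2
  · intro t ht φ hφ
    have e2 := g_eq (M := M) ht (fun y => M.fe t (u t) y * φ y)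
    simp only [e2]
    rw [mLumped_eq ht, a_eq_stiff ht (isFE_fe ht _) hφ]
    simp only [fe_node ht, hmat t ht _ (node_mem_surface t _)]
    rw [stiff_eq_sum ht, ← Finset.sum_add_distrib, ← Finset.sum_add_distrib]
    refine Finset.sum_eq_zero fun i _ => ?_
    have hm := mass_pos ht i
    unfold nodalField
    field_simp
    ring
  · intro t ht φ hφ
    rw [mLumped_eq ht, mLumped_eq ht, mLumped_eq ht, a_eq_stiff ht (isFE_fe ht _) hφ]
    simp only [fe_node ht, interp_eq_fe]
    rw [stiff_eq_sum ht, Finset.mul_sum, Finset.mul_sum, Finset.mul_sum,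
      ← Finset.sum_add_distrib, ← Finset.sum_sub_distrib]
    refine Finset.sum_congr rfl fun i _ => ?_
    have hm := mass_pos ht i
    unfold nodalPotential
    field_simp
  · intro x hx
    simp only [h0]
    exact (hU₀.eq_fe h00 hx).symm

/-- The regularised semi-discrete problem is an ordinary differential equation for the nodal values
of `U` with a globally Lipschitz right hand side; `W` is a function of these values. -/
theorem exists_unique_solution (M : Mesh S) (hT : 0 < T) {ε θ δ : ℝ} (hε : 0 < ε)
    (hδ : δ ∈ Ioo (0 : ℝ) 1) {U₀ : E3 → ℝ} (hU₀ : M.IsFE 0 U₀) :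
    ∃ U W : ℝ → E3 → ℝ, M.IsSolution ε θ δ U₀ U W ∧
      ∀ U' W' : ℝ → E3 → ℝ, M.IsSolution ε θ δ U₀ U' W' →
        ∀ t ∈ Icc 0 T, EqOn (U' t) (U t) (M.surface t) ∧ EqOn (W' t) (W t) (M.surface t) := by
  have h00 : (0 : ℝ) ∈ Icc 0 T := ⟨le_rfl, hT.le⟩
  obtain ⟨K, hK, hl⟩ := M.exists_lipschitz_nodalField (ε := ε) (θ := θ) hδ
  obtain ⟨u, hu0, hu⟩ := exists_solution_of_lipschitz hT hK hl
    (fun x => continuousOn_nodalField hδ continuousOn_const) (fun i => U₀ (M.node 0 i))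
  refine ⟨_, _, isSolution_of_nodal hT hε hδ hU₀ hu0 hu, fun U' W' h t ht => ?_⟩
  have hn : M.nodal U' t = u t := by
    refine solution_unique_of_lipschitz hK hl ?_ (fun t ht => (h.nodal_eq ht).2) hu ht
    rw [hu0]; funext i; exact h.initial (node_mem_surface 0 i)
  constructor
  · intro x hx
    rw [← hn]; exact (h.regular_U.1.2 t ht).eq_fe ht hx
  · intro x hx
    simp only [← hn, ← (h.nodal_eq ht).1]
    exact (h.regular_W.2 t ht).eq_fe ht hx

/-! ### The energy estimate -/

variable (M) in
/-- The properties of a mesh on which the energy estimate rests: the stiffness form and the masses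
change in time at rates that they control, and multiplication of the nodal values by the mean
divergences of the velocity around the nodes is bounded below with respect to the stiffness form. -/
structure EnergyBounds (c₁ c₂ c₃ c₄ : ℝ) : Prop where
  stiff_deriv : ∀ t ∈ Icc 0 T, ∀ (u : ℝ → Fin M.numNodes → ℝ) (u' : Fin M.numNodes → ℝ),
    HasDerivWithinAt u u' (Icc 0 T) t → ∃ d,
      HasDerivWithinAt (fun s => M.stiff s (u s) (u s)) d (Icc 0 T) t ∧
      |d - 2 * M.stiff t (u t) u'| ≤ c₁ * M.stiff t (u t) (u t)
  rate_nonneg : ∀ t ∈ Icc 0 T, ∀ i, 0 ≤ M.massRate t i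
  rate_le : ∀ t ∈ Icc 0 T, ∀ i, M.massRate t i ≤ c₂ * M.mass t i
  mul_rate : ∀ t ∈ Icc 0 T, ∀ u : Fin M.numNodes → ℝ,
    -∑ i, M.massRate t i / M.mass t i * u i * M.stiff t u (Pi.single i 1) ≤
      c₃ * (M.stiff t u u + ∑ i, M.mass t i * u i ^ 2)
  mass_le : ∀ t ∈ Icc 0 T, ∑ i, M.mass t i ≤ c₄

/-- The constant in the differential inequality for the energy. -/
def growthRate (ε c₁ c₂ c₃ c₄ : ℝ) : ℝ :=
  2 / ε * (ε * c₁ / 2 + ε * c₃ + 2 / ε ^ 2) + 2 * ε * (ε * c₃ + c₂ / (2 * ε))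
    + c₂ * c₄ / (2 * ε)

variable (M) in
/-- The energy of the nodal values `u`, augmented by a multiple of the lumped `L²` norm that makes
it coercive uniformly in `δ`. -/
def augmentedEnergy (ε θ δ t : ℝ) (u : Fin M.numNodes → ℝ) : ℝ :=
  ε / 2 * M.stiff t u u + 1 / ε * ∑ i, M.mass t i * potentialReg θ δ (u i)
    + 1 / ε * ∑ i, M.mass t i * u i ^ 2

/-- Since `F_log^δ ≥ 0`, only the concave part `(1 - r²) / 2` of the potential can be negative. -/
lemma coercive_augmentedEnergy {ε θ δ t : ℝ} (ht : t ∈ Icc 0 T) (hε : 0 < ε) (hθ : 0 < θ)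
    (hδ : δ ∈ Ioo (0 : ℝ) 1) (u : Fin M.numNodes → ℝ) :
    ε / 2 * M.stiff t u u + 1 / (2 * ε) * ∑ i, M.mass t i * u i ^ 2 ≤
      M.augmentedEnergy ε θ δ t u := by
  have h : -(1 / 2) * ∑ i, M.mass t i * u i ^ 2 ≤ ∑ i, M.mass t i * potentialReg θ δ (u i) := by
    rw [Finset.mul_sum]
    refine Finset.sum_le_sum fun i _ => ?_
    have h1 := (FlogReg_nonneg_and_le hδ (u i)).1
    have hm := mass_pos ht i
    unfold potentialReg
    nlinarith [mul_nonneg hm.le (mul_nonneg hθ.le h1)]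
  unfold augmentedEnergy
  have h2 := mul_le_mul_of_nonneg_left h (one_div_pos.2 hε).le
  have e : 1 / (2 * ε) = 1 / ε * (1 / 2) := by field_simp
  rw [e]
  linarith

lemma hasDerivAt_potentialReg (θ : ℝ) {δ : ℝ} (hδ : δ ∈ Ioo (0 : ℝ) 1) (r : ℝ) :
    HasDerivAt (potentialReg θ δ) (θ / 2 * fReg δ r - r) r := by
  have h := ((hasDerivAt_FlogReg' hδ r).const_mul (θ / 2)).add
    ((((hasDerivAt_id r).pow 2).const_sub 1).div_const 2)
  refine h.congr_deriv ?_
  simp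
  ring

lemma potentialReg_sub_le {θ δ : ℝ} (hθ : 0 < θ) (hδ : δ ∈ Ioo (0 : ℝ) 1) (r : ℝ) :
    potentialReg θ δ r - r * (θ / 2 * fReg δ r - r) ≤ (1 + r ^ 2) / 2 := by
  have h := (FlogReg_nonneg_and_le hδ r).2
  unfold potentialReg
  nlinarith

/-- The differential inequality for the augmented energy. The terms `F^δ(u) - u (F^δ)'(u)` are only
bounded from above uniformly in `δ`; this is enough because their weights, the rates of the masses,
are non-negative. -/
lemma hasDerivWithinAt_augmentedEnergy {c₁ c₂ c₃ c₄ : ℝ} (hB : M.EnergyBounds c₁ c₂ c₃ c₄)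
    (hc₁ : 0 ≤ c₁) (hc₂ : 0 ≤ c₂) (hc₃ : 0 ≤ c₃) (hc₄ : 0 ≤ c₄)
    {ε θ δ : ℝ} (hε : 0 < ε) (hθ : 0 < θ) (hδ : δ ∈ Ioo (0 : ℝ) 1)
    {u : ℝ → Fin M.numNodes → ℝ} {t : ℝ} (ht : t ∈ Icc 0 T)
    (hu : HasDerivWithinAt u (M.nodalField ε θ δ t (u t)) (Icc 0 T) t) :
    ∃ y, HasDerivWithinAt (fun s => M.augmentedEnergy ε θ δ s (u s)) y (Icc 0 T) t ∧
      y ≤ -(1 / 2) * M.stiff t (M.nodalPotential ε θ δ t (u t)) (M.nodalPotential ε θ δ t (u t))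
        + growthRate ε c₁ c₂ c₃ c₄ * (1 + M.augmentedEnergy ε θ δ t (u t)) := by
  set v := u t with hv
  set w := M.nodalPotential ε θ δ t v with hw
  set v' := M.nodalField ε θ δ t v with hv'
  obtain ⟨d, hd, hd'⟩ := hB.stiff_deriv t ht u _ hu
  rw [← hv] at hd'
  have hui : ∀ i, HasDerivWithinAt (fun s => u s i) (v' i) (Icc 0 T) t := hasDerivWithinAt_pi.1 hu
  have hF : HasDerivWithinAt (fun s => ∑ i, M.mass s i * potentialReg θ δ (u s i))
      (∑ i, (M.massRate t i * potentialReg θ δ (v i)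
        + M.mass t i * ((θ / 2 * fReg δ (v i) - v i) * v' i))) (Icc 0 T) t :=
    HasDerivWithinAt.fun_sum fun i _ => by
      have hp : HasDerivWithinAt (fun s => potentialReg θ δ (u s i))
          ((θ / 2 * fReg δ (v i) - v i) * v' i) (Icc 0 T) t :=
        HasDerivAt.comp_hasDerivWithinAt (h₂ := potentialReg θ δ) (h := fun s => u s i) t
          (hasDerivAt_potentialReg θ hδ (u t i)) (hui i)
      exact (hasDerivWithinAt_mass ht i).mul hp
  have hN : HasDerivWithinAt (fun s => ∑ i, M.mass s i * u s i ^ 2)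
      (∑ i, (M.massRate t i * v i ^ 2 + M.mass t i * (2 * v i * v' i))) (Icc 0 T) t :=
    HasDerivWithinAt.fun_sum fun i _ => ((hasDerivWithinAt_mass ht i).mul
      ((hui i).pow 2)).congr_deriv (by simp [hv])
  refine ⟨_, ((hd.const_mul (ε / 2)).add (hF.const_mul (1 / ε))).add (hN.const_mul (1 / ε)), ?_⟩
  set s : Fin M.numNodes → ℝ := fun i => M.stiff t v (Pi.single i 1) with hs
  set r : Fin M.numNodes → ℝ := fun i => M.stiff t w (Pi.single i 1) with hr
  have hm : ∀ i, 0 < M.mass t i := mass_pos ht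
  have e1 : ∀ i, M.mass t i * v' i = -(M.massRate t i * v i) - r i := by
    intro i
    have := (hm i).ne'
    rw [hv']; unfold nodalField; rw [← hw]
    field_simp
    ring
  have e2 : ∀ i, M.mass t i * (θ / 2 * fReg δ (v i) - v i) = ε * (M.mass t i * w i - ε * s i) := by
    intro i
    have := (hm i).ne'
    rw [hw]; unfold nodalPotential
    field_simp
    ring
  set N := ∑ i, M.mass t i * v i ^ 2 with hNdef
  have hN0 : 0 ≤ N := Finset.sum_nonneg fun i _ => mul_nonneg (hm i).le (sq_nonneg _)
  have hS0 := M.stiff_self_nonneg t v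
  have svv' : M.stiff t v v' = ∑ i, s i * v' i := stiff_eq_sum ht v v'
  have sww : M.stiff t w w = ∑ i, r i * w i := stiff_eq_sum ht w w
  have swv : M.stiff t w v = ∑ i, r i * v i := stiff_eq_sum ht w v
  -- the potential part of the derivative of the energy, after inserting both equations
  have k1 : 1 / ε * ∑ i, (M.massRate t i * potentialReg θ δ (v i)
        + M.mass t i * ((θ / 2 * fReg δ (v i) - v i) * v' i)) =
      -M.stiff t w w - ε * M.stiff t v v'
        + 1 / ε * ∑ i, M.massRate t i *
          (potentialReg θ δ (v i) - v i * (θ / 2 * fReg δ (v i) - v i))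
        + ε * -∑ i, M.massRate t i / M.mass t i * v i * s i := by
    rw [svv', sww, Finset.mul_sum, Finset.mul_sum, Finset.mul_sum, ← Finset.sum_neg_distrib,
      ← Finset.sum_neg_distrib, Finset.mul_sum, ← Finset.sum_sub_distrib, ← Finset.sum_add_distrib,
      ← Finset.sum_add_distrib]
    refine Finset.sum_congr rfl fun i _ => ?_
    have hmi := (hm i).ne'
    have a1 := e1 i
    have a2 := e2 i
    set p := θ / 2 * fReg δ (v i) - v i
    have a3 : w i = (p / ε + ε * s i / M.mass t i) := by
      field_simp; linarith
    have a4 : r i = -(M.massRate t i * v i) - M.mass t i * v' i := by linarith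
    rw [a3, a4]
    field_simp
    ring
  have k2 : ∑ i, M.massRate t i * (potentialReg θ δ (v i) - v i * (θ / 2 * fReg δ (v i) - v i)) ≤
      c₂ / 2 * (c₄ + N) := by
    calc _ ≤ ∑ i, (c₂ / 2 * M.mass t i + c₂ / 2 * (M.mass t i * v i ^ 2)) := by
          refine Finset.sum_le_sum fun i _ => ?_
          have b1 := potentialReg_sub_le hθ hδ (v i)
          have b2 := hB.rate_nonneg t ht i
          have b3 := hB.rate_le t ht i
          calc _ ≤ M.massRate t i * ((1 + v i ^ 2) / 2) := mul_le_mul_of_nonneg_left b1 b2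
            _ ≤ c₂ * M.mass t i * ((1 + v i ^ 2) / 2) :=
              mul_le_mul_of_nonneg_right b3 (by positivity)
            _ = _ := by ring
      _ = c₂ / 2 * ∑ i, M.mass t i + c₂ / 2 * N := by
          rw [Finset.sum_add_distrib, ← Finset.mul_sum, ← Finset.mul_sum]
      _ ≤ _ := by
          have := hB.mass_le t ht
          rw [mul_add]; gcongr
  have k3 := hB.mul_rate t ht v
  -- the derivative of the `L²` part: the growth of the masses enters with a favourable sign
  have k4 : ∑ i, (M.massRate t i * v i ^ 2 + M.mass t i * (2 * v i * v' i)) ≤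
      -2 * M.stiff t w v := by
    rw [swv, Finset.mul_sum]
    refine Finset.sum_le_sum fun i _ => ?_
    have b2 := hB.rate_nonneg t ht i
    have a1 : M.mass t i * (2 * v i * v' i) = 2 * v i * (-(M.massRate t i * v i) - r i) := by
      rw [← e1 i]; ring
    rw [a1]
    nlinarith [mul_nonneg b2 (sq_nonneg (v i))]
  -- Young's inequality, with the weights that absorb half of the dissipation
  have k5 : -2 * M.stiff t w v ≤ ε / 2 * M.stiff t w w + 2 / ε * M.stiff t v v := by
    have h := M.stiff_self_nonneg t (w + (2 / ε) • v)
    rw [stiff_add ht, stiff_comm t w, stiff_comm t _ (w + _), stiff_add ht, stiff_add ht,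
      stiff_smul ht, stiff_smul ht, stiff_comm t w ((2 / ε) • v), stiff_smul ht,
      stiff_comm t v w] at h
    have h' := mul_nonneg (half_pos hε).le h
    have e : ε / 2 * (M.stiff t w w + 2 / ε * M.stiff t w v
        + 2 / ε * (M.stiff t w v + 2 / ε * M.stiff t v v)) =
        ε / 2 * M.stiff t w w + 2 * M.stiff t w v + 2 / ε * M.stiff t v v := by
      field_simp; ring
    have e' : ε / 2 * (M.stiff t w w + 2 / ε * M.stiff t w v
        + 2 / ε * (M.stiff t w v + 2 / ε * M.stiff t v v)) ≥ 0 := by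
      refine le_of_le_of_eq h' ?_
      rw [stiff_comm t v ((2 / ε) • v), stiff_smul ht]
      ring
    linarith
  have k6 := coercive_augmentedEnergy ht hε hθ hδ v
  set Y := M.augmentedEnergy ε θ δ t v
  set A := M.stiff t v v
  set B := M.stiff t w w
  rw [k1]
  have k7 : ε / 2 * d ≤ ε * M.stiff t v v' + ε * c₁ / 2 * A := by
    have := (abs_le.1 hd').2
    nlinarith
  have hi : 0 < 1 / ε := one_div_pos.2 hε
  have k8 := mul_le_mul_of_nonneg_left k2 hi.le
  have k9 := mul_le_mul_of_nonneg_left k3 hε.le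
  have k10 := mul_le_mul_of_nonneg_left (k4.trans k5) hi.le
  have e10 : 1 / ε * (ε / 2 * B + 2 / ε * A) = B / 2 + 2 / ε ^ 2 * A := by field_simp
  have e8 : 1 / ε * (c₂ / 2 * (c₄ + N)) = c₂ * c₄ / (2 * ε) + c₂ / (2 * ε) * N := by
    field_simp
  rw [e10] at k10
  rw [e8] at k8
  have hA : A ≤ 2 / ε * Y := by
    have : 0 ≤ 1 / (2 * ε) * N := by positivity
    have e : 2 / ε * (ε / 2 * A) = A := by field_simp
    rw [← e]
    exact mul_le_mul_of_nonneg_left (by linarith) (by positivity)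
  have hNY : N ≤ 2 * ε * Y := by
    have : 0 ≤ ε / 2 * A := by positivity
    have e : 2 * ε * (1 / (2 * ε) * N) = N := by field_simp
    rw [← e]
    exact mul_le_mul_of_nonneg_left (by linarith) (by positivity)
  have hY : 0 ≤ Y := by
    have : 0 ≤ ε / 2 * A := by positivity
    have : 0 ≤ 1 / (2 * ε) * N := by positivity
    linarith
  have f1 := mul_le_mul_of_nonneg_left hA
    (show 0 ≤ ε * c₁ / 2 + ε * c₃ + 2 / ε ^ 2 by positivity)
  have f2 := mul_le_mul_of_nonneg_left hNY (show 0 ≤ ε * c₃ + c₂ / (2 * ε) by positivity)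
  have f3 : c₂ * c₄ / (2 * ε) ≤ c₂ * c₄ / (2 * ε) * (1 + Y) :=
    le_mul_of_one_le_right (by positivity) (by linarith)
  have f4 : 0 ≤ 2 / ε * (ε * c₁ / 2 + ε * c₃ + 2 / ε ^ 2) + 2 * ε * (ε * c₃ + c₂ / (2 * ε)) := by
    positivity
  have f5 : (2 / ε * (ε * c₁ / 2 + ε * c₃ + 2 / ε ^ 2) + 2 * ε * (ε * c₃ + c₂ / (2 * ε)))
      + c₂ * c₄ / (2 * ε) = growthRate ε c₁ c₂ c₃ c₄ := rfl
  rw [← f5]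
  linarith

/-- The bound for the energy and the dissipation of a solution, from the differential inequality
and Gronwall's lemma. -/
theorem energy_le_of_energyBounds (hT : 0 < T) {c₁ c₂ c₃ c₄ : ℝ}
    (hB : M.EnergyBounds c₁ c₂ c₃ c₄)
    (hc₁ : 0 ≤ c₁) (hc₂ : 0 ≤ c₂) (hc₃ : 0 ≤ c₃) (hc₄ : 0 ≤ c₄)
    {ε θ δ : ℝ} (hε : 0 < ε) (hθ : 0 < θ) (hδ : δ ∈ Ioo (0 : ℝ) 1)
    {U₀ : E3 → ℝ} {U W : ℝ → E3 → ℝ} (h : M.IsSolution ε θ δ U₀ U W) {Y₀ : ℝ}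
    (hY₀ : M.augmentedEnergy ε θ δ 0 (fun i => U₀ (M.node 0 i)) ≤ Y₀) :
    IntervalIntegrable (fun t => M.a t (W t) (W t)) volume 0 T ∧
      ∀ t ∈ Icc 0 T, M.energyReg ε θ δ t (U t) + ∫ s in (0 : ℝ)..T, M.a s (W s) (W s) ≤
        3 * ((1 + Y₀) * Real.exp (growthRate ε c₁ c₂ c₃ c₄ * T)) := by
  set u := M.nodal U
  have hu : ∀ t ∈ Icc 0 T, HasDerivWithinAt u (M.nodalField ε θ δ t (u t)) (Icc 0 T) t :=
    fun t ht => (h.nodal_eq ht).2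
  have huc : ContinuousOn u (Icc 0 T) := fun t ht => (hu t ht).continuousWithinAt
  set b : ℝ → ℝ := fun t =>
    M.stiff t (M.nodalPotential ε θ δ t (u t)) (M.nodalPotential ε θ δ t (u t)) with hb
  have hbc : ContinuousOn b (Icc 0 T) :=
    continuousOn_stiff (continuousOn_nodalPotential hδ huc) (continuousOn_nodalPotential hδ huc)
  have hab : ∀ t ∈ Icc 0 T, M.a t (W t) (W t) = b t := by
    intro t ht
    have hWf := h.regular_W.2 t ht
    rw [a_eq_stiff ht hWf hWf, hb]
    simp only
    rw [← (h.nodal_eq ht).1]; rfl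
  have hb0 : ∀ t, 0 ≤ b t := fun t => M.stiff_self_nonneg t _
  -- `b` is extended continuously to all times, so that its primitive is differentiable
  set b' : ℝ → ℝ := fun t => b (projIcc 0 T hT.le t) with hb'
  have hb'c : Continuous b' :=
    (continuousOn_iff_continuous_domRestrict.1 hbc).comp continuous_projIcc
  have hbb' : ∀ t ∈ Icc 0 T, b' t = b t := fun t ht => by
    simp only [hb', projIcc_of_mem hT.le ht]
  have hint : ∫ s in (0 : ℝ)..T, M.a s (W s) (W s) = ∫ s in (0 : ℝ)..T, b' s := by
    refine intervalIntegral.integral_congr fun s hs => ?_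
    rw [uIcc_of_le hT.le] at hs
    simp only [hab s hs, hbb' s hs]
  have hii : IntervalIntegrable (fun t => M.a t (W t) (W t)) volume 0 T := by
    refine (ContinuousOn.intervalIntegrable ?_)
    rw [uIcc_of_le hT.le]
    exact hbc.congr fun t ht => hab t ht
  refine ⟨hii, fun t ht => ?_⟩
  choose! y hy hy' using fun t ht =>
    hasDerivWithinAt_augmentedEnergy hB hc₁ hc₂ hc₃ hc₄ hε hθ hδ (u := u) ht (hu t ht)
  set C := growthRate ε c₁ c₂ c₃ c₄ with hC
  have hC0 : 0 ≤ C := by rw [hC]; unfold growthRate; positivity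
  set Y : ℝ → ℝ := fun t => M.augmentedEnergy ε θ δ t (u t) with hYd
  set I : ℝ → ℝ := fun t => ∫ s in (0 : ℝ)..t, b' s with hI
  have hYn : ∀ t ∈ Icc 0 T, ε / 2 * M.stiff t (u t) (u t) + 1 / ε * ∑ i, M.mass t i *
      potentialReg θ δ (u t i) ≤ Y t ∧ 0 ≤ Y t := by
    intro t ht
    have h1 := coercive_augmentedEnergy ht hε hθ hδ (u t)
    have h2 : 0 ≤ ∑ i, M.mass t i * u t i ^ 2 :=
      Finset.sum_nonneg fun i _ => mul_nonneg (mass_pos ht i).le (sq_nonneg _)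
    have h3 := M.stiff_self_nonneg t (u t)
    have h4 : 0 ≤ 1 / ε * ∑ i, M.mass t i * u t i ^ 2 := by positivity
    have h5 : 0 ≤ 1 / (2 * ε) * ∑ i, M.mass t i * u t i ^ 2 := by positivity
    have h6 : 0 ≤ ε / 2 * M.stiff t (u t) (u t) := by positivity
    refine ⟨?_, by simp only [hYd]; linarith⟩
    simp only [hYd, augmentedEnergy]; linarith
  have hId : ∀ t, HasDerivAt I (b' t) t := fun t =>
    intervalIntegral.integral_hasDerivAt_right (hb'c.intervalIntegrable _ _)
      (hb'c.stronglyMeasurableAtFilter _ _) hb'c.continuousAt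
  have hI0 : ∀ t ∈ Icc 0 T, 0 ≤ I t := fun t ht =>
    intervalIntegral.integral_nonneg ht.1 fun s _ => hb0 _
  have hG := one_add_le_of_deriv_le (Z := fun t => Y t + 1 / 2 * I t) (T := T) (C := C)
    (fun t ht => (hy t ht).add ((hId t).hasDerivWithinAt.const_mul (1 / 2))) (fun t ht => by
      have h1 := hy' t ht
      have h2 := hbb' t ht
      have h3 := mul_nonneg hC0 (hI0 t ht)
      simp only [hb] at h2
      rw [h2]
      simp only [hYd]
      nlinarith)
  have hI00 : I 0 = 0 := by simp [hI]
  have hY0 : Y 0 ≤ Y₀ := by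
    simp only [hYd]
    have : u 0 = fun i => U₀ (M.node 0 i) := by
      funext i; exact h.initial (node_mem_surface 0 i)
    rw [this]; exact hY₀
  have hT' : T ∈ Icc 0 T := ⟨hT.le, le_rfl⟩
  have h00 : (0 : ℝ) ∈ Icc 0 T := ⟨le_rfl, hT.le⟩
  have hexp : ∀ t ∈ Icc 0 T, 1 + (Y t + 1 / 2 * I t) ≤ (1 + Y₀) * Real.exp (C * T) := by
    intro t ht
    refine (hG t ht).trans ?_
    simp only [hI00, mul_zero, add_zero]
    have h1 : Real.exp (C * t) ≤ Real.exp (C * T) :=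
      Real.exp_le_exp.2 (mul_le_mul_of_nonneg_left ht.2 hC0)
    have h2 := (hYn 0 h00).2
    exact mul_le_mul (by linarith) h1 (Real.exp_pos _).le (by linarith)
  have h1 := hexp t ht
  have h2 := hexp T hT'
  have h3 := hYn t ht
  have h4 := hYn T hT'
  rw [hint, energyReg_eq ht ε θ δ (h.regular_U.1.2 t ht)]
  have h5 := hI0 t ht
  have h6 : I T = ∫ s in (0 : ℝ)..T, b' s := rfl
  rw [← h6]
  have h7 : ε / 2 * M.stiff t (fun i => U t (M.node t i)) (fun i => U t (M.node t i))
      + 1 / ε * ∑ i, M.mass t i * potentialReg θ δ (U t (M.node t i)) ≤ Y t := h3.1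
  linarith [h4.2]

end Mesh

/-! ### From shape regularity to the energy estimate -/

lemma norm_dualVec_sq {e f : E3} (h : 0 < gramDet e f) :
    ‖dualVec e f‖ ^ 2 = ‖f‖ ^ 2 / gramDet e f := by
  rw [← real_inner_self_eq_norm_sq]
  nth_rewrite 2 [dualVec]
  rw [inner_smul_right, inner_sub_right, inner_smul_right, inner_smul_right,
    inner_dualVec_left h.ne', inner_dualVec_right]
  ring

lemma one_le_norm_dualVec_mul {e f : E3} (h : gramDet e f ≠ 0) : 1 ≤ ‖dualVec e f‖ * ‖e‖ := by
  rw [← inner_dualVec_left h]; exact real_inner_le_norm _ _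

lemma gramDet_le (e f : E3) : gramDet e f ≤ (‖e‖ * ‖f‖) ^ 2 := by
  unfold gramDet; nlinarith [sq_nonneg (inner ℝ e f)]

/-- A triangle whose heights over two sides are at least `p` has an area of at least `p² / 2`. -/
lemma sq_le_sqrt_gramDet {e f : E3} {p : ℝ} (hp : 0 < p) (hD : 0 < gramDet e f)
    (h1 : ‖dualVec e f‖ ≤ 1 / p) (h2 : ‖dualVec f e‖ ≤ 1 / p) :
    p ^ 2 ≤ Real.sqrt (gramDet e f) := by
  have hf : p ≤ ‖f‖ := by
    have := one_le_norm_dualVec_mul (e := f) (f := e) (by rw [gramDet_comm]; exact hD.ne')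
    have h3 : 1 ≤ 1 / p * ‖f‖ := this.trans (mul_le_mul_of_nonneg_right h2 (norm_nonneg _))
    rw [one_div, inv_mul_eq_div, le_div_iff₀ hp] at h3
    linarith
  have h4 : ‖f‖ ^ 2 / gramDet e f ≤ (1 / p) ^ 2 := by
    rw [← norm_dualVec_sq hD]
    exact pow_le_pow_left₀ (norm_nonneg _) h1 2
  rw [div_le_iff₀ hD, div_pow, one_pow, div_mul_eq_mul_div, one_mul,
    le_div_iff₀ (by positivity)] at h4
  refine Real.le_sqrt_of_sq_le ?_
  have h5 := pow_le_pow_left₀ hp.le hf 2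
  calc (p ^ 2) ^ 2 = p ^ 2 * p ^ 2 := by ring
    _ ≤ ‖f‖ ^ 2 * p ^ 2 := mul_le_mul_of_nonneg_right h5 (by positivity)
    _ ≤ _ := h4

namespace Mesh

variable {T : ℝ} {S : EvolvingSurface T} {M : Mesh S}

variable (M) in
/-- Uniform geometric bounds for a mesh of size `h`: edges have length at most `h`, the gradients of
the basis functions are at most `1 / (ρ h)`, the velocity is Lipschitz along edges, and its
divergence is non-negative and varies by at most `Q h` between triangles with a common node. -/
structure ShapeBounds (h ρ Λ Q : ℝ) : Prop where
  edge_le : ∀ t ∈ Icc 0 T, ∀ K ∈ M.triangles, ∀ i ∈ K, ∀ j ∈ K, ‖M.edge t i j‖ ≤ h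
  dual_le : ∀ t ∈ Icc 0 T, ∀ i j k, i ≠ j → i ≠ k → j ≠ k → {i, j, k} ∈ M.triangles →
    ‖dualVec (M.edge t i j) (M.edge t i k)‖ ≤ 1 / (ρ * h)
  velocity_le : ∀ t ∈ Icc 0 T, ∀ i j,
    ‖S.velocity t (M.node t j) - S.velocity t (M.node t i)‖ ≤ Λ * ‖M.edge t i j‖
  div_nonneg : ∀ t ∈ Icc 0 T, ∀ K ∈ M.triangles, 0 ≤ M.divVelocity t K
  div_close : ∀ t ∈ Icc 0 T, ∀ K ∈ M.triangles, ∀ L ∈ M.triangles, ∀ i ∈ K, i ∈ L →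
    |M.divVelocity t K - M.divVelocity t L| ≤ Q * h

section ShapeRegular

variable {h ρ Λ Q : ℝ}

lemma ShapeBounds.dual_le' (hM : M.ShapeBounds h ρ Λ Q) {t : ℝ} (ht : t ∈ Icc 0 T)
    {i j k : Fin M.numNodes} (hij : i ≠ j) (hik : i ≠ k) (hjk : j ≠ k)
    (hK : {i, j, k} ∈ M.triangles) :
    ‖dualVec (M.edge t i k) (M.edge t i j)‖ ≤ 1 / (ρ * h) :=
  hM.dual_le t ht i k j hik hij hjk.symm (by rwa [Finset.pair_comm])

/-- The shape regularity bounds the area of a triangle from below. -/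
lemma ShapeBounds.le_sqrt_gramDet (hM : M.ShapeBounds h ρ Λ Q) (hh : 0 < h) (hρ : 0 < ρ) {t : ℝ}
    (ht : t ∈ Icc 0 T) {i j k : Fin M.numNodes} (hij : i ≠ j) (hik : i ≠ k) (hjk : j ≠ k)
    (hK : {i, j, k} ∈ M.triangles) :
    ρ ^ 2 * h ^ 2 ≤ Real.sqrt (gramDet (M.edge t i j) (M.edge t i k)) := by
  rw [← mul_pow]
  exact sq_le_sqrt_gramDet (mul_pos hρ hh) (gramDet_edge_pos ht hij hik hjk hK)
    (hM.dual_le t ht i j k hij hik hjk hK) (hM.dual_le' ht hij hik hjk hK)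

lemma ShapeBounds.divVelocity_le (hM : M.ShapeBounds h ρ Λ Q) (hh : 0 < h) (hρ : 0 < ρ)
    (hΛ : 0 ≤ Λ) {t : ℝ} (ht : t ∈ Icc 0 T) {K : Finset (Fin M.numNodes)}
    (hK : K ∈ M.triangles) : M.divVelocity t K ≤ 2 * Λ / ρ := by
  obtain ⟨i, j, k, hij, hik, hjk, rfl⟩ := exists_triple' hK
  rw [divVelocity_eq ht hij hik hjk hK]
  have h1 := hM.dual_le t ht i j k hij hik hjk hK
  have h2 := hM.dual_le' ht hij hik hjk hK
  have h3 := (hM.velocity_le t ht i j).trans (mul_le_mul_of_nonneg_left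
    (hM.edge_le t ht _ hK i (by simp) j (by simp)) hΛ)
  have h4 := (hM.velocity_le t ht i k).trans (mul_le_mul_of_nonneg_left
    (hM.edge_le t ht _ hK i (by simp) k (by simp)) hΛ)
  have hp : 0 ≤ 1 / (ρ * h) := by positivity
  have e : 2 * Λ / ρ = 1 / (ρ * h) * (Λ * h) + 1 / (ρ * h) * (Λ * h) := by field_simp; ring
  rw [e]
  exact add_le_add ((real_inner_le_norm _ _).trans (mul_le_mul h1 h3 (norm_nonneg _) hp))
    ((real_inner_le_norm _ _).trans (mul_le_mul h2 h4 (norm_nonneg _) hp))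

lemma inner_triGrad_left {t : ℝ} (ht : t ∈ Icc 0 T) {i j k : Fin M.numNodes} (hij : i ≠ j)
    (hik : i ≠ k) (hjk : j ≠ k) (hK : {i, j, k} ∈ M.triangles) (u : Fin M.numNodes → ℝ) :
    inner ℝ (M.triGrad t i j k u) (M.edge t i j) = u j - u i ∧
      inner ℝ (M.triGrad t i j k u) (M.edge t i k) = u k - u i := by
  have hD := (gramDet_edge_pos ht hij hik hjk hK).ne'
  unfold triGrad
  simp only [inner_add_left, inner_smul_left, conj_trivial, inner_dualVec_left hD,
    inner_dualVec_left (e := M.edge t i k) (f := M.edge t i j) (by rwa [gramDet_comm]),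
    inner_dualVec_right]
  constructor <;> ring

/-- The contribution of a triangle to the stiffness form, without inverses of vectors. -/
lemma cellArea_mul_inner_triGrad {t : ℝ} (ht : t ∈ Icc 0 T) {i j k : Fin M.numNodes} (hij : i ≠ j)
    (hik : i ≠ k) (hjk : j ≠ k) (hK : {i, j, k} ∈ M.triangles) (u v : Fin M.numNodes → ℝ) :
    M.cellArea t {i, j, k} * inner ℝ (M.triGrad t i j k u) (M.triGrad t i j k v) =
      refArea * ((‖M.edge t i k‖ ^ 2 * ((u j - u i) * (v j - v i))
        - inner ℝ (M.edge t i j) (M.edge t i k)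
          * ((u j - u i) * (v k - v i) + (u k - u i) * (v j - v i))
        + ‖M.edge t i j‖ ^ 2 * ((u k - u i) * (v k - v i)))
          / Real.sqrt (gramDet (M.edge t i j) (M.edge t i k))) := by
  have hD := gramDet_edge_pos ht hij hik hjk hK
  obtain ⟨h1, h2⟩ := inner_triGrad_left ht hij hik hjk hK u
  have hs := Real.sqrt_pos.2 hD
  rw [cellArea_triple]
  nth_rewrite 2 [triGrad]
  unfold dualVec
  rw [gramDet_comm (M.edge t i k) (M.edge t i j)]
  simp only [inner_add_right, inner_smul_right, inner_sub_right, h1, h2]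
  nth_rewrite 2 3 [← Real.sq_sqrt hD.le]
  rw [real_inner_comm (M.edge t i j) (M.edge t i k)]
  field_simp
  ring

/-- The time derivative of the contribution of a triangle to the stiffness form. -/
lemma ShapeBounds.hasDerivWithinAt_triangle (hM : M.ShapeBounds h ρ Λ Q) (hh : 0 < h)
    (hρ : 0 < ρ) (hΛ : 0 ≤ Λ) {t : ℝ} (ht : t ∈ Icc 0 T) {K : Finset (Fin M.numNodes)}
    (hK : K ∈ M.triangles) {u : ℝ → Fin M.numNodes → ℝ} {u' : Fin M.numNodes → ℝ}
    (hu : HasDerivWithinAt u u' (Icc 0 T) t) :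
    ∃ d, HasDerivWithinAt (fun s => M.cellArea s K *
        inner ℝ (M.grad s K (M.fe s (u s))) (M.grad s K (M.fe s (u s)))) d (Icc 0 T) t ∧
      |d - 2 * (M.cellArea t K * inner ℝ (M.grad t K (M.fe t (u t))) (M.grad t K (M.fe t u')))|
        ≤ (4 * Λ / ρ ^ 2 + 2 * Λ / ρ) * (M.cellArea t K *
          inner ℝ (M.grad t K (M.fe t (u t))) (M.grad t K (M.fe t (u t)))) := by
  have hdiv0 := hM.div_nonneg t ht K hK
  have hdiv := hM.divVelocity_le hh hρ hΛ ht hK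
  obtain ⟨i, j, k, hij, hik, hjk, rfl⟩ := exists_triple' hK
  have hD := gramDet_edge_pos ht hij hik hjk hK
  have hs := Real.sqrt_pos.2 hD
  have hσ := hM.le_sqrt_gramDet hh hρ ht hij hik hjk hK
  have he := hasDerivWithinAt_edge ht i j
  have hf := hasDerivWithinAt_edge ht i k
  have hui := hasDerivWithinAt_pi.1 hu
  have ha := (hui j).sub (hui i)
  have hb := (hui k).sub (hui i)
  have hE := hM.edge_le t ht _ hK i (by simp) j (by simp)
  have hF := hM.edge_le t ht _ hK i (by simp) k (by simp)
  have hE' := (hM.velocity_le t ht i j).trans (mul_le_mul_of_nonneg_left hE hΛ)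
  have hF' := (hM.velocity_le t ht i k).trans (mul_le_mul_of_nonneg_left hF hΛ)
  obtain ⟨g1, g2⟩ := inner_triGrad_left ht hij hik hjk hK (u t)
  have hg := cellArea_mul_inner_triGrad ht hij hik hjk hK (u t) (u t)
  rw [cellArea_triple, real_inner_self_eq_norm_sq] at hg
  have hder := ((((hf.norm_sq.mul (ha.mul ha)).sub ((he.inner ℝ hf).mul
    ((ha.mul hb).add (hb.mul ha)))).add (he.norm_sq.mul (hb.mul hb))).div
    (hasDerivWithinAt_sqrt_gramDet he hf hD) hs.ne').const_mul refArea
  rw [← divVelocity_eq ht hij hik hjk hK] at hder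
  refine ⟨_, hder.congr (fun s hs => ?_) ?_, ?_⟩
  · rw [grad_fe hs hij hik hjk hK]
    exact cellArea_mul_inner_triGrad hs hij hik hjk hK _ _
  · rw [grad_fe ht hij hik hjk hK]
    exact cellArea_mul_inner_triGrad ht hij hik hjk hK _ _
  · simp only [grad_fe ht hij hik hjk hK]
    rw [cellArea_mul_inner_triGrad ht hij hik hjk hK (u t) u', cellArea_triple,
      real_inner_self_eq_norm_sq]
    simp only [Pi.sub_apply, Pi.add_apply, Pi.mul_apply]
    set e := M.edge t i j
    set f := M.edge t i k
    set e' := S.velocity t (M.node t j) - S.velocity t (M.node t i)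
    set f' := S.velocity t (M.node t k) - S.velocity t (M.node t i)
    set g := M.triGrad t i j k (u t)
    set σ := Real.sqrt (gramDet e f)
    set a := u t j - u t i with ha'
    set b := u t k - u t i with hb'
    set a' := u' j - u' i
    set b' := u' k - u' i
    set D := M.divVelocity t {i, j, k}
    have hr := refArea_pos
    -- the square of the rotated gradient, scaled by the area
    have hN : ‖a • f - b • e‖ ^ 2 = ‖f‖ ^ 2 * (a * a) - inner ℝ e f * (a * b + b * a)
        + ‖e‖ ^ 2 * (b * b) := by
      rw [← real_inner_self_eq_norm_sq]
      simp only [inner_sub_left, inner_sub_right, inner_smul_left, inner_smul_right, conj_trivial,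
        real_inner_self_eq_norm_sq, real_inner_comm e f]
      ring
    have hN' : ‖a • f - b • e‖ ^ 2 = (σ * ‖g‖) ^ 2 := by
      rw [hN, mul_pow]
      rw [← hN] at hg ⊢
      field_simp at hg
      linarith
    have hN'' : ‖a • f - b • e‖ = σ * ‖g‖ :=
      (sq_eq_sq₀ (norm_nonneg _) (by positivity)).1 hN'
    have hal : |a| ≤ ‖g‖ * h := by
      rw [← g1]
      exact (abs_real_inner_le_norm _ _).trans (mul_le_mul_of_nonneg_left hE (norm_nonneg _))
    have hbl : |b| ≤ ‖g‖ * h := by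
      rw [← g2]
      exact (abs_real_inner_le_norm _ _).trans (mul_le_mul_of_nonneg_left hF (norm_nonneg _))
    have hP : ‖a • f' - b • e'‖ ≤ 2 * Λ * h ^ 2 * ‖g‖ := by
      refine (norm_sub_le _ _).trans ?_
      rw [norm_smul, norm_smul, Real.norm_eq_abs, Real.norm_eq_abs]
      have q1 := mul_le_mul hal hF' (norm_nonneg _) (by positivity)
      have q2 := mul_le_mul hbl hE' (norm_nonneg _) (by positivity)
      linarith
    have hI : inner ℝ (a • f - b • e) (a • f' - b • e') = inner ℝ f f' * (a * a)
        - (inner ℝ e f' + inner ℝ e' f) * (a * b) + inner ℝ e e' * (b * b) := by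
      simp only [inner_sub_left, inner_sub_right, inner_smul_left, inner_smul_right, conj_trivial,
        real_inner_comm e' f]
      ring
    have hI' : |inner ℝ (a • f - b • e) (a • f' - b • e')| ≤
        σ * ‖g‖ * (2 * Λ * h ^ 2 * ‖g‖) := by
      refine (abs_real_inner_le_norm _ _).trans ?_
      rw [hN'']
      exact mul_le_mul_of_nonneg_left hP (by positivity)
    -- the terms with `u'` cancel, and the rest comes from the velocities of the edges and of the
    -- area
    have key : ∀ X : ℝ, X = refArea * (2 * inner ℝ (a • f - b • e) (a • f' - b • e') / σ
        - ‖a • f - b • e‖ ^ 2 * D / σ) → |X| ≤ (4 * Λ / ρ ^ 2 + 2 * Λ / ρ) *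
          (refArea * σ * ‖g‖ ^ 2) := by
      rintro X rfl
      rw [abs_mul, abs_of_pos hr, hN']
      have q1 : |2 * inner ℝ (a • f - b • e) (a • f' - b • e') / σ| ≤ 4 * Λ * h ^ 2 * ‖g‖ ^ 2 := by
        rw [abs_div, abs_of_pos hs, div_le_iff₀ hs, abs_mul, abs_two]
        nlinarith
      have q2 : |(σ * ‖g‖) ^ 2 * D / σ| ≤ σ * ‖g‖ ^ 2 * (2 * Λ / ρ) := by
        have : (σ * ‖g‖) ^ 2 * D / σ = σ * ‖g‖ ^ 2 * D := by field_simp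
        rw [this, abs_of_nonneg (by positivity)]
        gcongr
      have q3 : 4 * Λ * h ^ 2 * ‖g‖ ^ 2 ≤ 4 * Λ / ρ ^ 2 * (σ * ‖g‖ ^ 2) := by
        have : 4 * Λ * h ^ 2 * ‖g‖ ^ 2 = 4 * Λ / ρ ^ 2 * (ρ ^ 2 * h ^ 2 * ‖g‖ ^ 2) := by
          field_simp
        rw [this]
        gcongr
      have q4 := (abs_sub _ _).trans (add_le_add (q1.trans q3) q2)
      calc _ ≤ refArea * (4 * Λ / ρ ^ 2 * (σ * ‖g‖ ^ 2) + σ * ‖g‖ ^ 2 * (2 * Λ / ρ)) :=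
            mul_le_mul_of_nonneg_left q4 hr.le
        _ = _ := by ring
    refine key _ ?_
    rw [hI, hN]
    field_simp
    ring

/-- A mesh with uniform geometric bounds admits the energy estimate. -/
theorem ShapeBounds.energyBounds (hT : 0 < T) (hM : M.ShapeBounds h ρ Λ Q) (hh : 0 < h)
    (hρ : 0 < ρ) (hΛ : 0 ≤ Λ) {m₀ : ℝ} (hm₀ : ∑ i, M.mass 0 i ≤ m₀) :
    M.EnergyBounds (4 * Λ / ρ ^ 2 + 2 * Λ / ρ) (2 * Λ / ρ) (1 / 2 + 12 * Q ^ 2 / ρ ^ 2)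
      ((1 + m₀) * Real.exp (2 * Λ / ρ * T)) := by
  have hcell : ∀ t (K : Finset (Fin M.numNodes)) (i : Fin M.numNodes),
      0 ≤ (if i ∈ K then M.cellArea t K / 3 else 0) := by
    intro t K i
    split_ifs
    · exact _root_.div_nonneg (cellArea_nonneg t K) (by norm_num)
    · exact le_rfl
  have hrn : ∀ t ∈ Icc 0 T, ∀ i, 0 ≤ M.massRate t i := fun t ht i =>
    Finset.sum_nonneg fun K hK => mul_nonneg (hcell t K i) (hM.div_nonneg t ht K hK)
  have hrl : ∀ t ∈ Icc 0 T, ∀ i, M.massRate t i ≤ 2 * Λ / ρ * M.mass t i := by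
    intro t ht i
    unfold massRate mass
    rw [Finset.mul_sum]
    refine Finset.sum_le_sum fun K hK => ?_
    rw [mul_comm]
    exact mul_le_mul_of_nonneg_right (hM.divVelocity_le hh hρ hΛ ht hK) (hcell t K i)
  refine ⟨?_, hrn, hrl, ?_, ?_⟩
  · intro t ht u u' hu
    choose! d hd hd' using fun K hK => hM.hasDerivWithinAt_triangle hh hρ hΛ ht (K := K) hK hu
    refine ⟨∑ K ∈ M.triangles, d K, ?_, ?_⟩
    · unfold stiff
      simp only [a_eq]
      exact HasDerivWithinAt.fun_sum fun K hK => hd K hK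
    · unfold stiff
      rw [a_eq, a_eq, Finset.mul_sum, Finset.mul_sum, ← Finset.sum_sub_distrib]
      exact (Finset.abs_sum_le_sum_abs _ _).trans (Finset.sum_le_sum fun K hK => hd' K hK)
  · intro t ht u
    set q : Fin M.numNodes → ℝ := fun i => M.massRate t i / M.mass t i with hq
    have hq0 : ∀ i, 0 ≤ q i := fun i => _root_.div_nonneg (hrn t ht i) (mass_pos ht i).le
    -- `q i` is a weighted mean of the divergences on the triangles around the node `i`
    have hqK : ∀ K ∈ M.triangles, ∀ i ∈ K, |q i - M.divVelocity t K| ≤ Q * h := by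
      intro K hK i hi
      have hm := mass_pos ht i
      have e : q i - M.divVelocity t K = (∑ L ∈ M.triangles,
          (if i ∈ L then M.cellArea t L / 3 else 0) * (M.divVelocity t L - M.divVelocity t K))
          / M.mass t i := by
        rw [eq_div_iff hm.ne', sub_mul, hq]
        simp only [mul_sub, Finset.sum_sub_distrib]
        rw [div_mul_cancel₀ _ hm.ne', ← Finset.sum_mul, mul_comm]
        rw [mul_comm]; unfold massRate mass; ring
      rw [e, abs_div, abs_of_pos hm, div_le_iff₀ hm]
      refine (Finset.abs_sum_le_sum_abs _ _).trans ?_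
      unfold mass
      rw [Finset.mul_sum]
      refine Finset.sum_le_sum fun L hL => ?_
      rw [abs_mul, abs_of_nonneg (hcell t L i), mul_comm]
      by_cases hiL : i ∈ L
      · exact mul_le_mul_of_nonneg_right (hM.div_close t ht L hL K hK i hiL hi) (hcell t L i)
      · simp [hiL]
    have hqq : ∀ K ∈ M.triangles, ∀ i ∈ K, ∀ j ∈ K, |q j - q i| ≤ 2 * Q * h := by
      intro K hK i hi j hj
      have h1 := abs_le.1 (hqK K hK i hi)
      have h2 := abs_le.1 (hqK K hK j hj)
      rw [abs_le]; constructor <;> linarith [h1.1, h1.2, h2.1, h2.2]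
    have e1 : -∑ i, M.massRate t i / M.mass t i * u i * M.stiff t u (Pi.single i 1) =
        -M.stiff t u (fun i => q i * u i) := by
      rw [stiff_eq_sum ht u (fun i => q i * u i)]
      congr 1
      refine Finset.sum_congr rfl fun i _ => ?_
      simp only [hq]; ring
    have e2 : ∑ i, M.mass t i * u i ^ 2 =
        ∑ K ∈ M.triangles, ∑ i, (if i ∈ K then M.cellArea t K / 3 else 0) * u i ^ 2 := by
      rw [Finset.sum_comm]
      refine Finset.sum_congr rfl fun i _ => ?_
      unfold mass; rw [Finset.sum_mul]
    rw [e1, e2]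
    unfold stiff
    rw [a_eq, a_eq, ← Finset.sum_add_distrib, Finset.mul_sum, ← Finset.sum_neg_distrib]
    refine Finset.sum_le_sum fun K hK => ?_
    have hα := cellArea_nonneg t K (M := M)
    have hqq' := hqq K hK
    obtain ⟨i, j, k, hij, hik, hjk, rfl⟩ := exists_triple' hK
    rw [grad_fe ht hij hik hjk hK, grad_fe ht hij hik hjk hK]
    rw [sum_triple (M := M) hij hik hjk (fun l hl => by rw [if_neg hl, zero_mul])]
    simp only [Finset.mem_insert, Finset.mem_singleton, true_or, or_true, if_true]
    set g := M.triGrad t i j k u with hg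
    set α := M.cellArea t {i, j, k}
    -- the gradient of `q u` is `q i • g` up to a remainder `G` in which the differences of `q`,
    -- of order `h`, compensate the factor `1 / h` of the gradients of the basis functions
    set G := (((q j - q i) * u j) • dualVec (M.edge t i j) (M.edge t i k)
      + ((q k - q i) * u k) • dualVec (M.edge t i k) (M.edge t i j)) with hG
    have e3 : M.triGrad t i j k (fun l => q l * u l) = q i • g + G := by
      rw [hg, hG]; unfold triGrad; module
    have hGn : ‖G‖ ≤ 2 * |Q| / ρ * (|u j| + |u k|) := by
      have h1 := hM.dual_le t ht i j k hij hik hjk hK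
      have h2 := hM.dual_le' ht hij hik hjk hK
      refine (norm_add_le _ _).trans ?_
      rw [norm_smul, norm_smul, Real.norm_eq_abs, Real.norm_eq_abs, abs_mul, abs_mul]
      have b1 : |q j - q i| ≤ 2 * |Q| * h := (hqq' i (by simp) j (by simp)).trans
        (by have := le_abs_self Q; gcongr)
      have b2 : |q k - q i| ≤ 2 * |Q| * h := (hqq' i (by simp) k (by simp)).trans
        (by have := le_abs_self Q; gcongr)
      calc _ ≤ 2 * |Q| * h * |u j| * (1 / (ρ * h)) + 2 * |Q| * h * |u k| * (1 / (ρ * h)) := by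
            gcongr
        _ = _ := by field_simp
    have hGn2 : ‖G‖ ^ 2 ≤ 8 * Q ^ 2 / ρ ^ 2 * (u j ^ 2 + u k ^ 2) := by
      calc ‖G‖ ^ 2 ≤ (2 * |Q| / ρ * (|u j| + |u k|)) ^ 2 :=
            pow_le_pow_left₀ (norm_nonneg _) hGn 2
        _ = 4 * Q ^ 2 / ρ ^ 2 * (|u j| + |u k|) ^ 2 := by
            rw [mul_pow, div_pow, mul_pow, sq_abs]; ring
        _ ≤ 4 * Q ^ 2 / ρ ^ 2 * (2 * (u j ^ 2 + u k ^ 2)) := by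
            refine mul_le_mul_of_nonneg_left ?_ (by positivity)
            nlinarith [sq_nonneg (|u j| - |u k|), sq_abs (u j), sq_abs (u k)]
        _ = _ := by ring
    rw [e3, inner_add_right, inner_smul_right, real_inner_self_eq_norm_sq]
    have hi : -inner ℝ g G ≤ ‖g‖ ^ 2 / 2 + ‖G‖ ^ 2 / 2 := by
      have := abs_le.1 (abs_real_inner_le_norm g G)
      nlinarith [sq_nonneg (‖g‖ - ‖G‖)]
    have hqi := mul_nonneg (hq0 i) (sq_nonneg ‖g‖)
    have hfin : -(q i * ‖g‖ ^ 2 + inner ℝ g G) ≤ (1 / 2 + 12 * Q ^ 2 / ρ ^ 2) *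
        (‖g‖ ^ 2 + (u i ^ 2 + u j ^ 2 + u k ^ 2) / 3) := by
      have e4 : 8 * Q ^ 2 / ρ ^ 2 = 2 / 3 * (12 * Q ^ 2 / ρ ^ 2) := by ring
      have hc : 0 ≤ 12 * Q ^ 2 / ρ ^ 2 := by positivity
      rw [e4] at hGn2
      set c := 12 * Q ^ 2 / ρ ^ 2
      nlinarith [mul_nonneg hc (sq_nonneg ‖g‖), mul_nonneg hc (sq_nonneg (u i)), sq_nonneg (u i),
        sq_nonneg (u j), sq_nonneg (u k)]
    calc -(α * (q i * ‖g‖ ^ 2 + inner ℝ g G)) = α * -(q i * ‖g‖ ^ 2 + inner ℝ g G) := by ring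
      _ ≤ α * _ := mul_le_mul_of_nonneg_left hfin hα
      _ = _ := by ring
  · intro t ht
    have hT' : 0 ≤ 2 * Λ / ρ := by positivity
    have := one_add_le_of_deriv_le (Z := fun t => ∑ i, M.mass t i) (T := T) (C := 2 * Λ / ρ)
      (fun t ht => HasDerivWithinAt.fun_sum fun i _ => hasDerivWithinAt_mass ht i) (fun t ht => by
        refine (Finset.sum_le_sum fun i _ => hrl t ht i).trans ?_
        rw [← Finset.mul_sum]
        exact mul_le_mul_of_nonneg_left (by linarith) hT') t ht
    have h1 : Real.exp (2 * Λ / ρ * t) ≤ Real.exp (2 * Λ / ρ * T) :=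
      Real.exp_le_exp.2 (mul_le_mul_of_nonneg_left ht.2 hT')
    have h0 : 0 ≤ ∑ i, M.mass 0 i :=
      Finset.sum_nonneg fun i _ => (mass_pos ⟨le_rfl, hT.le⟩ i).le
    have h2 : (1 + ∑ i, M.mass 0 i) * Real.exp (2 * Λ / ρ * t) ≤
        (1 + m₀) * Real.exp (2 * Λ / ρ * T) :=
      mul_le_mul (by linarith) h1 (Real.exp_pos _).le (by linarith)
    linarith

end ShapeRegular

end Mesh

/-! ### Bounds for the velocity -/

/-- A first-order Taylor estimate on a convex set where the derivative is Lipschitz. -/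
lemma norm_sub_sub_fderiv_le {F : Type*} [NormedAddCommGroup F] [NormedSpace ℝ F] {f : E3 → F}
    {B : Set E3} {L : ℝ} (hL : 0 ≤ L) (hB : Convex ℝ B) (hf : ∀ x ∈ B, DifferentiableAt ℝ f x)
    (hf' : ∀ x ∈ B, ∀ y ∈ B, ‖fderiv ℝ f x - fderiv ℝ f y‖ ≤ L * ‖x - y‖) {x y : E3}
    (hx : x ∈ B) (hy : y ∈ B) :
    ‖f x - f y - fderiv ℝ f y (x - y)‖ ≤ L * ‖x - y‖ ^ 2 := by
  have hs : segment ℝ y x ⊆ B := hB.segment_subset hy hx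
  have h := (convex_segment y x).norm_image_sub_le_of_norm_fderiv_le' (𝕜 := ℝ) (f := f)
    (φ := fderiv ℝ f y) (C := L * ‖x - y‖) (fun z hz => hf z (hs hz)) ?_
    (left_mem_segment ℝ y x) (right_mem_segment ℝ y x)
  · rw [pow_two, ← mul_assoc]; exact h
  · intro z hz
    refine (hf' z (hs hz) y hy).trans (mul_le_mul_of_nonneg_left ?_ hL)
    obtain ⟨a, b, ha, hb, hab, rfl⟩ := hz
    have e : a • y + b • x - y = b • (x - y) := by
      have : a = 1 - b := by linarith
      subst this; module
    rw [e, norm_smul, Real.norm_of_nonneg hb]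
    exact mul_le_of_le_one_left (norm_nonneg _) (by linarith)

/-- On a ball the velocity is Lipschitz and satisfies a second-order Taylor estimate, uniformly in
time. -/
lemma IsC1InTimeC2InSpace.exists_bounds {T : ℝ} {V : ℝ → E3 → E3}
    (hV : IsC1InTimeC2InSpace T V) (R : ℝ) :
    ∃ Λ : ℝ, 0 ≤ Λ ∧ ∀ t ∈ Icc 0 T, ∀ y ∈ Metric.closedBall (0 : E3) R,
      ‖fderiv ℝ (V t) y‖ ≤ Λ ∧ ∀ x ∈ Metric.closedBall (0 : E3) R,
        ‖V t x - V t y‖ ≤ Λ * ‖x - y‖ ∧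
        ‖V t x - V t y - fderiv ℝ (V t) y (x - y)‖ ≤ Λ * ‖x - y‖ ^ 2 := by
  obtain ⟨V', hC, hk, -⟩ := hV
  have hK : IsCompact (Icc 0 T ×ˢ Metric.closedBall (0 : E3) R) :=
    isCompact_Icc.prod (isCompact_closedBall _ _)
  have hsub : Icc 0 T ×ˢ Metric.closedBall (0 : E3) R ⊆ Icc 0 T ×ˢ univ :=
    prod_mono_right (subset_univ _)
  obtain ⟨b1, hb1⟩ := hK.exists_bound_of_continuousOn ((hk 1 (by norm_num)).1.mono hsub)
  obtain ⟨b2, hb2⟩ := hK.exists_bound_of_continuousOn ((hk 2 le_rfl).1.mono hsub)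
  set Λ := max 0 (max b1 b2) with hΛ
  have h1 : ∀ t ∈ Icc 0 T, ∀ y ∈ Metric.closedBall (0 : E3) R, ‖fderiv ℝ (V t) y‖ ≤ Λ := by
    intro t ht y hy
    rw [← norm_iteratedFDeriv_one]
    exact (hb1 (t, y) ⟨ht, hy⟩).trans ((le_max_left _ _).trans (le_max_right _ _))
  have h2 : ∀ t ∈ Icc 0 T, ∀ y ∈ Metric.closedBall (0 : E3) R,
      ‖fderiv ℝ (fderiv ℝ (V t)) y‖ ≤ Λ := by
    intro t ht y hy
    rw [← norm_iteratedFDeriv_one, norm_iteratedFDeriv_fderiv]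
    exact (hb2 (t, y) ⟨ht, hy⟩).trans ((le_max_right _ _).trans (le_max_right _ _))
  have hB := convex_closedBall (0 : E3) R
  refine ⟨Λ, le_max_left _ _, fun t ht y hy => ⟨h1 t ht y hy, fun x hx => ⟨?_, ?_⟩⟩⟩
  · exact hB.norm_image_sub_le_of_norm_fderiv_le (𝕜 := ℝ)
      (fun z _ => ((hC t ht).1.differentiable (by norm_num)) z) (fun z hz => h1 t ht z hz) hy hx
  · refine norm_sub_sub_fderiv_le (le_max_left _ _) hB
      (fun z _ => ((hC t ht).1.differentiable (by norm_num)) z) (fun z hz w hw => ?_) hx hy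
    exact hB.norm_image_sub_le_of_norm_fderiv_le (𝕜 := ℝ) (fun z _ =>
      (((hC t ht).1.fderiv_right (m := 1) (by norm_num)).differentiable (by norm_num)) z)
      (fun z hz => h2 t ht z hz) hw hz

/-- Trajectories that start on a compact surface stay in a ball, although the velocity is only
locally Lipschitz: a trajectory stays close to a given one if it starts close to it. -/
lemma EvolvingSurface.exists_norm_flow_le {T : ℝ} (S : EvolvingSurface T) :
    ∃ R : ℝ, 0 ≤ R ∧ ∀ x ∈ S.initial.carrier, ∀ t ∈ Icc 0 T, ‖S.flow x t‖ ≤ R := by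
  refine S.initial.isCompact.induction_on (p := fun A => ∃ R : ℝ, 0 ≤ R ∧ ∀ x ∈ A,
    ∀ t ∈ Icc 0 T, ‖S.flow x t‖ ≤ R) ⟨0, le_rfl, by simp⟩ ?_ ?_ ?_
  · rintro A B hAB ⟨R, hR, h⟩
    exact ⟨R, hR, fun x hx => h x (hAB hx)⟩
  · rintro A B ⟨R, hR, h⟩ ⟨R', hR', h'⟩
    refine ⟨max R R', le_max_of_le_left hR, ?_⟩
    rintro x (hx | hx) t ht
    · exact (h x hx t ht).trans (le_max_left _ _)
    · exact (h' x hx t ht).trans (le_max_right _ _)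
  intro x₀ hx₀
  have hcont : ∀ x ∈ S.initial.carrier, ContinuousOn (S.flow x) (Icc 0 T) :=
    fun x hx t ht => (S.flow_deriv x hx t ht).continuousWithinAt
  obtain ⟨b, hb⟩ := isCompact_Icc.exists_bound_of_continuousOn (hcont x₀ hx₀)
  obtain ⟨Λ, hΛ, hV⟩ := S.velocity_regular.exists_bounds (max 0 b + 1)
  have hr : 0 < Real.exp (-(Λ * T)) := Real.exp_pos _
  refine ⟨S.initial.carrier ∩ Metric.ball x₀ (Real.exp (-(Λ * T))),
    inter_mem_nhdsWithin _ (Metric.ball_mem_nhds _ hr), max 0 b + 1,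
    add_nonneg (le_max_left _ _) zero_le_one, ?_⟩
  rintro x ⟨hx, hxr⟩ t ht
  -- the first time at which the distance to the trajectory of `x₀` is `1`, if there is one
  by_contra! hcon
  have hd : ContinuousOn (fun s => dist (S.flow x s) (S.flow x₀ s)) (Icc 0 T) :=
    fun s hs => (hcont x hx s hs).dist (hcont x₀ hx₀ s hs)
  have hA : IsCompact (Icc 0 T ∩ (fun s => dist (S.flow x s) (S.flow x₀ s)) ⁻¹' Ici 1) :=
    isCompact_Icc.of_isClosed_subset (hd.preimage_isClosed_of_isClosed isClosed_Icc isClosed_Ici)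
      inter_subset_left
  have hne : t ∈ Icc 0 T ∩ (fun s => dist (S.flow x s) (S.flow x₀ s)) ⁻¹' Ici 1 := by
    refine ⟨ht, ?_⟩
    simp only [mem_preimage, mem_Ici, dist_eq_norm]
    have := norm_le_norm_add_norm_sub' (S.flow x t) (S.flow x₀ t)
    have h2 := (hb t ht).trans (le_max_right 0 b)
    linarith
  obtain ⟨s, ⟨⟨hs0, hs1⟩, hs⟩, hmin⟩ := hA.exists_isLeast ⟨t, hne⟩
  have hlt : ∀ r ∈ Ico 0 s, dist (S.flow x r) (S.flow x₀ r) < 1 := by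
    intro r hr'
    by_contra! h
    exact absurd (hmin ⟨⟨hr'.1, hr'.2.le.trans hs1⟩, h⟩) (not_le.2 hr'.2)
  have hsT : Icc 0 s ⊆ Icc 0 T := Icc_subset_Icc_right hs1
  have hmem₀ : ∀ r ∈ Ico 0 s, S.flow x₀ r ∈ Metric.closedBall (0 : E3) (max 0 b + 1) := by
    intro r hr'
    rw [mem_closedBall_zero_iff]
    have := (hb r (hsT (Ico_subset_Icc_self hr'))).trans (le_max_right 0 b)
    linarith
  have hmem : ∀ r ∈ Ico 0 s, S.flow x r ∈ Metric.closedBall (0 : E3) (max 0 b + 1) := by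
    intro r hr'
    rw [mem_closedBall_zero_iff]
    have h1 := (hb r (hsT (Ico_subset_Icc_self hr'))).trans (le_max_right 0 b)
    have h2 := hlt r hr'
    rw [dist_eq_norm] at h2
    have := norm_le_norm_add_norm_sub' (S.flow x r) (S.flow x₀ r)
    linarith
  have hder : ∀ y ∈ S.initial.carrier, ∀ r ∈ Ico 0 s,
      HasDerivWithinAt (S.flow y) (S.velocity r (S.flow y r)) (Ici r) r := fun y hy r hr' =>
    hasDerivWithinAt_Ici_of_Icc ⟨hr'.1, hr'.2.trans_le hs1⟩
      (S.flow_deriv y hy r (hsT (Ico_subset_Icc_self hr')))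
  have hG := dist_le_of_trajectories_ODE_of_mem (v := S.velocity) (K := Λ.toNNReal)
    (s := fun _ => Metric.closedBall (0 : E3) (max 0 b + 1)) (a := 0) (b := s)
    (f := S.flow x) (g := S.flow x₀) (δ := dist x x₀)
    (fun r hr' => LipschitzOnWith.of_dist_le_mul fun y hy z hz => by
      rw [dist_eq_norm, dist_eq_norm, Real.coe_toNNReal _ hΛ]
      exact ((hV r (hsT (Ico_subset_Icc_self hr')) z hz).2 y hy).1)
    ((hcont x hx).mono hsT) (hder x hx) hmem ((hcont x₀ hx₀).mono hsT) (hder x₀ hx₀) hmem₀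
    (by rw [S.flow_zero x hx, S.flow_zero x₀ hx₀]) s (right_mem_Icc.2 hs0)
  rw [Real.coe_toNNReal _ hΛ, sub_zero] at hG
  have h1 : (1 : ℝ) ≤ dist (S.flow x s) (S.flow x₀ s) := hs
  have h2 : dist x x₀ * Real.exp (Λ * s) < Real.exp (-(Λ * T)) * Real.exp (Λ * T) := by
    refine mul_lt_mul_of_lt_of_le_of_nonneg_of_pos (Metric.mem_ball.1 hxr)
      (Real.exp_le_exp.2 (mul_le_mul_of_nonneg_left hs1 hΛ)) dist_nonneg (Real.exp_pos _)
  rw [← Real.exp_add, neg_add_cancel, Real.exp_zero] at h2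
  linarith

/-! ### The geometry of a closed surface -/

namespace Surface

variable (Γ : Surface)

lemma norm_normal {x : E3} (hx : x ∈ Γ.carrier) : ‖Γ.normal x‖ = 1 := by
  obtain ⟨O, g, -, hxO, -, -, h⟩ := Γ.local_eq x hx
  obtain ⟨h1, h2⟩ := h x ⟨hx, hxO⟩
  rw [h2, norm_smul, norm_inv, norm_norm, inv_mul_cancel₀ (norm_ne_zero_iff.2 h1)]

/-- The bounds of `exists_bounds` near a point, from a local equation `g = 0` of the surface. -/
lemma exists_local_bounds {x : E3} (hx : x ∈ Γ.carrier) :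
    ∃ r L : ℝ, 0 < r ∧ 0 ≤ L ∧ ∀ a ∈ Γ.carrier ∩ Metric.ball x r,
      ∀ b ∈ Γ.carrier ∩ Metric.ball x r, ‖Γ.normal a - Γ.normal b‖ ≤ L * ‖a - b‖ ∧
        |inner ℝ (a - b) (Γ.normal b)| ≤ L * ‖a - b‖ ^ 2 := by
  obtain ⟨O, g, hO, hxO, hg, hΓ, hν⟩ := Γ.local_eq x hx
  have hgx : ∀ y ∈ O, ContDiffAt ℝ 2 g y := fun y hy => hg.contDiffAt (hO.mem_nhds hy)
  have hg1 : ContDiffAt ℝ 1 (fderiv ℝ g) x := (hgx x hxO).fderiv_right (by norm_num)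
  have hg2 : ContDiffAt ℝ 1 (gradient g) x :=
    (InnerProductSpace.toDual ℝ E3).symm.contDiff.contDiffAt.comp x hg1
  have hx0 : gradient g x ≠ 0 := (hν x ⟨hx, hxO⟩).1
  have hN : ContDiffAt ℝ 1 (fun y => ‖gradient g y‖⁻¹ • gradient g y) x :=
    ((hg2.norm ℝ hx0).inv (norm_ne_zero_iff.2 hx0)).smul hg2
  obtain ⟨K1, t1, ht1, hK1⟩ := hN.exists_lipschitzOnWith
  obtain ⟨K2, t2, ht2, hK2⟩ := hg1.exists_lipschitzOnWith
  have hcont : ContinuousAt (fun y => ‖gradient g y‖⁻¹) x :=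
    (hg2.continuousAt.norm).inv₀ (norm_ne_zero_iff.2 hx0)
  have ht3 : {y | ‖gradient g y‖⁻¹ < ‖gradient g x‖⁻¹ + 1} ∈ 𝓝 x :=
    hcont.eventually_lt_const (lt_add_one _)
  obtain ⟨r, hr, hball⟩ := Metric.mem_nhds_iff.1
    (inter_mem (inter_mem ht1 ht2) (inter_mem ht3 (hO.mem_nhds hxO)))
  set c := ‖gradient g x‖⁻¹ + 1
  have hc : 0 ≤ c := add_nonneg (inv_nonneg.2 (norm_nonneg _)) zero_le_one
  refine ⟨r, max K1 (c * K2), hr, le_max_of_le_left K1.2, ?_⟩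
  rintro a ⟨ha, har⟩ b ⟨hb, hbr⟩
  have ha' := hball har
  have hb' := hball hbr
  have hνa := hν a ⟨ha, ha'.2.2⟩
  have hνb := hν b ⟨hb, hb'.2.2⟩
  constructor
  · rw [hνa.2, hνb.2, ← dist_eq_norm, ← dist_eq_norm]
    exact (hK1.dist_le_mul a ha'.1.1 b hb'.1.1).trans
      (mul_le_mul_of_nonneg_right (le_max_left _ _) dist_nonneg)
  · have hT := norm_sub_sub_fderiv_le (f := g) (B := Metric.ball x r) K2.2 (convex_ball x r)
      (fun y hy => (hgx y (hball hy).2.2).differentiableAt (by norm_num))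
      (fun y hy z hz => by
        rw [← dist_eq_norm, ← dist_eq_norm]
        exact hK2.dist_le_mul y (hball hy).1.2 z (hball hz).1.2) har hbr
    have ga : g a = 0 := by
      have : a ∈ {y ∈ O | g y = 0} := hΓ ▸ ⟨ha, ha'.2.2⟩
      exact this.2
    have gb : g b = 0 := by
      have : b ∈ {y ∈ O | g y = 0} := hΓ ▸ ⟨hb, hb'.2.2⟩
      exact this.2
    rw [ga, gb, sub_zero, zero_sub, norm_neg] at hT
    have e : inner ℝ (a - b) (Γ.normal b) = ‖gradient g b‖⁻¹ * fderiv ℝ g b (a - b) := by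
      rw [hνb.2, inner_smul_right, real_inner_comm]
      congr 1
      exact InnerProductSpace.toDual_symm_apply
    rw [e, abs_mul, abs_of_nonneg (inv_nonneg.2 (norm_nonneg _))]
    calc _ ≤ c * (K2 * ‖a - b‖ ^ 2) :=
          mul_le_mul (le_of_lt hb'.2.1) hT (norm_nonneg _) hc
      _ ≤ _ := by
          rw [← mul_assoc]
          exact mul_le_mul_of_nonneg_right (le_max_right _ _) (by positivity)

/-- On a closed surface the normal is Lipschitz, and secants are tangential to second order. The
local bounds extend to distant pairs of points by compactness. -/
lemma exists_bounds :
    ∃ L : ℝ, 0 ≤ L ∧ ∀ a ∈ Γ.carrier, ∀ b ∈ Γ.carrier, ‖Γ.normal a - Γ.normal b‖ ≤ L * ‖a - b‖ ∧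
        |inner ℝ (a - b) (Γ.normal b)| ≤ L * ‖a - b‖ ^ 2 := by
  have key : ∃ L : ℝ, 0 ≤ L ∧ ∀ q ∈ Γ.carrier ×ˢ Γ.carrier, (q.1 ∈ Γ.carrier ∧ q.2 ∈ Γ.carrier) →
      ‖Γ.normal q.1 - Γ.normal q.2‖ ≤ L * ‖q.1 - q.2‖ ∧
        |inner ℝ (q.1 - q.2) (Γ.normal q.2)| ≤ L * ‖q.1 - q.2‖ ^ 2 := by
    refine (Γ.isCompact.prod Γ.isCompact).induction_on (p := fun A => ∃ L : ℝ, 0 ≤ L ∧ ∀ q ∈ A,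
      (q.1 ∈ Γ.carrier ∧ q.2 ∈ Γ.carrier) → ‖Γ.normal q.1 - Γ.normal q.2‖ ≤ L * ‖q.1 - q.2‖ ∧
        |inner ℝ (q.1 - q.2) (Γ.normal q.2)| ≤ L * ‖q.1 - q.2‖ ^ 2) ⟨0, le_rfl, by simp⟩ ?_ ?_ ?_
    · rintro A B hAB ⟨R, hR, h⟩
      exact ⟨R, hR, fun x hx => h x (hAB hx)⟩
    · rintro A B ⟨R, hR, h⟩ ⟨R', hR', h'⟩
      refine ⟨max R R', le_max_of_le_left hR, ?_⟩
      rintro q (hq | hq) hqΓ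
      · refine ⟨(h q hq hqΓ).1.trans ?_, (h q hq hqΓ).2.trans ?_⟩
        · exact mul_le_mul_of_nonneg_right (le_max_left _ _) (norm_nonneg _)
        · exact mul_le_mul_of_nonneg_right (le_max_left _ _) (by positivity)
      · refine ⟨(h' q hq hqΓ).1.trans ?_, (h' q hq hqΓ).2.trans ?_⟩
        · exact mul_le_mul_of_nonneg_right (le_max_right _ _) (norm_nonneg _)
        · exact mul_le_mul_of_nonneg_right (le_max_right _ _) (by positivity)
    rintro ⟨x, y⟩ ⟨hx, hy⟩
    simp only at hx hy
    rcases eq_or_ne x y with rfl | hxy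
    · obtain ⟨r, L, hr, hL, h⟩ := Γ.exists_local_bounds hx
      refine ⟨Metric.ball x r ×ˢ Metric.ball x r, mem_nhdsWithin_of_mem_nhds
        (prod_mem_nhds (Metric.ball_mem_nhds _ hr) (Metric.ball_mem_nhds _ hr)), L, hL, ?_⟩
      rintro ⟨a, b⟩ ⟨ha, hb⟩ ⟨ha', hb'⟩
      exact h a ⟨ha', ha⟩ b ⟨hb', hb⟩
    · have hd : 0 < ‖x - y‖ := norm_pos_iff.2 (sub_ne_zero.2 hxy)
      have hopen : {q : E3 × E3 | ‖x - y‖ / 2 < ‖q.1 - q.2‖} ∈ 𝓝 (x, y) := by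
        refine IsOpen.mem_nhds (isOpen_lt (by fun_prop) (by fun_prop)) ?_
        simp only [mem_ofPred_eq]; linarith
      refine ⟨_, mem_nhdsWithin_of_mem_nhds hopen, 4 / ‖x - y‖, by positivity, ?_⟩
      rintro ⟨a, b⟩ hq ⟨ha, hb⟩
      simp only [mem_ofPred_eq] at hq ha hb ⊢
      have hone : 2 ≤ 4 / ‖x - y‖ * ‖a - b‖ := by
        rw [div_mul_eq_mul_div, le_div_iff₀ hd]; linarith
      constructor
      · refine le_trans ?_ hone
        refine (norm_sub_le _ _).trans ?_
        rw [Γ.norm_normal ha, Γ.norm_normal hb]; norm_num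
      · have h1 := abs_real_inner_le_norm (a - b) (Γ.normal b)
        rw [Γ.norm_normal hb, mul_one] at h1
        refine h1.trans ?_
        rw [pow_two, ← mul_assoc]
        exact le_mul_of_one_le_left (norm_nonneg _) (by linarith)
  obtain ⟨L, hL, h⟩ := key
  exact ⟨L, hL, fun a ha b hb => h (a, b) ⟨ha, hb⟩ ⟨ha, hb⟩⟩

/-- The segment from a point to a nearest point of the surface is normal to the surface. -/
lemma exists_smul_normal {x y : E3} (hy : y ∈ Γ.carrier)
    (hxy : dist x y = Metric.infDist x Γ.carrier) : ∃ c : ℝ, x - y = c • Γ.normal y := by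
  obtain ⟨O, g, hO, hyO, hg, hΓ, hν⟩ := Γ.local_eq y hy
  have gy : g y = 0 := by
    have : y ∈ {y ∈ O | g y = 0} := hΓ ▸ ⟨hy, hyO⟩
    exact this.2
  have hφ : HasStrictFDerivAt (fun z : E3 => ‖z - x‖ ^ 2) (2 • (innerSL ℝ (y - x))) y := by
    have h := (hasStrictFDerivAt_norm_sq (y - x)).comp y
      ((hasStrictFDerivAt_id (𝕜 := ℝ) y).sub_const x)
    rw [ContinuousLinearMap.comp_id] at h
    exact h
  have hmin : IsLocalExtrOn (fun z : E3 => ‖z - x‖ ^ 2) {z | g z = g y} y := by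
    left
    have hOn : O ∈ 𝓝[{z | g z = g y}] y := mem_nhdsWithin_of_mem_nhds (hO.mem_nhds hyO)
    filter_upwards [hOn, self_mem_nhdsWithin] with z hz hz'
    have hzΓ : z ∈ Γ.carrier := by
      have : z ∈ Γ.carrier ∩ O := hΓ ▸ ⟨hz, hz'.trans gy⟩
      exact this.1
    have h1 : dist x y ≤ dist x z := hxy ▸ Metric.infDist_le_dist_of_mem hzΓ
    rw [dist_comm, dist_eq_norm, dist_comm, dist_eq_norm] at h1
    exact pow_le_pow_left₀ (norm_nonneg _) h1 2
  have hgs : HasStrictFDerivAt g (fderiv ℝ g y) y :=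
    (hg.contDiffAt (hO.mem_nhds hyO)).hasStrictFDerivAt (by norm_num)
  obtain ⟨a, b, hab, h⟩ := hmin.exists_multipliers_of_hasStrictFDerivAt_1d hgs hφ
  obtain ⟨h0, hn⟩ := hν y ⟨hy, hyO⟩
  have hv : a • gradient g y + (2 * b) • (y - x) = 0 := by
    refine ext_inner_right ℝ fun v => ?_
    have := DFunLike.congr_fun h v
    simp only [add_apply, smul_apply, innerSL_apply_apply,
      zero_apply, smul_eq_mul, nsmul_eq_mul, Nat.cast_ofNat] at this
    rw [inner_add_left, inner_smul_left, inner_smul_left, inner_zero_left, gradient,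
      InnerProductSpace.toDual_symm_apply]
    simp only [conj_trivial]
    linarith
  have hb : b ≠ 0 := by
    rintro rfl
    rw [mul_zero, zero_smul, add_zero, smul_eq_zero] at hv
    rcases hv with rfl | hv
    · exact hab rfl
    · exact h0 hv
  refine ⟨a / (2 * b) * ‖gradient g y‖, ?_⟩
  have hn0 : ‖gradient g y‖ ≠ 0 := norm_ne_zero_iff.2 h0
  rw [hn, smul_smul, mul_assoc, mul_inv_cancel₀ hn0, mul_one]
  have : (2 * b) • (x - y) = a • gradient g y := by
    rw [eq_comm, ← sub_eq_zero, ← hv]; module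
  rw [div_eq_inv_mul, mul_smul, ← this, smul_smul, inv_mul_cancel₀ (by positivity), one_smul]

end Surface

/-! ### Areas of Lipschitz images -/

lemma euclideanHausdorffMeasure_image_le {X Y : Type*} [MetricSpace X] [MeasurableSpace X]
    [BorelSpace X] [MetricSpace Y] [MeasurableSpace Y] [BorelSpace Y] {K : NNReal} {f : X → Y}
    {s : Set X} (h : LipschitzOnWith K f s) :
    (Measure.euclideanHausdorffMeasure 2 : Measure Y) (f '' s) ≤
      (K : ENNReal) ^ 2 * (Measure.euclideanHausdorffMeasure 2 : Measure X) s := by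
  have h1 := h.hausdorffMeasure_image_le (d := ((2 : ℕ) : ℝ)) (by positivity)
  rw [ENNReal.rpow_natCast] at h1
  rw [Measure.euclideanHausdorffMeasure_def, Measure.euclideanHausdorffMeasure_def,
    Measure.smul_apply, Measure.smul_apply, ENNReal.smul_def, ENNReal.smul_def, smul_eq_mul,
    smul_eq_mul, mul_left_comm]
  exact mul_le_mul_right h1 _

/-- The change of variables inequality for a Lipschitz map. -/
lemma lintegral_image_le {c : NNReal} {f : E3 → E3} {s : Set E3} (hs : MeasurableSet s)
    (h : LipschitzOnWith c f s) (F : E3 → ENNReal) :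
    ∫⁻ y in f '' s, F y ∂area ≤ (c : ENNReal) ^ 2 * ∫⁻ x in s, F (f x) ∂area := by
  have hf : AEMeasurable f (area.restrict s) := h.continuousOn.aemeasurable hs
  have hle : area.restrict (f '' s) ≤ ((c : ENNReal) ^ 2) • (area.restrict s).map f := by
    refine Measure.le_iff.2 fun B hB => ?_
    rw [Measure.restrict_apply hB, Measure.smul_apply, Measure.map_apply_of_aemeasurable hf hB,
      Measure.restrict_apply' hs, smul_eq_mul]
    have e : B ∩ f '' s = f '' (f ⁻¹' B ∩ s) := by
      rw [inter_comm, inter_comm (f ⁻¹' B), image_inter_preimage]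
    rw [e]
    exact euclideanHausdorffMeasure_image_le (h.mono inter_subset_right)
  refine (lintegral_mono' hle le_rfl).trans ?_
  rw [lintegral_smul_measure, smul_eq_mul]
  exact mul_le_mul_right (lintegral_map_le _ _) _

/-- The change of variables inequality for a map `p` that is inverse to a Lipschitz map `q`. -/
lemma lintegral_le_of_expanding {c : NNReal} {p q : E3 → E3} {s : Set E3} (hs : MeasurableSet s)
    (hp : ContinuousOn p s) (hq : ∀ x ∈ s, q (p x) = x)
    (h : ∀ x ∈ s, ∀ y ∈ s, ‖x - y‖ ≤ c * ‖p x - p y‖) (F : E3 → ENNReal) :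
    MeasurableSet (p '' s) ∧
      ∫⁻ x in s, F x ∂area ≤ (c : ENNReal) ^ 2 * ∫⁻ y in p '' s, F (q y) ∂area := by
  have hinj : InjOn p s := LeftInvOn.injOn hq
  have hm := hs.image_of_continuousOn_injOn hp hinj
  have e : s = q '' (p '' s) := (LeftInvOn.image_image hq).symm
  refine ⟨hm, ?_⟩
  nth_rewrite 1 [e]
  refine lintegral_image_le hm (LipschitzOnWith.of_dist_le_mul ?_) F
  rintro _ ⟨x, hx, rfl⟩ _ ⟨y, hy, rfl⟩
  rw [hq x hx, hq y hy, dist_eq_norm, dist_eq_norm]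
  exact h x hx y hy

/-- A closed surface has finite area: locally it is a graph over its tangent plane, and the
orthogonal projection to that plane has a Lipschitz inverse. -/
lemma Surface.area_lt_top (Γ : Surface) : area Γ.carrier < ⊤ := by
  obtain ⟨L, hL, hΓ⟩ := Γ.exists_bounds
  refine Γ.isCompact.measure_lt_top_of_nhdsWithin fun x hx => ?_
  set r : ℝ := 1 / (6 * (L + 1)) with hr
  have hr0 : 0 < r := by positivity
  refine ⟨Γ.carrier ∩ Metric.ball x r, inter_mem_nhdsWithin _ (Metric.ball_mem_nhds _ hr0), ?_⟩
  set n := Γ.normal x with hn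
  have hn1 : ‖n‖ = 1 := Γ.norm_normal hx
  set K : Submodule ℝ E3 := (ℝ ∙ n)ᗮ with hK
  have hfin : Module.finrank ℝ K = 2 := by
    have hn0 : n ≠ 0 := by intro h; rw [h, norm_zero] at hn1; exact zero_ne_one hn1
    have : Fact (Module.finrank ℝ E3 = 2 + 1) := ⟨by simp⟩
    exact Submodule.finrank_orthogonal_span_singleton hn0
  let P : E3 → K := fun a => K.orthogonalProjectionOnto a
  have hdist : ∀ a ∈ Γ.carrier ∩ Metric.ball x r, ∀ b ∈ Γ.carrier ∩ Metric.ball x r,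
      dist a b ≤ 2 * dist (P a) (P b) := by
    rintro a ⟨ha, har⟩ b ⟨hb, hbr⟩
    rw [Metric.mem_ball, dist_eq_norm] at har hbr
    have h1 := (hΓ a ha b hb).2
    have h2 := (hΓ b hb x hx).1
    have h3 : ‖a - b‖ ≤ 2 * r := by
      have := norm_sub_le (a - x) (b - x)
      rw [sub_sub_sub_cancel_right] at this
      linarith
    have h4 : |inner ℝ (a - b) n| ≤ 1 / 2 * ‖a - b‖ := by
      have e : inner ℝ (a - b) n =
          inner ℝ (a - b) (Γ.normal b) - inner ℝ (a - b) (Γ.normal b - n) := by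
        rw [inner_sub_right]; ring
      rw [e]
      have h5 := abs_real_inner_le_norm (a - b) (Γ.normal b - n)
      have h6 : L * ‖a - b‖ ^ 2 ≤ (L * (2 * r)) * ‖a - b‖ := by
        rw [pow_two, ← mul_assoc]
        gcongr
      have h7 : ‖a - b‖ * ‖Γ.normal b - n‖ ≤ (L * r) * ‖a - b‖ := by
        rw [mul_comm]
        gcongr
        exact h2.trans (by gcongr)
      have h8 : 3 * (L * r) ≤ 1 / 2 := by
        rw [hr, mul_one_div, ← mul_div_assoc, div_le_iff₀ (by positivity)]
        linarith
      have h9 := abs_sub (inner ℝ (a - b) (Γ.normal b)) (inner ℝ (a - b) (Γ.normal b - n))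
      nlinarith [norm_nonneg (a - b)]
    have h5 := Submodule.norm_sq_eq_add_norm_sq_projection (a - b) (ℝ ∙ n)
    have h6 : ‖(ℝ ∙ n).orthogonalProjectionOnto (a - b)‖ = |inner ℝ (a - b) n| := by
      rw [← Submodule.norm_coe, Submodule.coe_orthogonalProjectionOnto_apply,
        Submodule.starProjection_unit_singleton ℝ hn1, norm_smul, hn1, mul_one, real_inner_comm,
        Real.norm_eq_abs]
    have h7 : dist (P a) (P b) = ‖K.orthogonalProjectionOnto (a - b)‖ := by
      rw [map_sub, dist_eq_norm]
    rw [h6] at h5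
    change _ = _ + ‖K.orthogonalProjectionOnto (a - b)‖ ^ 2 at h5
    rw [← h7] at h5
    rw [dist_eq_norm]
    have h8 : (0 : ℝ) ≤ dist (P a) (P b) := dist_nonneg
    nlinarith [pow_le_pow_left₀ (abs_nonneg _) h4 2, norm_nonneg (a - b)]
  set A := Γ.carrier ∩ Metric.ball x r
  have hinj : InjOn P A := by
    intro a ha b hb hab
    have := hdist a ha b hb
    rw [hab, dist_self, mul_zero] at this
    exact dist_le_zero.1 this
  have hA : A = Function.invFunOn P A '' (P '' A) := by
    rw [image_image]
    ext a
    refine ⟨fun ha => ⟨a, ha, hinj.leftInvOn_invFunOn ha⟩, ?_⟩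
    rintro ⟨b, hb, rfl⟩
    change Function.invFunOn P A (P b) ∈ A
    rwa [hinj.leftInvOn_invFunOn hb]
  have hLip : LipschitzOnWith 2 (Function.invFunOn P A) (P '' A) := by
    refine LipschitzOnWith.of_dist_le_mul ?_
    rintro _ ⟨a, ha, rfl⟩ _ ⟨b, hb, rfl⟩
    rw [hinj.leftInvOn_invFunOn ha, hinj.leftInvOn_invFunOn hb]
    exact hdist a ha b hb
  have hle := euclideanHausdorffMeasure_image_le hLip
  rw [← hA] at hle
  refine hle.trans_lt (ENNReal.mul_lt_top (by simp) ?_)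
  have hHaar : (Measure.euclideanHausdorffMeasure (Module.finrank ℝ K) : Measure K).IsAddHaarMeasure :=
    inferInstance
  rw [hfin] at hHaar
  refine Bornology.IsBounded.measure_lt_top ?_
  have hb : Bornology.IsBounded A := Metric.isBounded_ball.subset inter_subset_right
  exact (K.orthogonalProjectionOnto.lipschitz).isBounded_image hb

/-! ### Cross products and tangential traces -/

/-- The cross product on `ℝ³`. -/
def cross (a b : E3) : E3 :=
  !₂[a 1 * b 2 - a 2 * b 1, a 2 * b 0 - a 0 * b 2, a 0 * b 1 - a 1 * b 0]

lemma inner_eq_sum (a b : E3) : inner ℝ a b = a 0 * b 0 + a 1 * b 1 + a 2 * b 2 := by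
  rw [PiLp.inner_apply, Fin.sum_univ_three]
  simp only [RCLike.inner_apply, conj_trivial]
  ring

lemma inner_cross (a b c : E3) : inner ℝ (cross a b) c =
    (a 1 * b 2 - a 2 * b 1) * c 0 + (a 2 * b 0 - a 0 * b 2) * c 1
      + (a 0 * b 1 - a 1 * b 0) * c 2 := inner_eq_sum _ _

lemma norm_sq_eq_sum (a : E3) : ‖a‖ ^ 2 = a 0 * a 0 + a 1 * a 1 + a 2 * a 2 := by
  rw [← real_inner_self_eq_norm_sq, inner_eq_sum]

lemma norm_cross_sq (a b : E3) : ‖cross a b‖ ^ 2 = gramDet a b := by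
  rw [gramDet, norm_sq_eq_sum, norm_sq_eq_sum, norm_sq_eq_sum, inner_eq_sum]
  simp only [cross, Matrix.cons_val_zero, Matrix.cons_val_one, Matrix.cons_val]
  ring

lemma norm_cross_le (a b : E3) : ‖cross a b‖ ≤ ‖a‖ * ‖b‖ := by
  refine le_of_sq_le_sq ?_ (by positivity)
  rw [norm_cross_sq]; exact gramDet_le a b

lemma abs_inner_cross_le (a b c : E3) : |inner ℝ (cross a b) c| ≤ ‖a‖ * ‖b‖ * ‖c‖ :=
  (abs_real_inner_le_norm _ _).trans
    (mul_le_mul_of_nonneg_right (norm_cross_le a b) (norm_nonneg c))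

/-- Three vectors that are almost orthogonal to a unit vector are almost linearly dependent. -/
lemma abs_inner_cross_le_of_normal {a b c n : E3} {h κ : ℝ} (hh : 0 ≤ h) (hκ : 0 ≤ κ)
    (hn : ‖n‖ = 1) (ha : ‖a‖ ≤ h) (hb : ‖b‖ ≤ h) (hc : ‖c‖ ≤ h) (ha' : |inner ℝ a n| ≤ κ)
    (hb' : |inner ℝ b n| ≤ κ) (hc' : |inner ℝ c n| ≤ κ) :
    |inner ℝ (cross a b) c| ≤ 3 * (κ * h ^ 2) := by
  have e : inner ℝ (cross a b) c = inner ℝ a n * inner ℝ (cross b c) n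
      + inner ℝ b n * inner ℝ (cross c a) n + inner ℝ c n * inner ℝ (cross a b) n := by
    have h1 : n 0 * n 0 + n 1 * n 1 + n 2 * n 2 = 1 := by rw [← norm_sq_eq_sum, hn]; norm_num
    simp only [inner_cross]
    simp only [inner_eq_sum]
    linear_combination (-((a 1 * b 2 - a 2 * b 1) * c 0 + (a 2 * b 0 - a 0 * b 2) * c 1
      + (a 0 * b 1 - a 1 * b 0) * c 2)) * h1
  have hp : ∀ u v w : E3, |inner ℝ w n| ≤ κ → ‖u‖ ≤ h → ‖v‖ ≤ h →
      |inner ℝ w n * inner ℝ (cross u v) n| ≤ κ * h ^ 2 := by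
    intro u v w hw hu hv
    rw [abs_mul]
    refine mul_le_mul hw ?_ (abs_nonneg _) hκ
    refine (abs_inner_cross_le u v n).trans ?_
    rw [hn, mul_one, pow_two]
    exact mul_le_mul hu hv (norm_nonneg _) hh
  rw [e]
  refine (abs_add_three _ _ _).trans ?_
  linarith [hp b c a ha' hb hc, hp c a b hb' hc ha, hp a b c hc' ha hb]

/-- The matrix entries of a linear map. -/
def entry (B : E3 →L[ℝ] E3) (a b : Fin 3) : ℝ := B (EuclideanSpace.single b 1) a

lemma abs_coord_le (v : E3) (a : Fin 3) : |v a| ≤ ‖v‖ := by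
  rw [← Real.norm_eq_abs]; exact PiLp.norm_apply_le v a

lemma abs_entry_le (B : E3 →L[ℝ] E3) (a b : Fin 3) : |entry B a b| ≤ ‖B‖ := by
  refine (abs_coord_le _ a).trans ((B.le_opNorm _).trans ?_)
  simp

lemma apply_eq_sum (B : E3 →L[ℝ] E3) (v : E3) (a : Fin 3) :
    B v a = entry B a 0 * v 0 + entry B a 1 * v 1 + entry B a 2 * v 2 := by
  have e : v = v 0 • EuclideanSpace.single 0 (1 : ℝ) + v 1 • EuclideanSpace.single 1 (1 : ℝ)
      + v 2 • EuclideanSpace.single 2 (1 : ℝ) := by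
    ext i; fin_cases i <;> simp
  conv_lhs => rw [e]
  simp only [map_add, map_smul, PiLp.add_apply, PiLp.smul_apply, smul_eq_mul, entry]
  ring

/-- The derivative of a determinant of vectors that are moved by a linear map. -/
lemma inner_cross_linear (B : E3 →L[ℝ] E3) (a b c : E3) :
    inner ℝ (cross (B a) b) c + inner ℝ (cross a (B b)) c + inner ℝ (cross a b) (B c) =
      (entry B 0 0 + entry B 1 1 + entry B 2 2) * inner ℝ (cross a b) c := by
  simp only [inner_cross, apply_eq_sum]
  ring

/-- The orthogonal projection onto the plane of `e` and `f`, as a matrix, in terms of the dual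
basis and of the normal. -/
lemma dualVec_mul_add {e f : E3} (h : gramDet e f ≠ 0) (a b : Fin 3) :
    dualVec e f a * e b + dualVec f e a * f b =
      (if a = b then 1 else 0) - cross e f a * cross e f b / gramDet e f := by
  have e1 : ∀ a, dualVec e f a = (gramDet e f)⁻¹ * (‖f‖ ^ 2 * e a - inner ℝ e f * f a) :=
    fun a => rfl
  have e2 : ∀ a, dualVec f e a = (gramDet e f)⁻¹ * (‖e‖ ^ 2 * f a - inner ℝ e f * e a) := by
    intro a; rw [gramDet_comm, real_inner_comm]; rfl
  rw [e1, e2, eq_sub_iff_add_eq, ← mul_right_inj' h]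
  have hg : gramDet e f = (e 0 * e 0 + e 1 * e 1 + e 2 * e 2) * (f 0 * f 0 + f 1 * f 1 + f 2 * f 2)
      - (e 0 * f 0 + e 1 * f 1 + e 2 * f 2) ^ 2 := by
    rw [gramDet, norm_sq_eq_sum, norm_sq_eq_sum, inner_eq_sum]
  have e3 : gramDet e f * ((gramDet e f)⁻¹ * (‖f‖ ^ 2 * e a - inner ℝ e f * f a) * e b
      + (gramDet e f)⁻¹ * (‖e‖ ^ 2 * f a - inner ℝ e f * e a) * f b
      + cross e f a * cross e f b / gramDet e f) =
      (‖f‖ ^ 2 * e a - inner ℝ e f * f a) * e b + (‖e‖ ^ 2 * f a - inner ℝ e f * e a) * f b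
      + cross e f a * cross e f b := by field_simp
  rw [e3, hg, norm_sq_eq_sum, norm_sq_eq_sum, inner_eq_sum]
  fin_cases a <;> fin_cases b <;> simp [cross] <;> ring

/-- The tangential trace of a linear map. -/
lemma inner_dualVec_apply {e f : E3} (h : gramDet e f ≠ 0) (B : E3 →L[ℝ] E3) :
    inner ℝ (dualVec e f) (B e) + inner ℝ (dualVec f e) (B f) =
      ∑ a, ∑ b, entry B a b *
        ((if a = b then 1 else 0) - cross e f a * cross e f b / gramDet e f) := by
  simp only [← dualVec_mul_add h, Fin.sum_univ_three, inner_eq_sum, apply_eq_sum]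
  ring

/-- The orthogonal projection of `v` onto the plane of `e` and `f`. -/
lemma sub_inner_cross {e f : E3} (h : gramDet e f ≠ 0) (v : E3) :
    v - (inner ℝ (cross e f) v / gramDet e f) • cross e f =
      inner ℝ e v • dualVec e f + inner ℝ f v • dualVec f e := by
  ext a
  simp only [PiLp.sub_apply, PiLp.smul_apply, PiLp.add_apply, smul_eq_mul, inner_eq_sum]
  have h0 := dualVec_mul_add h a 0
  have h1 := dualVec_mul_add h a 1
  have h2 := dualVec_mul_add h a 2
  have ev : v a = (if a = 0 then 1 else 0) * v 0 + (if a = 1 then 1 else 0) * v 1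
      + (if a = 2 then 1 else 0) * v 2 := by fin_cases a <;> simp
  rw [ev]
  linear_combination -v 0 * h0 - v 1 * h1 - v 2 * h2

/-- Projections onto two planes are close if the normal of the first one is almost orthogonal to
the second one. -/
lemma abs_normal_mul_sub_le {e f e' f' : E3} {η : ℝ} (h : 0 < gramDet e f) (h' : 0 < gramDet e' f')
    (hη : |inner ℝ (cross e f) e'| * ‖dualVec e' f'‖ + |inner ℝ (cross e f) f'| * ‖dualVec f' e'‖
      ≤ η * Real.sqrt (gramDet e f)) (a b : Fin 3) :
    |cross e f a * cross e f b / gramDet e f - cross e' f' a * cross e' f' b / gramDet e' f'| ≤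
      4 * η := by
  have hs := Real.sqrt_pos.2 h
  have hs' := Real.sqrt_pos.2 h'
  have hss := Real.mul_self_sqrt h.le
  have hss' := Real.mul_self_sqrt h'.le
  set s := Real.sqrt (gramDet e f)
  set s' := Real.sqrt (gramDet e' f')
  -- the unit normals `m`, `n` of the planes, and the tangential part `r` of `m`
  set m : E3 := s⁻¹ • cross e f with hm
  set n : E3 := s'⁻¹ • cross e' f' with hn
  have hm1 : ‖m‖ = 1 := by
    rw [← sq_eq_sq₀ (norm_nonneg _) zero_le_one, hm, norm_smul, mul_pow, norm_cross_sq, ← hss,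
      norm_inv, Real.norm_of_nonneg hs.le]
    field_simp
  have hn1 : ‖n‖ = 1 := by
    rw [← sq_eq_sq₀ (norm_nonneg _) zero_le_one, hn, norm_smul, mul_pow, norm_cross_sq, ← hss',
      norm_inv, Real.norm_of_nonneg hs'.le]
    field_simp
  set c : ℝ := inner ℝ n m with hc
  set r : E3 := m - c • n with hr
  have hr1 : ‖r‖ ≤ η := by
    have e1 : r = inner ℝ e' m • dualVec e' f' + inner ℝ f' m • dualVec f' e' := by
      rw [← sub_inner_cross h'.ne', hr, hc, hn, inner_smul_left, smul_smul, ← hss']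
      simp only [conj_trivial]
      congr 2
      field_simp
    have e2 : ∀ v, inner ℝ v m = s⁻¹ * inner ℝ (cross e f) v := fun v => by
      rw [hm, inner_smul_right, real_inner_comm]
    rw [e1, e2, e2]
    refine (norm_add_le _ _).trans ?_
    rw [norm_smul, norm_smul, norm_mul, norm_mul, norm_inv, Real.norm_of_nonneg hs.le, mul_assoc,
      mul_assoc, ← mul_add, inv_mul_le_iff₀ hs, mul_comm s]
    exact hη
  have hc1 : |c| ≤ 1 := by
    have := abs_real_inner_le_norm n m
    rwa [hm1, hn1, mul_one] at this
  have hr2 : ‖r‖ ^ 2 = 1 - c ^ 2 := by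
    rw [hr, norm_sub_sq_real, hm1, norm_smul c, hn1, inner_smul_right, real_inner_comm, ← hc, mul_one,
      Real.norm_eq_abs, sq_abs]
    ring
  have hr3 : ‖r‖ ≤ 1 := by nlinarith [norm_nonneg r, sq_nonneg c]
  have em : cross e f a * cross e f b / gramDet e f = m a * m b := by
    rw [hm, ← hss]
    simp only [PiLp.smul_apply, smul_eq_mul]
    field_simp
  have en : cross e' f' a * cross e' f' b / gramDet e' f' = n a * n b := by
    rw [hn, ← hss']
    simp only [PiLp.smul_apply, smul_eq_mul]
    field_simp
  have e3 : ∀ i, m i = c * n i + r i := fun i => by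
    rw [hr]; simp only [PiLp.sub_apply, PiLp.smul_apply, smul_eq_mul]; ring
  rw [em, en]
  have e4 : m a * m b - n a * n b =
      -‖r‖ ^ 2 * (n a * n b) + c * (n a * r b) + c * (r a * n b) + r a * r b := by
    rw [e3 a, e3 b, hr2]; ring
  have hna : |n a| ≤ 1 := hn1 ▸ abs_coord_le n a
  have hnb : |n b| ≤ 1 := hn1 ▸ abs_coord_le n b
  have hra := abs_coord_le r a
  have hrb := abs_coord_le r b
  have hr0 := norm_nonneg r
  have t1 : |-‖r‖ ^ 2 * (n a * n b)| ≤ ‖r‖ := by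
    rw [abs_mul, abs_neg, abs_of_nonneg (by positivity), abs_mul, pow_two, mul_assoc]
    refine mul_le_of_le_one_right hr0 (mul_le_one₀ hr3 (by positivity) ?_)
    exact mul_le_one₀ hna (abs_nonneg _) hnb
  have t2 : |c * (n a * r b)| ≤ ‖r‖ := by
    rw [abs_mul, abs_mul, ← mul_assoc]
    exact (mul_le_of_le_one_left (abs_nonneg _) (mul_le_one₀ hc1 (abs_nonneg _) hna)).trans hrb
  have t3 : |c * (r a * n b)| ≤ ‖r‖ := by
    rw [abs_mul, abs_mul, mul_comm |r a|, ← mul_assoc]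
    exact (mul_le_of_le_one_left (abs_nonneg _) (mul_le_one₀ hc1 (abs_nonneg _) hnb)).trans hra
  have t4 : |r a * r b| ≤ ‖r‖ := by
    rw [abs_mul]
    exact (mul_le_of_le_one_left (abs_nonneg _) (hra.trans hr3)).trans hrb
  rw [e4]
  have := abs_add_le (-‖r‖ ^ 2 * (n a * n b) + c * (n a * r b) + c * (r a * n b)) (r a * r b)
  have := abs_add_three (-‖r‖ ^ 2 * (n a * n b)) (c * (n a * r b)) (c * (r a * n b))
  linarith

lemma HasDerivWithinAt.cross_inner {e f g : ℝ → E3} {e' f' g' : E3} {s : Set ℝ} {t : ℝ}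
    (he : HasDerivWithinAt e e' s t) (hf : HasDerivWithinAt f f' s t)
    (hg : HasDerivWithinAt g g' s t) :
    HasDerivWithinAt (fun t => inner ℝ (cross (e t) (f t)) (g t)) (inner ℝ (cross e' (f t)) (g t)
      + inner ℝ (cross (e t) f') (g t) + inner ℝ (cross (e t) (f t)) g') s t := by
  simp only [inner_cross]
  have hc : ∀ {u : ℝ → E3} {u' : E3}, HasDerivWithinAt u u' s t → ∀ i,
      HasDerivWithinAt (fun t => u t i) (u' i) s t := fun {u u'} hu i =>
    ((EuclideanSpace.proj (𝕜 := ℝ) i).hasFDerivAt.comp_hasDerivWithinAt t hu)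
  refine ((((((hc he 1).mul (hc hf 2)).sub ((hc he 2).mul (hc hf 1))).mul (hc hg 0)).add
    ((((hc he 2).mul (hc hf 0)).sub ((hc he 0).mul (hc hf 2))).mul (hc hg 1))).add
    ((((hc he 0).mul (hc hf 1)).sub ((hc he 1).mul (hc hf 0))).mul (hc hg 2))).congr_deriv ?_
  simp only [Pi.mul_apply, Pi.sub_apply]
  ring

namespace Mesh

variable {T : ℝ} {S : EvolvingSurface T} {M : Mesh S}

/-! ### Shape bounds of good triangulations -/

lemma node_mem_closedBall {R : ℝ} (hR : ∀ x ∈ S.initial.carrier, ∀ t ∈ Icc 0 T, ‖S.flow x t‖ ≤ R)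
    {t : ℝ} (ht : t ∈ Icc 0 T) (i : Fin M.numNodes) :
    M.node t i ∈ Metric.closedBall (0 : E3) R :=
  mem_closedBall_zero_iff.2 (hR _ (M.node₀_mem i) t ht)

lemma diam_cell_le_size {t : ℝ} (ht : t ∈ Icc 0 T) {K : Finset (Fin M.numNodes)}
    (hK : K ∈ M.triangles) : Metric.diam (M.cell t K) ≤ M.size := by
  obtain ⟨R, hR0, hR⟩ := S.exists_norm_flow_le
  refine le_csSup ⟨R + R, ?_⟩ ⟨t, ht, K, hK, rfl⟩
  rintro _ ⟨s, hs, L, -, rfl⟩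
  refine (Metric.diam_mono (convexHull_min ?_ (convex_closedBall 0 R))
    Metric.isBounded_closedBall).trans ((Metric.diam_closedBall hR0).trans_eq (two_mul R))
  rintro _ ⟨i, -, rfl⟩
  exact node_mem_closedBall hR hs i

lemma norm_sub_le_size {t : ℝ} (ht : t ∈ Icc 0 T) {K : Finset (Fin M.numNodes)}
    (hK : K ∈ M.triangles) {x y : E3} (hx : x ∈ M.cell t K) (hy : y ∈ M.cell t K) :
    ‖x - y‖ ≤ M.size := by
  rw [← dist_eq_norm]
  exact (Metric.dist_le_diam_of_mem (isCompact_cell t K).isBounded hx hy).trans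
    (diam_cell_le_size ht hK)

lemma norm_edge_le_size {t : ℝ} (ht : t ∈ Icc 0 T) {K : Finset (Fin M.numNodes)}
    (hK : K ∈ M.triangles) {i j : Fin M.numNodes} (hi : i ∈ K) (hj : j ∈ K) :
    ‖M.edge t i j‖ ≤ M.size :=
  norm_sub_le_size ht hK (node_mem_cell t hj) (node_mem_cell t hi)

lemma Assumptions.size_pos (hT : 0 < T) {ρ : ℝ} (hM : M.Assumptions ρ) : 0 < M.size := by
  have h0 : (0 : ℝ) ∈ Icc 0 T := left_mem_Icc.2 hT.le
  obtain ⟨x, hx⟩ := S.initial.isConnected.nonempty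
  obtain ⟨y, hy, -⟩ := (hM.exact 0 h0).surjOn ⟨x, hx, rfl⟩
  unfold surface at hy
  simp only [mem_iUnion, exists_prop] at hy
  obtain ⟨K, hK, -⟩ := hy
  obtain ⟨i, j, k, hij, hik, hjk, rfl⟩ := exists_triple' hK
  refine lt_of_lt_of_le ?_ (norm_edge_le_size h0 hK (i := i) (j := j) (by simp) (by simp))
  have h := gramDet_edge_pos h0 hij hik hjk hK
  refine norm_pos_iff.2 fun he => ?_
  rw [he] at h
  simp [gramDet] at h

/-- The plane of a triangle contains the gradients of its basis functions; a ball in the triangle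
of diameter `d` therefore bounds them by `1 / d`. -/
lemma inDiameter_mul_norm_dualVec_le {t : ℝ} (ht : t ∈ Icc 0 T) {i j k : Fin M.numNodes}
    (hij : i ≠ j) (hik : i ≠ k) (hjk : j ≠ k) (hK : {i, j, k} ∈ M.triangles) :
    inDiameter (M.cell t {i, j, k}) * ‖dualVec (M.edge t i j) (M.edge t i k)‖ ≤ 1 := by
  have hD := gramDet_edge_pos ht hij hik hjk hK
  set d := dualVec (M.edge t i j) (M.edge t i k) with hd
  have hd0 : 0 < ‖d‖ := by
    have := one_le_norm_dualVec_mul hD.ne'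
    by_contra! h
    rw [← hd, le_antisymm h (norm_nonneg _), zero_mul] at this
    linarith
  rw [← le_div_iff₀ hd0]
  refine Real.sSup_le ?_ (by positivity)
  rintro _ ⟨c, hc, r, hr, rfl, hsub⟩
  have hdir : d ∈ (affineSpan ℝ (M.cell t {i, j, k})).direction := by
    rw [direction_affineSpan]
    have hv : ∀ l ∈ ({i, j, k} : Finset (Fin M.numNodes)),
        M.edge t i l ∈ vectorSpan ℝ (M.cell t {i, j, k}) := fun l hl =>
      vsub_mem_vectorSpan ℝ (node_mem_cell t hl) (node_mem_cell t (by simp))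
    exact Submodule.smul_mem _ _ (Submodule.sub_mem _
      (Submodule.smul_mem _ _ (hv j (by simp))) (Submodule.smul_mem _ _ (hv k (by simp))))
  have hmem : ∀ q : ℝ, |q| = r → c + (q / ‖d‖) • d ∈ M.cell t {i, j, k} := by
    intro q hq
    refine hsub ⟨?_, ?_⟩
    · rw [Metric.mem_closedBall, dist_eq_norm, add_sub_cancel_left, norm_smul, norm_div, norm_norm,
        div_mul_cancel₀ _ hd0.ne', Real.norm_eq_abs, hq]
    · rw [add_comm]
      exact AffineSubspace.vadd_mem_of_mem_direction (Submodule.smul_mem _ _ hdir) hc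
  have h1 := basis_eq_inner ht hij hik hjk hK (hmem r (abs_of_nonneg hr))
  have h2 := basis_eq_inner ht hij hik hjk hK (hmem (-r) (by rw [abs_neg, abs_of_nonneg hr]))
  have hw1 := (basis_spec (cell_subset_surface hK (hmem r (abs_of_nonneg hr)))).1
  have hw2 := (basis_spec (cell_subset_surface hK
    (hmem (-r) (by rw [abs_neg, abs_of_nonneg hr])))).1
  have hle : M.basis t (c + (r / ‖d‖) • d) j ≤ 1 := by
    rw [← hw1.2.1]
    exact Finset.single_le_sum (fun i _ => hw1.1 i) (Finset.mem_univ j)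
  have hge := hw2.1 j
  rw [← hd] at h1 h2
  rw [h1] at hle
  rw [h2] at hge
  have e : inner ℝ d (c + (r / ‖d‖) • d - M.node t i)
      - inner ℝ d (c + (-r / ‖d‖) • d - M.node t i) = 2 * r * ‖d‖ := by
    rw [← inner_sub_right, show c + (r / ‖d‖) • d - M.node t i - (c + (-r / ‖d‖) • d - M.node t i)
      = (2 * (r / ‖d‖)) • d by module, inner_smul_right, real_inner_self_eq_norm_sq]
    field_simp
  rw [le_div_iff₀ hd0]
  linarith

lemma Assumptions.norm_dualVec_le (hT : 0 < T) {ρ : ℝ} (hρ : 0 < ρ) (hM : M.Assumptions ρ) {t : ℝ}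
    (ht : t ∈ Icc 0 T) {i j k : Fin M.numNodes} (hij : i ≠ j) (hik : i ≠ k) (hjk : j ≠ k)
    (hK : {i, j, k} ∈ M.triangles) :
    ‖dualVec (M.edge t i j) (M.edge t i k)‖ ≤ 1 / (ρ * M.size) := by
  rw [le_div_iff₀ (mul_pos hρ (hM.size_pos hT)), mul_comm]
  exact (mul_le_mul_of_nonneg_right (hM.quasiUniform t ht _ hK) (norm_nonneg _)).trans
    (inDiameter_mul_norm_dualVec_le ht hij hik hjk hK)

/-- Adjacent triangles have normals within `O(h)` of each other, uniformly in time: the determinant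
of two edges of one of them and an edge of the other one is `O(h⁴)` initially, because the nodes
lie on a surface with bounded curvature, and this is preserved by the flow. -/
lemma abs_inner_cross_edge_le {h κ Λ : ℝ} (hh : 0 ≤ h) (hκ : 0 ≤ κ) (hΛ : 0 ≤ Λ)
    {i j k l : Fin M.numNodes}
    (hj : ∀ t ∈ Icc 0 T, ‖M.edge t i j‖ ≤ h) (hk : ∀ t ∈ Icc 0 T, ‖M.edge t i k‖ ≤ h)
    (hl : ∀ t ∈ Icc 0 T, ‖M.edge t i l‖ ≤ h)
    (hκ' : ∀ m, ‖M.edge 0 i m‖ ≤ h →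
      |inner ℝ (M.edge 0 i m) (S.initial.normal (M.node₀ i))| ≤ κ * h ^ 2)
    (hB : ∀ t ∈ Icc 0 T, ‖fderiv ℝ (S.velocity t) (M.node t i)‖ ≤ Λ)
    (hV : ∀ t ∈ Icc 0 T, ∀ m, ‖S.velocity t (M.node t m) - S.velocity t (M.node t i)
      - fderiv ℝ (S.velocity t) (M.node t i) (M.edge t i m)‖ ≤ Λ * ‖M.edge t i m‖ ^ 2) :
    ∀ t ∈ Icc 0 T, |inner ℝ (cross (M.edge t i j) (M.edge t i k)) (M.edge t i l)| ≤
      3 * (κ + Λ * T) * Real.exp ((3 * Λ + 1) * T) * h ^ 4 := by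
  intro t ht
  have h0 : (0 : ℝ) ∈ Icc 0 T := left_mem_Icc.2 (ht.1.trans ht.2)
  have hder := fun s hs => HasDerivWithinAt.cross_inner (hasDerivWithinAt_edge (M := M) hs i j)
    (hasDerivWithinAt_edge hs i k) (hasDerivWithinAt_edge (t := s) hs i l)
  have key := norm_le_of_norm_deriv_le (K := 3 * Λ) (δ := 3 * (κ * h ^ 2 * h ^ 2))
    (η := 3 * Λ * h ^ 4) (by positivity) (by positivity) (by positivity) hder ?_ ?_ t ht
  · rw [← Real.norm_eq_abs]
    refine key.trans_eq ?_
    ring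
  · rw [Real.norm_eq_abs]
    exact abs_inner_cross_le_of_normal hh (by positivity)
      (S.initial.norm_normal (M.node₀_mem i)) (hj 0 h0) (hk 0 h0) (hl 0 h0)
      (hκ' j (hj 0 h0)) (hκ' k (hk 0 h0)) (hκ' l (hl 0 h0))
  · intro s hs
    set B := fderiv ℝ (S.velocity s) (M.node s i) with hBdef
    have hres : ∀ m, ∃ r, S.velocity s (M.node s m) - S.velocity s (M.node s i)
        = B (M.edge s i m) + r ∧ ‖r‖ ≤ Λ * ‖M.edge s i m‖ ^ 2 := fun m =>
      ⟨_, (add_sub_cancel _ _).symm, hV s hs m⟩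
    obtain ⟨rj, ej, hrj⟩ := hres j
    obtain ⟨rk, ek, hrk⟩ := hres k
    obtain ⟨rl, el, hrl⟩ := hres l
    have e : inner ℝ (cross (B (M.edge s i j) + rj) (M.edge s i k)) (M.edge s i l)
        + inner ℝ (cross (M.edge s i j) (B (M.edge s i k) + rk)) (M.edge s i l)
        + inner ℝ (cross (M.edge s i j) (M.edge s i k)) (B (M.edge s i l) + rl) =
        (entry B 0 0 + entry B 1 1 + entry B 2 2)
          * inner ℝ (cross (M.edge s i j) (M.edge s i k)) (M.edge s i l)
        + (inner ℝ (cross rj (M.edge s i k)) (M.edge s i l)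
          + inner ℝ (cross (M.edge s i j) rk) (M.edge s i l)
          + inner ℝ (cross (M.edge s i j) (M.edge s i k)) rl) := by
      rw [← inner_cross_linear]
      simp only [inner_cross, PiLp.add_apply]
      ring
    have hrest : ∀ a b c : E3, ‖a‖ * ‖b‖ * ‖c‖ ≤ Λ * h ^ 4 →
        |inner ℝ (cross a b) c| ≤ Λ * h ^ 4 := fun a b c hc => (abs_inner_cross_le a b c).trans hc
    have hsq : ∀ m, ‖M.edge s i m‖ ≤ h → Λ * ‖M.edge s i m‖ ^ 2 ≤ Λ * h ^ 2 := fun m hm =>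
      mul_le_mul_of_nonneg_left (pow_le_pow_left₀ (norm_nonneg _) hm 2) hΛ
    have r1 := hrest rj (M.edge s i k) (M.edge s i l) (by
      calc _ ≤ Λ * h ^ 2 * h * h := by
            gcongr
            exacts [hrj.trans (hsq j (hj s hs)), hk s hs, hl s hs]
        _ = _ := by ring)
    have r2 := hrest (M.edge s i j) rk (M.edge s i l) (by
      calc _ ≤ h * (Λ * h ^ 2) * h := by
            gcongr
            exacts [hj s hs, hrk.trans (hsq k (hk s hs)), hl s hs]
        _ = _ := by ring)
    have r3 := hrest (M.edge s i j) (M.edge s i k) rl (by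
      calc _ ≤ h * h * (Λ * h ^ 2) := by
            gcongr
            exacts [hj s hs, hk s hs, hrl.trans (hsq l (hl s hs))]
        _ = _ := by ring)
    have htr : |entry B 0 0 + entry B 1 1 + entry B 2 2| ≤ 3 * Λ := by
      refine (abs_add_three _ _ _).trans ?_
      linarith [(abs_entry_le B 0 0).trans (hB s hs), (abs_entry_le B 1 1).trans (hB s hs),
        (abs_entry_le B 2 2).trans (hB s hs)]
    rw [ej, ek, el, e]
    refine (norm_add_le _ _).trans (add_le_add ?_ ?_)
    · rw [norm_mul]
      exact mul_le_mul_of_nonneg_right htr (norm_nonneg _)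
    · rw [Real.norm_eq_abs]
      refine (abs_add_three _ _ _).trans ?_
      linarith

/-- The uniform geometric bounds of all good triangulations of an evolving surface. -/
theorem exists_shapeBounds (hT : 0 < T) (S : EvolvingSurface T) {ρ : ℝ} (hρ : 0 < ρ) :
    ∃ Λ Q : ℝ, 0 ≤ Λ ∧ ∀ M : Mesh S, M.Assumptions ρ → M.ShapeBounds M.size ρ Λ Q := by
  obtain ⟨R, -, hR⟩ := S.exists_norm_flow_le
  obtain ⟨Λ, hΛ, hV⟩ := S.velocity_regular.exists_bounds R
  obtain ⟨κ, hκ, hΓ⟩ := S.initial.exists_bounds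
  set A := 3 * (κ + Λ * T) * Real.exp ((3 * Λ + 1) * T) with hA
  have hA0 : 0 ≤ A := by positivity
  refine ⟨Λ, 4 * Λ / ρ + 9 * (Λ * (4 * (2 * A / ρ ^ 3))), hΛ, fun M hM => ?_⟩
  have hh := hM.size_pos hT
  have hball := fun t (ht : t ∈ Icc 0 T) i => node_mem_closedBall (M := M) hR ht i
  refine ⟨fun t ht K hK i hi j hj => norm_edge_le_size ht hK hi hj,
    fun t ht i j k hij hik hjk hK => hM.norm_dualVec_le hT hρ ht hij hik hjk hK,
    fun t ht i j => ((hV t ht _ (hball t ht i)).2 _ (hball t ht j)).1, hM.expanding, ?_⟩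
  intro t ht K hK L hL i hiK hiL
  obtain ⟨j, k, hij, hik, hjk, rfl⟩ := exists_triple hK hiK
  obtain ⟨j', k', hij', hik', hjk', rfl⟩ := exists_triple hL hiL
  set B := fderiv ℝ (S.velocity t) (M.node t i) with hB
  have hBΛ : ‖B‖ ≤ Λ := (hV t ht _ (hball t ht i)).1
  -- the divergence is the tangential trace of the derivative of the velocity, up to `O(h)`
  have htrace : ∀ p q, i ≠ p → i ≠ q → p ≠ q → {i, p, q} ∈ M.triangles →
      |M.divVelocity t {i, p, q} -
        (inner ℝ (dualVec (M.edge t i p) (M.edge t i q)) (B (M.edge t i p))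
          + inner ℝ (dualVec (M.edge t i q) (M.edge t i p)) (B (M.edge t i q)))|
        ≤ 2 * Λ / ρ * M.size := by
    intro p q hip hiq hpq hKpq
    rw [divVelocity_eq ht hip hiq hpq hKpq, add_sub_add_comm, ← inner_sub_right, ← inner_sub_right]
    have hone : ∀ (d : E3) (m : Fin M.numNodes), m ∈ ({i, p, q} : Finset (Fin M.numNodes)) →
        ‖d‖ ≤ 1 / (ρ * M.size) →
        |inner ℝ d (S.velocity t (M.node t m) - S.velocity t (M.node t i) - B (M.edge t i m))|
          ≤ Λ / ρ * M.size := by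
      intro d m hm hd
      refine (abs_real_inner_le_norm _ _).trans ?_
      have h1 : ‖S.velocity t (M.node t m) - S.velocity t (M.node t i) - B (M.edge t i m)‖ ≤
          Λ * M.size ^ 2 :=
        ((hV t ht _ (hball t ht i)).2 _ (hball t ht m)).2.trans (mul_le_mul_of_nonneg_left
          (pow_le_pow_left₀ (norm_nonneg _) (norm_edge_le_size ht hKpq (by simp) hm) 2) hΛ)
      refine (mul_le_mul hd h1 (norm_nonneg _) (by positivity)).trans_eq ?_
      field_simp
    refine (abs_add_le _ _).trans ?_
    have h1 := hone _ p (by simp) (hM.norm_dualVec_le hT hρ ht hip hiq hpq hKpq)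
    have h2 := hone _ q (by simp) (hM.norm_dualVec_le hT hρ ht hiq hip hpq.symm
      (by rwa [Finset.pair_comm]))
    have e3 : 2 * Λ / ρ * M.size = Λ / ρ * M.size + Λ / ρ * M.size := by ring
    rw [e3]
    exact add_le_add h1 h2
  have hD := gramDet_edge_pos ht hij hik hjk hK
  have hD' := gramDet_edge_pos ht hij' hik' hjk' hL
  have hsmall : ∀ l ∈ ({i, j', k'} : Finset (Fin M.numNodes)),
      |inner ℝ (cross (M.edge t i j) (M.edge t i k)) (M.edge t i l)| ≤ A * M.size ^ 4 := by
    intro l hl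
    refine abs_inner_cross_edge_le hh.le hκ hΛ
      (fun s hs => norm_edge_le_size hs hK (by simp) (by simp))
      (fun s hs => norm_edge_le_size hs hK (by simp) (by simp))
      (fun s hs => norm_edge_le_size hs hL (by simp) hl) ?_
      (fun s hs => (hV s hs _ (hball s hs i)).1)
      (fun s hs m => ((hV s hs _ (hball s hs i)).2 _ (hball s hs m)).2) t ht
    intro m hm
    have e : M.edge 0 i m = M.node₀ m - M.node₀ i := by
      unfold edge node
      rw [S.flow_zero _ (M.node₀_mem m), S.flow_zero _ (M.node₀_mem i)]
    rw [e] at hm ⊢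
    exact (hΓ _ (M.node₀_mem m) _ (M.node₀_mem i)).2.trans
      (mul_le_mul_of_nonneg_left (pow_le_pow_left₀ (norm_nonneg _) hm 2) hκ)
  have hproj := abs_normal_mul_sub_le (η := 2 * A / ρ ^ 3 * M.size) hD hD' (by
    have hs : ρ ^ 2 * M.size ^ 2 ≤ Real.sqrt (gramDet (M.edge t i j) (M.edge t i k)) := by
      rw [← mul_pow]
      exact sq_le_sqrt_gramDet (mul_pos hρ hh) hD (hM.norm_dualVec_le hT hρ ht hij hik hjk hK)
        (hM.norm_dualVec_le hT hρ ht hik hij hjk.symm (by rwa [Finset.pair_comm]))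
    have h1 := mul_le_mul (hsmall j' (by simp)) (hM.norm_dualVec_le hT hρ ht hij' hik' hjk' hL)
      (norm_nonneg _) (by positivity)
    have h2 := mul_le_mul (hsmall k' (by simp)) (hM.norm_dualVec_le hT hρ ht hik' hij' hjk'.symm
      (by rwa [Finset.pair_comm])) (norm_nonneg _) (by positivity)
    have h3 : 2 * A / ρ ^ 3 * M.size * (ρ ^ 2 * M.size ^ 2) ≤
        2 * A / ρ ^ 3 * M.size * Real.sqrt (gramDet (M.edge t i j) (M.edge t i k)) :=
      mul_le_mul_of_nonneg_left hs (by positivity)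
    refine (add_le_add h1 h2).trans (le_trans (le_of_eq ?_) h3)
    field_simp
    ring)
  have hd := htrace j k hij hik hjk hK
  have hd' := htrace j' k' hij' hik' hjk' hL
  rw [inner_dualVec_apply hD.ne'] at hd
  rw [inner_dualVec_apply hD'.ne'] at hd'
  have hdiff : |∑ a, ∑ b, entry B a b * ((if a = b then 1 else 0)
        - cross (M.edge t i j) (M.edge t i k) a * cross (M.edge t i j) (M.edge t i k) b
          / gramDet (M.edge t i j) (M.edge t i k))
      - ∑ a, ∑ b, entry B a b * ((if a = b then 1 else 0)
        - cross (M.edge t i j') (M.edge t i k') a * cross (M.edge t i j') (M.edge t i k') b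
          / gramDet (M.edge t i j') (M.edge t i k'))|
      ≤ 9 * (Λ * (4 * (2 * A / ρ ^ 3 * M.size))) := by
    rw [← Finset.sum_sub_distrib]
    simp only [← Finset.sum_sub_distrib, ← mul_sub, sub_sub_sub_cancel_left]
    have hab : ∀ a b : Fin 3, |entry B a b
        * (cross (M.edge t i j') (M.edge t i k') a * cross (M.edge t i j') (M.edge t i k') b
          / gramDet (M.edge t i j') (M.edge t i k')
        - cross (M.edge t i j) (M.edge t i k) a * cross (M.edge t i j) (M.edge t i k) b
          / gramDet (M.edge t i j) (M.edge t i k))| ≤ Λ * (4 * (2 * A / ρ ^ 3 * M.size)) := by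
      intro a b
      rw [abs_mul, abs_sub_comm (_ / _)]
      exact mul_le_mul ((abs_entry_le B a b).trans hBΛ) (hproj a b) (abs_nonneg _) hΛ
    refine (Finset.abs_sum_le_sum_abs _ _).trans
      ((Finset.sum_le_sum fun a _ => (Finset.abs_sum_le_sum_abs _ _).trans
        (Finset.sum_le_sum fun b _ => hab a b)).trans_eq ?_)
    simp only [Finset.sum_const, Finset.card_univ, Fintype.card_fin, nsmul_eq_mul]
    norm_num
    ring
  rw [abs_le] at hd hd' hdiff ⊢
  have e1 : (4 * Λ / ρ + 9 * (Λ * (4 * (2 * A / ρ ^ 3)))) * M.size =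
      2 * Λ / ρ * M.size + 2 * Λ / ρ * M.size + 9 * (Λ * (4 * (2 * A / ρ ^ 3 * M.size))) := by ring
  rw [e1]
  constructor <;> linarith [hd.1, hd.2, hd'.1, hd'.2, hdiff.1, hdiff.2]

end Mesh

/-! ### The normal projection -/

namespace Surface

variable {Γ : Surface} {κ : ℝ}

lemma proj_spec (Γ : Surface) (x : E3) :
    proj Γ.carrier x ∈ Γ.carrier ∧ dist x (proj Γ.carrier x) = Metric.infDist x Γ.carrier := by
  have h : ∃ y, y ∈ Γ.carrier ∧ dist x y = Metric.infDist x Γ.carrier := by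
    obtain ⟨y, hy, e⟩ := Γ.isCompact.exists_infDist_eq_dist Γ.isConnected.nonempty x
    exact ⟨y, hy, e.symm⟩
  unfold proj
  rw [dif_pos h]
  exact h.choose_spec

lemma exists_sub_proj (Γ : Surface) (x : E3) : ∃ s : ℝ,
    x = proj Γ.carrier x + s • Γ.normal (proj Γ.carrier x) ∧ |s| = Metric.infDist x Γ.carrier := by
  obtain ⟨h1, h2⟩ := Γ.proj_spec x
  obtain ⟨s, hs⟩ := Γ.exists_smul_normal h1 h2
  refine ⟨s, by rw [← hs]; abel, ?_⟩
  rw [← h2, dist_eq_norm, hs, norm_smul, Γ.norm_normal h1, mul_one, Real.norm_eq_abs]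

/-- Near the surface the normal projection is Lipschitz. -/
lemma norm_proj_sub_le
    (hΓ : ∀ a ∈ Γ.carrier, ∀ b ∈ Γ.carrier, ‖Γ.normal a - Γ.normal b‖ ≤ κ * ‖a - b‖ ∧
        |inner ℝ (a - b) (Γ.normal b)| ≤ κ * ‖a - b‖ ^ 2) {h : ℝ} (hκh : κ * h ≤ 1 / 4) {x y : E3}
    (hx : Metric.infDist x Γ.carrier ≤ h) (hy : Metric.infDist y Γ.carrier ≤ h) :
    ‖proj Γ.carrier x - proj Γ.carrier y‖ ≤ 2 * ‖x - y‖ := by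
  obtain ⟨s, es, hs⟩ := Γ.exists_sub_proj x
  obtain ⟨s', es', hs'⟩ := Γ.exists_sub_proj y
  have ha := (Γ.proj_spec x).1
  have hb := (Γ.proj_spec y).1
  have hh : 0 ≤ h := Metric.infDist_nonneg.trans hx
  set a := proj Γ.carrier x
  set b := proj Γ.carrier y
  have h1 := (hΓ a ha b hb).2
  have h2 := (hΓ b hb a ha).2
  have e : ‖a - b‖ ^ 2 = inner ℝ (a - b) (x - y) + s * inner ℝ (b - a) (Γ.normal a)
      + s' * inner ℝ (a - b) (Γ.normal b) := by
    have : x - y = (a - b) + s • Γ.normal a - s' • Γ.normal b := by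
      rw [es, es']; abel
    rw [this, inner_sub_right, inner_add_right, inner_smul_right, inner_smul_right,
      real_inner_self_eq_norm_sq, ← neg_sub a b, inner_neg_left]
    ring
  have h3 := real_inner_le_norm (a - b) (x - y)
  have h4 : s * inner ℝ (b - a) (Γ.normal a) ≤ 1 / 4 * ‖a - b‖ ^ 2 := by
    refine (le_abs_self _).trans ?_
    rw [abs_mul, hs]
    rw [norm_sub_rev] at h2
    calc _ ≤ h * (κ * ‖a - b‖ ^ 2) := by gcongr
      _ = κ * h * ‖a - b‖ ^ 2 := by ring
      _ ≤ _ := by gcongr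
  have h5 : s' * inner ℝ (a - b) (Γ.normal b) ≤ 1 / 4 * ‖a - b‖ ^ 2 := by
    refine (le_abs_self _).trans ?_
    rw [abs_mul, hs']
    calc _ ≤ h * (κ * ‖a - b‖ ^ 2) := by gcongr
      _ = κ * h * ‖a - b‖ ^ 2 := by ring
      _ ≤ _ := by gcongr
  by_contra! hcon
  have h6 : 0 < ‖a - b‖ := (by positivity : (0 : ℝ) ≤ 2 * ‖x - y‖).trans_lt hcon
  nlinarith

/-- Along directions that are almost tangential the normal projection is bi-Lipschitz. -/
lemma norm_sub_le_norm_proj_sub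
    (hΓ : ∀ a ∈ Γ.carrier, ∀ b ∈ Γ.carrier, ‖Γ.normal a - Γ.normal b‖ ≤ κ * ‖a - b‖ ∧
        |inner ℝ (a - b) (Γ.normal b)| ≤ κ * ‖a - b‖ ^ 2) {h : ℝ} (hκh : κ * h ≤ 1 / 4) {x y : E3}
    (hx : Metric.infDist x Γ.carrier ≤ h)
    (hxy : |inner ℝ (x - y) (Γ.normal (proj Γ.carrier y))| ≤ 1 / 4 * ‖x - y‖) :
    ‖x - y‖ ≤ 3 * ‖proj Γ.carrier x - proj Γ.carrier y‖ := by
  obtain ⟨s, es, hs⟩ := Γ.exists_sub_proj x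
  obtain ⟨s', es', hs'⟩ := Γ.exists_sub_proj y
  have ha := (Γ.proj_spec x).1
  have hb := (Γ.proj_spec y).1
  have hh : 0 ≤ h := Metric.infDist_nonneg.trans hx
  set a := proj Γ.carrier x
  set b := proj Γ.carrier y
  have h1 := (hΓ a ha b hb).1
  have hνb := Γ.norm_normal hb
  set r : E3 := (a - b) + s • (Γ.normal a - Γ.normal b) with hr
  have e : x - y = r + (s - s') • Γ.normal b := by
    rw [es, es', hr]; module
  have hr1 : ‖r‖ ≤ 5 / 4 * ‖a - b‖ := by
    refine (norm_add_le _ _).trans ?_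
    rw [norm_smul, Real.norm_eq_abs, hs]
    have : Metric.infDist x Γ.carrier * ‖Γ.normal a - Γ.normal b‖ ≤ h * (κ * ‖a - b‖) := by
      gcongr
    nlinarith [norm_nonneg (a - b)]
  have h2 : |s - s'| ≤ ‖x - y‖ + ‖r‖ := by
    have : (s - s') • Γ.normal b = (x - y) - r := by rw [e]; abel
    have h3 := congrArg norm this
    rw [norm_smul, hνb, mul_one, Real.norm_eq_abs] at h3
    rw [h3]; exact norm_sub_le _ _
  have h3 : ‖x - y‖ ^ 2 ≤ ‖r‖ * ‖x - y‖ + (‖x - y‖ + ‖r‖) * (1 / 4 * ‖x - y‖) := by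
    have e2 : ‖x - y‖ ^ 2 = inner ℝ r (x - y) + (s - s') * inner ℝ (x - y) (Γ.normal b) := by
      rw [← real_inner_self_eq_norm_sq, real_inner_comm (Γ.normal b)]
      nth_rewrite 1 [e]
      rw [inner_add_left, inner_smul_left]
      rfl
    rw [e2]
    refine add_le_add (real_inner_le_norm _ _) ((le_abs_self _).trans ?_)
    rw [abs_mul]
    exact mul_le_mul h2 hxy (abs_nonneg _) (by positivity)
  by_contra! hcon
  have h6 : 0 < ‖x - y‖ := (by positivity : (0 : ℝ) ≤ 3 * ‖a - b‖).trans_lt hcon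
  nlinarith [norm_nonneg (a - b), norm_nonneg r]

/-! ### Differences of a smooth function along a curve on the surface -/

lemma continuousOn_normal (Γ : Surface) : ContinuousOn Γ.normal Γ.carrier := by
  obtain ⟨κ, hκ, hΓ⟩ := Γ.exists_bounds
  refine (LipschitzOnWith.of_dist_le_mul (K := κ.toNNReal) fun a ha b hb => ?_).continuousOn
  rw [dist_eq_norm, dist_eq_norm, Real.coe_toNNReal _ hκ]
  exact (hΓ a ha b hb).1

lemma continuous_gradient {φ : E3 → ℝ} (hφ : ContDiff ℝ 1 φ) : Continuous (gradient φ) :=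
  (InnerProductSpace.toDual ℝ E3).symm.continuous.comp (hφ.continuous_fderiv one_ne_zero)

lemma continuousOn_tangentialGradient (Γ : Surface) {φ : E3 → ℝ} (hφ : ContDiff ℝ 1 φ) :
    ContinuousOn (Γ.tangentialGradient φ) Γ.carrier := by
  have h1 := (continuous_gradient hφ).continuousOn (s := Γ.carrier)
  have h2 := Γ.continuousOn_normal
  exact h1.fun_sub ((h1.inner (𝕜 := ℝ) h2).fun_smul h2)

lemma inner_tangentialGradient (Γ : Surface) (φ : E3 → ℝ) (y v : E3) :
    fderiv ℝ φ y v = inner ℝ (Γ.tangentialGradient φ y) v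
      + inner ℝ (gradient φ y) (Γ.normal y) * inner ℝ v (Γ.normal y) := by
  unfold tangentialGradient
  rw [inner_sub_left, inner_smul_left, real_inner_comm v (Γ.normal y), gradient,
    InnerProductSpace.toDual_symm_apply]
  simp

/-- A curve on the surface is tangential to it, so only the tangential gradient matters; the curve
need not be differentiable. -/
lemma sub_le_integral_tangentialGradient (Γ : Surface) {φ : E3 → ℝ} (hφ : ContDiff ℝ 1 φ)
    {γ : ℝ → E3} {a c : ℝ} (ha : 0 ≤ a) (hc : 0 ≤ c) (hγ : ∀ s ∈ Icc 0 a, γ s ∈ Γ.carrier)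
    (hL : ∀ s ∈ Icc 0 a, ∀ s' ∈ Icc 0 a, ‖γ s - γ s'‖ ≤ c * |s - s'|) :
    φ (γ a) - φ (γ 0) ≤ c * ∫ s in (0 : ℝ)..a, ‖Γ.tangentialGradient φ (γ s)‖ := by
  obtain ⟨κ, hκ, hΓ⟩ := Γ.exists_bounds
  have hγc : ContinuousOn γ (Icc 0 a) := by
    refine (LipschitzOnWith.of_dist_le_mul (K := c.toNNReal) fun s hs s' hs' => ?_).continuousOn
    rw [dist_eq_norm, Real.dist_eq, Real.coe_toNNReal _ hc]
    exact hL s hs s' hs'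
  set G : ℝ → ℝ := fun s => ‖Γ.tangentialGradient φ (γ s)‖ with hG
  have hGc : ContinuousOn G (Icc 0 a) :=
    ((Γ.continuousOn_tangentialGradient hφ).comp hγc hγ).norm
  have hint : ∀ s ∈ Icc 0 a, IntervalIntegrable G volume 0 s := fun s hs =>
    (hGc.mono (Icc_subset_Icc_right hs.2)).intervalIntegrable_of_Icc hs.1
  have key := image_le_of_liminf_slope_right_le_deriv_boundary
    (f := fun s => φ (γ s) - φ (γ 0)) (B := fun s => c * ∫ r in (0 : ℝ)..s, G r)
    (B' := fun s => c * G s) (a := 0) (b := a)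
    ((hφ.continuous.comp_continuousOn hγc).sub continuousOn_const) (by simp) ?_ ?_ ?_
  · exact key (right_mem_Icc.2 ha)
  · refine continuousOn_const.mul ?_
    have := intervalIntegral.continuousOn_primitive_interval (μ := volume) (f := G) (a := 0) (b := a)
      (by rw [uIcc_of_le ha]; exact hGc.integrableOn_Icc)
    rwa [uIcc_of_le ha] at this
  · intro s hs
    refine HasDerivWithinAt.const_mul c ?_
    have hs' : s ∈ Icc 0 a := Ico_subset_Icc_self hs
    have hcs : ContinuousWithinAt G (Ioi s) s :=
      (hGc s hs').mono_of_mem_nhdsWithin (Icc_mem_nhdsGT_of_mem hs)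
    refine intervalIntegral.integral_hasDerivWithinAt_right (hint s hs') ?_ hcs
    exact (hGc.stronglyMeasurableAtFilter_nhdsWithin measurableSet_Icc s).filter_mono
      (nhdsWithin_le_of_mem (Icc_mem_nhdsGT_of_mem hs))
  · intro s hs r hr
    have hs' : s ∈ Icc 0 a := Ico_subset_Icc_self hs
    set η := r - c * G s with hη
    have hη0 : 0 < η := sub_pos.2 hr
    set M := |inner ℝ (gradient φ (γ s)) (Γ.normal (γ s))| with hM
    have hM0 : 0 ≤ M := abs_nonneg _
    have hdiff : HasFDerivAt φ (fderiv ℝ φ (γ s)) (γ s) :=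
      (hφ.differentiable one_ne_zero _).hasFDerivAt
    have hlo := hdiff.isLittleO.def (c := η / (2 * (c + 1))) (by positivity)
    have htend : Tendsto γ (𝓝[>] s) (𝓝 (γ s)) :=
      (hγc s hs').mono_of_mem_nhdsWithin (Icc_mem_nhdsGT_of_mem hs)
    have hnear : ∀ᶠ z in 𝓝[>] s, z - s < η / (4 * (M * κ * c ^ 2 + 1)) := by
      have : Tendsto (fun z => z - s) (𝓝[>] s) (𝓝 (s - s)) :=
        ((continuous_id.sub continuous_const).tendsto s).mono_left nhdsWithin_le_nhds
      rw [sub_self] at this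
      exact this.eventually_lt_const (by positivity)
    refine Eventually.frequently ?_
    filter_upwards [htend.eventually hlo, hnear, self_mem_nhdsWithin,
      Icc_mem_nhdsGT_of_mem hs] with z hz1 hz2 hz3 hz4
    have hzs : 0 < z - s := sub_pos.2 hz3
    rw [slope_def_field, div_lt_iff₀ hzs, sub_sub_sub_cancel_right]
    set Δ := γ z - γ s with hΔ
    have hΔ1 : ‖Δ‖ ≤ c * (z - s) := by
      have := hL z hz4 s hs'
      rwa [abs_of_pos hzs] at this
    have h1 : φ (γ z) - φ (γ s) ≤ fderiv ℝ φ (γ s) Δ + η / (2 * (c + 1)) * ‖Δ‖ := by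
      rw [Real.norm_eq_abs] at hz1
      linarith [le_abs_self (φ (γ z) - φ (γ s) - fderiv ℝ φ (γ s) Δ)]
    have h2 : fderiv ℝ φ (γ s) Δ ≤ G s * ‖Δ‖ + M * (κ * ‖Δ‖ ^ 2) := by
      rw [Γ.inner_tangentialGradient]
      refine add_le_add (real_inner_le_norm _ _) ((le_abs_self _).trans ?_)
      rw [abs_mul]
      exact mul_le_mul_of_nonneg_left (hΓ _ (hγ z hz4) _ (hγ s hs')).2 hM0
    have h3 : G s * ‖Δ‖ ≤ c * G s * (z - s) := by
      have := mul_le_mul_of_nonneg_left hΔ1 (norm_nonneg (Γ.tangentialGradient φ (γ s)))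
      calc _ ≤ G s * (c * (z - s)) := this
        _ = _ := by ring
    have h4 : M * (κ * ‖Δ‖ ^ 2) ≤ η / 4 * (z - s) := by
      have h5 : ‖Δ‖ ^ 2 ≤ (c * (z - s)) ^ 2 := pow_le_pow_left₀ (norm_nonneg _) hΔ1 2
      rw [lt_div_iff₀ (by positivity)] at hz2
      have h6 : 0 ≤ M * κ * c ^ 2 := by positivity
      calc _ ≤ M * (κ * (c * (z - s)) ^ 2) := by gcongr
        _ = (M * κ * c ^ 2) * (z - s) * (z - s) := by ring
        _ ≤ _ := by
          refine mul_le_mul_of_nonneg_right ?_ hzs.le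
          nlinarith
    have h5 : η / (2 * (c + 1)) * ‖Δ‖ ≤ η / 2 * (z - s) := by
      rw [div_mul_eq_mul_div, div_le_iff₀ (by positivity)]
      have : ‖Δ‖ ≤ (c + 1) * (z - s) := hΔ1.trans (by nlinarith)
      nlinarith
    have h6 : r * (z - s) = c * G s * (z - s) + η * (z - s) := by rw [hη]; ring
    nlinarith

/-- The squared form of the previous estimate. -/
lemma sq_sub_le_integral_tangentialGradient (Γ : Surface) {φ : E3 → ℝ} (hφ : ContDiff ℝ 1 φ)
    {γ : ℝ → E3} {a c : ℝ} (ha : 0 < a) (hc : 0 ≤ c) (hγ : ∀ s ∈ Icc 0 a, γ s ∈ Γ.carrier)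
    (hL : ∀ s ∈ Icc 0 a, ∀ s' ∈ Icc 0 a, ‖γ s - γ s'‖ ≤ c * |s - s'|) :
    (φ (γ a) - φ (γ 0)) ^ 2 ≤
      c ^ 2 * a * ∫ s in (0 : ℝ)..a, ‖Γ.tangentialGradient φ (γ s)‖ ^ 2 := by
  have hγc : ContinuousOn γ (Icc 0 a) := by
    refine (LipschitzOnWith.of_dist_le_mul (K := c.toNNReal) fun s hs s' hs' => ?_).continuousOn
    rw [dist_eq_norm, Real.dist_eq, Real.coe_toNNReal _ hc]
    exact hL s hs s' hs'
  have hGc : ContinuousOn (fun s => ‖Γ.tangentialGradient φ (γ s)‖) (Icc 0 a) :=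
    ((Γ.continuousOn_tangentialGradient hφ).comp hγc hγ).norm
  have h1 := Γ.sub_le_integral_tangentialGradient hφ ha.le hc hγ hL
  have h2 := Γ.sub_le_integral_tangentialGradient hφ.neg ha.le hc hγ hL
  have e : ∀ y, ‖Γ.tangentialGradient (fun x => -φ x) y‖ = ‖Γ.tangentialGradient φ y‖ := by
    intro y
    have : gradient (fun x => -φ x) y = -gradient φ y := by
      unfold gradient
      rw [fderiv_fun_neg, map_neg]
    unfold tangentialGradient
    rw [this, ← norm_neg, inner_neg_left]
    congr 1
    module
  simp only [e] at h2
  set G : ℝ → ℝ := fun s => ‖Γ.tangentialGradient φ (γ s)‖ with hG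
  set I := ∫ s in (0 : ℝ)..a, G s with hI
  have hi1 : IntervalIntegrable G volume 0 a := hGc.intervalIntegrable_of_Icc ha.le
  have hi2 : IntervalIntegrable (fun s => G s ^ 2) volume 0 a :=
    (hGc.pow 2).intervalIntegrable_of_Icc ha.le
  have hJ : I ^ 2 ≤ a * ∫ s in (0 : ℝ)..a, G s ^ 2 := by
    have h0 : 0 ≤ ∫ s in (0 : ℝ)..a, (G s - I / a) ^ 2 :=
      intervalIntegral.integral_nonneg ha.le fun s _ => sq_nonneg _
    have e1 : ∫ s in (0 : ℝ)..a, (G s - I / a) ^ 2 =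
        (∫ s in (0 : ℝ)..a, G s ^ 2) - I ^ 2 / a := by
      have : ∀ s, (G s - I / a) ^ 2 = G s ^ 2 - (2 * (I / a)) * G s + (I / a) ^ 2 := fun s => by ring
      simp only [this]
      rw [intervalIntegral.integral_add (hi2.sub (hi1.const_mul _)) (by simp),
        intervalIntegral.integral_sub hi2 (hi1.const_mul _), intervalIntegral.integral_const_mul,
        intervalIntegral.integral_const, ← hI]
      simp only [sub_zero, smul_eq_mul]
      field_simp
      ring
    rw [e1, sub_nonneg, div_le_iff₀ ha] at h0
    linarith
  have habs : |φ (γ a) - φ (γ 0)| ≤ c * I := abs_le.2 ⟨by linarith, h1⟩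
  calc (φ (γ a) - φ (γ 0)) ^ 2 = |φ (γ a) - φ (γ 0)| ^ 2 := (sq_abs _).symm
    _ ≤ (c * I) ^ 2 := pow_le_pow_left₀ (abs_nonneg _) habs 2
    _ = c ^ 2 * I ^ 2 := by ring
    _ ≤ _ := by rw [mul_assoc]; gcongr

end Surface

/-! ### A difference estimate on the reference triangle -/

/-- The open right-angled triangle in `ℝ²` with legs of length `r`. -/
def openTriangle (r : ℝ) : Set E2 := {p | 0 < p 0 ∧ 0 < p 1 ∧ p 0 + p 1 < r}

lemma isOpen_openTriangle (r : ℝ) : IsOpen (openTriangle r) := by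
  refine ((isOpen_lt (by fun_prop) (by fun_prop)).inter ((isOpen_lt (by fun_prop) (by fun_prop)).inter
    (isOpen_lt (by fun_prop) (by fun_prop))) : IsOpen ({p : E2 | 0 < p 0} ∩ ({p : E2 | 0 < p 1} ∩
      {p : E2 | p 0 + p 1 < r})))

lemma openTriangle_subset_refTriangle {r : ℝ} (hr : r ≤ 1) : openTriangle r ⊆ refTriangle :=
  fun _ hp => ⟨hp.1.le, hp.2.1.le, hp.2.2.le.trans hr⟩

lemma volume_openTriangle_pos {r : ℝ} (hr : 0 < r) : 0 < volume (openTriangle r) := by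
  refine (isOpen_openTriangle r).measure_pos _ ⟨!₂[r / 3, r / 3], ?_, ?_, ?_⟩
  all_goals simp; try linarith

lemma volume_openTriangle_ne_top {r : ℝ} (hr : r ≤ 1) : volume (openTriangle r) ≠ ⊤ :=
  ne_top_of_le_ne_top volume_refTriangle_ne_top
    (measure_mono (openTriangle_subset_refTriangle hr))

/-- The first unit vector of the plane. -/
def unitVec : E2 := EuclideanSpace.single 0 1

lemma add_smul_unitVec_mem {q : E2} (hq : q ∈ openTriangle (1 / 2)) {s : ℝ}
    (hs : s ∈ Icc (0 : ℝ) (1 / 2)) : q + s • unitVec ∈ openTriangle 1 := by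
  obtain ⟨h0, h1, h2⟩ := hq
  have e0 : (q + s • unitVec) 0 = q 0 + s := by simp [unitVec]
  have e1 : (q + s • unitVec) 1 = q 1 := by simp [unitVec]
  refine ⟨?_, ?_, ?_⟩
  · rw [e0]; linarith [hs.1]
  · rwa [e1]
  · rw [e0, e1]; linarith [hs.2]

/-- Integration over the half-size triangle of a bound for a difference quotient: shifts by at most
`1/2` do not leave the triangle. -/
lemma ofReal_mul_volume_le {δ D : ℝ} (hD : 0 ≤ D) {E G : E2 → ℝ}
    (hE : ContinuousOn E (openTriangle 1)) (hG : ContinuousOn G (openTriangle 1))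
    (h : ∀ q ∈ openTriangle (1 / 2), δ ^ 2 ≤ 3 * E (q + (1 / 2 : ℝ) • unitVec) ^ 2 + 3 * E q ^ 2
      + 3 * (D * ∫ s in (0 : ℝ)..(1 / 2), G (q + s • unitVec) ^ 2)) :
    ENNReal.ofReal (δ ^ 2) * volume (openTriangle (1 / 2)) ≤
      6 * (∫⁻ q in openTriangle 1, ENNReal.ofReal (E q ^ 2))
        + ENNReal.ofReal (3 * D / 2) * ∫⁻ q in openTriangle 1, ENNReal.ofReal (G q ^ 2) := by
  classical
  have hT := (isOpen_openTriangle 1).measurableSet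
  have hT2 := (isOpen_openTriangle (1 / 2)).measurableSet
  have hmeas : ∀ {E : E2 → ℝ}, ContinuousOn E (openTriangle 1) →
      Measurable ((openTriangle 1).indicator fun q => ENNReal.ofReal (E q ^ 2)) := by
    intro E hE
    rw [← piecewise_eq_indicator]
    exact (ENNReal.continuous_ofReal.comp_continuousOn (hE.pow 2)).measurable_piecewise
      continuousOn_const hT
  set FE := (openTriangle 1).indicator fun q => ENNReal.ofReal (E q ^ 2) with hFE
  set FG := (openTriangle 1).indicator fun q => ENNReal.ofReal (G q ^ 2) with hFG
  have hFEm : Measurable FE := hmeas hE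
  have hFGm : Measurable FG := hmeas hG
  have hpt : ∀ q ∈ openTriangle (1 / 2), ENNReal.ofReal (δ ^ 2) ≤
      3 * FE (q + (1 / 2 : ℝ) • unitVec) + 3 * FE q
        + ENNReal.ofReal (3 * D) * ∫⁻ s in Icc (0 : ℝ) (1 / 2), FG (q + s • unitVec) := by
    intro q hq
    have hq' : q ∈ openTriangle 1 := by
      have := add_smul_unitVec_mem hq (s := 0) (by norm_num)
      rwa [zero_smul, add_zero] at this
    have hc : ContinuousOn (fun s : ℝ => G (q + s • unitVec) ^ 2) (Icc 0 (1 / 2)) :=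
      (hG.comp (by fun_prop) fun s hs => add_smul_unitVec_mem hq hs).pow 2
    have e1 : ENNReal.ofReal (∫ s in (0 : ℝ)..(1 / 2), G (q + s • unitVec) ^ 2) =
        ∫⁻ s in Icc (0 : ℝ) (1 / 2), FG (q + s • unitVec) := by
      rw [intervalIntegral.integral_of_le (by norm_num), ← integral_Icc_eq_integral_Ioc,
        ofReal_integral_eq_lintegral_ofReal hc.integrableOn_Icc (ae_of_all _ fun s => sq_nonneg _)]
      refine setLIntegral_congr_fun measurableSet_Icc fun s hs => ?_
      rw [hFG, indicator_of_mem (add_smul_unitVec_mem hq hs)]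
    have e2 : ∀ {q}, q ∈ openTriangle 1 → FE q = ENNReal.ofReal (E q ^ 2) := fun hq => by
      rw [hFE, indicator_of_mem hq]
    rw [← e1, e2 hq', e2 (add_smul_unitVec_mem hq (by norm_num)), ← ENNReal.ofReal_mul (by positivity),
      show (3 : ENNReal) = ENNReal.ofReal 3 by simp, ← ENNReal.ofReal_mul (by norm_num),
      ← ENNReal.ofReal_mul (by norm_num), ← ENNReal.ofReal_add (by positivity) (by positivity),
      ← ENNReal.ofReal_add (by positivity)]
    · exact ENNReal.ofReal_le_ofReal ((h q hq).trans_eq (by ring))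
    · exact mul_nonneg (by positivity)
        (intervalIntegral.integral_nonneg (by norm_num) fun s _ => sq_nonneg _)
  calc ENNReal.ofReal (δ ^ 2) * volume (openTriangle (1 / 2))
      = ∫⁻ q in openTriangle (1 / 2), ENNReal.ofReal (δ ^ 2) := (setLIntegral_const _ _).symm
    _ ≤ ∫⁻ q in openTriangle (1 / 2), (3 * FE (q + (1 / 2 : ℝ) • unitVec) + 3 * FE q
        + ENNReal.ofReal (3 * D) * ∫⁻ s in Icc (0 : ℝ) (1 / 2), FG (q + s • unitVec)) :=
        setLIntegral_mono' hT2 hpt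
    _ ≤ ∫⁻ q, (3 * FE (q + (1 / 2 : ℝ) • unitVec) + 3 * FE q
        + ENNReal.ofReal (3 * D) * ∫⁻ s in Icc (0 : ℝ) (1 / 2), FG (q + s • unitVec)) :=
        setLIntegral_le_lintegral _ _
    _ = 3 * (∫⁻ q, FE q) + 3 * (∫⁻ q, FE q)
        + ENNReal.ofReal (3 * D) * ∫⁻ s in Icc (0 : ℝ) (1 / 2), ∫⁻ q, FG q := by
        have hu : Measurable fun z : E2 × ℝ => FG (z.1 + z.2 • unitVec) :=
          hFGm.comp (by fun_prop)
        rw [lintegral_add_left (by fun_prop), lintegral_add_left (by fun_prop),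
          lintegral_const_mul _ (by fun_prop), lintegral_const_mul _ hFEm,
          lintegral_const_mul _ hu.lintegral_prod_right',
          lintegral_add_right_eq_self FE,
          lintegral_lintegral_swap (f := fun q s => FG (q + s • unitVec)) hu.aemeasurable]
        simp only [lintegral_add_right_eq_self FG]
    _ = _ := by
        rw [setLIntegral_const, Real.volume_Icc, hFE, hFG, lintegral_indicator hT,
          lintegral_indicator hT, ← add_mul, mul_comm (∫⁻ q in openTriangle 1, _) (ENNReal.ofReal _),
          ← mul_assoc, ← ENNReal.ofReal_mul (by positivity)]
        congr 2
        · norm_num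
        · congr 1; ring

namespace Mesh

variable {T : ℝ} {S : EvolvingSurface T} {M : Mesh S}

/-! ### Open triangles and the normal projection of the initial mesh -/

variable (M) in
/-- The relative interior of a triangle. -/
def openCell (t : ℝ) (K : Finset (Fin M.numNodes)) : Set E3 :=
  {x ∈ M.cell t K | ∀ i ∈ K, 0 < M.basis t x i}

lemma cell_eq_image (t : ℝ) (i j k : Fin M.numNodes) :
    M.cell t {i, j, k} =
      triMap (M.node t i) (M.edge t i j) (M.edge t i k) '' refTriangle := by
  rw [cell_triple, ← convexHull_triple_eq_image]
  simp [edge]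

lemma basis_triMap {t : ℝ} (ht : t ∈ Icc 0 T) {i j k : Fin M.numNodes} (hij : i ≠ j)
    (hik : i ≠ k) (hjk : j ≠ k) (hK : {i, j, k} ∈ M.triangles) {q : E2} (hq : q ∈ refTriangle) :
    M.basis t (triMap (M.node t i) (M.edge t i j) (M.edge t i k) q) i = 1 - q 0 - q 1 ∧
    M.basis t (triMap (M.node t i) (M.edge t i j) (M.edge t i k) q) j = q 0 ∧
    M.basis t (triMap (M.node t i) (M.edge t i j) (M.edge t i k) q) k = q 1 := by
  have hD := gramDet_edge_pos ht hij hik hjk hK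
  have hx : triMap (M.node t i) (M.edge t i j) (M.edge t i k) q ∈ M.cell t {i, j, k} := by
    rw [cell_eq_image]; exact mem_image_of_mem _ hq
  obtain ⟨h1, h2⟩ := inner_triMap (x := M.node t i) hD.ne' q
  rw [← basis_eq_inner ht hij hik hjk hK hx] at h1
  rw [← basis_eq_inner ht hik hij hjk.symm (by rwa [Finset.pair_comm])
    (by rwa [Finset.pair_comm])] at h2
  have h3 := (basis_spec (cell_subset_surface hK hx)).1.2.1
  rw [sum_triple hij hik hjk fun l hl => basis_eq_zero_of_notMem ht hK hx hl, h1, h2] at h3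
  exact ⟨by linarith, h1, h2⟩

lemma openCell_eq_image {t : ℝ} (ht : t ∈ Icc 0 T) {i j k : Fin M.numNodes} (hij : i ≠ j)
    (hik : i ≠ k) (hjk : j ≠ k) (hK : {i, j, k} ∈ M.triangles) :
    M.openCell t {i, j, k} =
      triMap (M.node t i) (M.edge t i j) (M.edge t i k) '' openTriangle 1 := by
  ext x
  constructor
  · rintro ⟨hx, hpos⟩
    rw [cell_eq_image] at hx
    obtain ⟨q, hq, rfl⟩ := hx
    obtain ⟨b1, b2, b3⟩ := basis_triMap ht hij hik hjk hK hq
    have p1 := hpos i (by simp)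
    have p2 := hpos j (by simp)
    have p3 := hpos k (by simp)
    rw [b1] at p1; rw [b2] at p2; rw [b3] at p3
    exact ⟨q, ⟨p2, p3, by linarith⟩, rfl⟩
  · rintro ⟨q, hq, rfl⟩
    have hq' := openTriangle_subset_refTriangle le_rfl hq
    obtain ⟨b1, b2, b3⟩ := basis_triMap ht hij hik hjk hK hq'
    refine ⟨by rw [cell_eq_image]; exact mem_image_of_mem _ hq', fun l hl => ?_⟩
    simp only [Finset.mem_insert, Finset.mem_singleton] at hl
    rcases hl with rfl | rfl | rfl
    · rw [b1]; linarith [hq.2.2]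
    · rw [b2]; exact hq.1
    · rw [b3]; exact hq.2.1

lemma openCell_subset (t : ℝ) (K : Finset (Fin M.numNodes)) : M.openCell t K ⊆ M.cell t K :=
  fun _ hx => hx.1

lemma measurableSet_openCell {t : ℝ} (ht : t ∈ Icc 0 T) {K : Finset (Fin M.numNodes)}
    (hK : K ∈ M.triangles) : MeasurableSet (M.openCell t K) := by
  obtain ⟨i, j, k, hij, hik, hjk, rfl⟩ := exists_triple' hK
  rw [openCell_eq_image ht hij hik hjk hK]
  exact (measurableEmbedding_triMap (gramDet_edge_pos ht hij hik hjk hK).ne').measurableSet_image'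
    (isOpen_openTriangle 1).measurableSet

/-- The open triangles are disjoint, since barycentric coordinates are unique. -/
lemma eq_of_mem_openCell {t : ℝ} (ht : t ∈ Icc 0 T) {K L : Finset (Fin M.numNodes)}
    (hK : K ∈ M.triangles) (hL : L ∈ M.triangles) {x : E3} (hxK : x ∈ M.openCell t K)
    (hxL : x ∈ M.openCell t L) : K = L := by
  refine Finset.Subset.antisymm (fun i hi => ?_) (fun i hi => ?_)
  · by_contra h
    exact (hxK.2 i hi).ne' (basis_eq_zero_of_notMem ht hL hxL.1 h)
  · by_contra h
    exact (hxL.2 i hi).ne' (basis_eq_zero_of_notMem ht hK hxK.1 h)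

lemma _root_.ESFEM.EvolvingSurface.at_zero (S : EvolvingSurface T) : S.at 0 = S.initial.carrier := by
  unfold EvolvingSurface.at
  rw [image_congr (g := id) fun x hx => S.flow_zero x hx, image_id]

lemma node_zero_eq (i : Fin M.numNodes) : M.node 0 i = M.node₀ i := S.flow_zero _ (M.node₀_mem i)

lemma infDist_le_size (hT : 0 < T) {K : Finset (Fin M.numNodes)} (hK : K ∈ M.triangles) {x : E3}
    (hx : x ∈ M.cell 0 K) : Metric.infDist x S.initial.carrier ≤ M.size := by
  obtain ⟨i, j, k, -, -, -, rfl⟩ := exists_triple' hK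
  have hi : M.node 0 i ∈ S.initial.carrier := by rw [node_zero_eq]; exact M.node₀_mem i
  refine (Metric.infDist_le_dist_of_mem hi).trans ?_
  rw [dist_eq_norm]
  exact norm_sub_le_size (left_mem_Icc.2 hT.le) hK hx (node_mem_cell 0 (by simp))

/-- The planes of the triangles are almost tangential to the surface. -/
lemma abs_inner_normal_le (hT : 0 < T) {ρ : ℝ} (hρ : 0 < ρ) (hM : M.Assumptions ρ) {κ : ℝ}
    (hκ : 0 ≤ κ) (hΓ : ∀ a ∈ S.initial.carrier, ∀ b ∈ S.initial.carrier,
      ‖S.initial.normal a - S.initial.normal b‖ ≤ κ * ‖a - b‖ ∧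
        |inner ℝ (a - b) (S.initial.normal b)| ≤ κ * ‖a - b‖ ^ 2)
    {K : Finset (Fin M.numNodes)} (hK : K ∈ M.triangles) {x y z : E3} (hx : x ∈ M.cell 0 K)
    (hy : y ∈ M.cell 0 K) (hz : z ∈ M.cell 0 K) :
    |inner ℝ (x - y) (S.initial.normal (proj S.initial.carrier z))| ≤
      (2 * κ / ρ + 2 * κ) * M.size * ‖x - y‖ := by
  have h0 : (0 : ℝ) ∈ Icc 0 T := left_mem_Icc.2 hT.le
  have hh := hM.size_pos hT
  obtain ⟨i, j, k, hij, hik, hjk, rfl⟩ := exists_triple' hK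
  have hD := gramDet_edge_pos h0 hij hik hjk hK
  have d1 := hM.norm_dualVec_le hT hρ h0 hij hik hjk hK
  have d2 := hM.norm_dualVec_le hT hρ h0 hik hij hjk.symm (by rwa [Finset.pair_comm])
  have hxy : x - y = inner ℝ (dualVec (M.edge 0 i j) (M.edge 0 i k)) (x - y) • M.edge 0 i j
      + inner ℝ (dualVec (M.edge 0 i k) (M.edge 0 i j)) (x - y) • M.edge 0 i k := by
    rw [cell_eq_image] at hx hy
    obtain ⟨p, -, rfl⟩ := hx
    obtain ⟨q, -, rfl⟩ := hy
    obtain ⟨p1, p2⟩ := inner_triMap (x := M.node 0 i) hD.ne' p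
    obtain ⟨q1, q2⟩ := inner_triMap (x := M.node 0 i) hD.ne' q
    have hsub : ∀ d a b : E3, inner ℝ d (a - b) =
        inner ℝ d (a - M.node 0 i) - inner ℝ d (b - M.node 0 i) := fun d a b => by
      rw [← inner_sub_right, sub_sub_sub_cancel_right]
    rw [hsub (dualVec (M.edge 0 i j) (M.edge 0 i k)), hsub (dualVec (M.edge 0 i k) (M.edge 0 i j)),
      p1, p2, q1, q2]
    unfold triMap
    module
  have hedge : ∀ l ∈ ({i, j, k} : Finset (Fin M.numNodes)),
      |inner ℝ (M.edge 0 i l) (S.initial.normal (M.node₀ i))| ≤ κ * M.size ^ 2 := by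
    intro l hl
    have h1 := norm_edge_le_size h0 hK (i := i) (by simp) hl
    have e : M.edge 0 i l = M.node₀ l - M.node₀ i := by
      unfold edge; rw [node_zero_eq, node_zero_eq]
    rw [e] at h1 ⊢
    exact (hΓ _ (M.node₀_mem l) _ (M.node₀_mem i)).2.trans
      (mul_le_mul_of_nonneg_left (pow_le_pow_left₀ (norm_nonneg _) h1 2) hκ)
  have hcoef : ∀ d : E3, ‖d‖ ≤ 1 / (ρ * M.size) → |inner ℝ d (x - y)| ≤
      1 / (ρ * M.size) * ‖x - y‖ := fun d hd =>
    (abs_real_inner_le_norm _ _).trans (mul_le_mul_of_nonneg_right hd (norm_nonneg _))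
  have hA : |inner ℝ (x - y) (S.initial.normal (M.node₀ i))| ≤
      2 * κ / ρ * M.size * ‖x - y‖ := by
    nth_rewrite 1 [hxy]
    rw [inner_add_left, inner_smul_left, inner_smul_left]
    simp only [conj_trivial]
    refine (abs_add_le _ _).trans ?_
    rw [abs_mul, abs_mul]
    refine (add_le_add
      (mul_le_mul (hcoef _ d1) (hedge j (by simp)) (abs_nonneg _) (by positivity))
      (mul_le_mul (hcoef _ d2) (hedge k (by simp)) (abs_nonneg _) (by positivity))).trans_eq ?_
    field_simp
    ring
  obtain ⟨pz, hpz⟩ := S.initial.proj_spec z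
  have hB : ‖M.node₀ i - proj S.initial.carrier z‖ ≤ 2 * M.size := by
    have h1 := norm_sub_le_size h0 hK (node_mem_cell 0 (by simp : i ∈ ({i, j, k} : Finset _))) hz
    have h2 := infDist_le_size hT hK hz
    rw [← hpz, dist_eq_norm] at h2
    rw [node_zero_eq] at h1
    have := norm_add_le (M.node₀ i - z) (z - proj S.initial.carrier z)
    rw [sub_add_sub_cancel] at this
    linarith
  have hC : |inner ℝ (x - y) (S.initial.normal (M.node₀ i)
      - S.initial.normal (proj S.initial.carrier z))| ≤ 2 * κ * M.size * ‖x - y‖ := by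
    refine (abs_real_inner_le_norm _ _).trans ?_
    have := (hΓ _ (M.node₀_mem i) _ pz).1.trans (mul_le_mul_of_nonneg_left hB hκ)
    calc _ ≤ ‖x - y‖ * (κ * (2 * M.size)) := by gcongr
      _ = _ := by ring
  have e : inner ℝ (x - y) (S.initial.normal (proj S.initial.carrier z)) =
      inner ℝ (x - y) (S.initial.normal (M.node₀ i)) - inner ℝ (x - y) (S.initial.normal (M.node₀ i)
      - S.initial.normal (proj S.initial.carrier z)) := by
    rw [inner_sub_right]; ring
  rw [e]
  refine (abs_sub _ _).trans ?_
  linarith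

variable (M) in
/-- The properties of the normal projection of the initial triangles that the estimate of the
initial energy uses: it is bi-Lipschitz on each of them. -/
def IsBiLipschitzProj : Prop :=
  ∀ K ∈ M.triangles, ∀ x ∈ M.cell 0 K, ∀ y ∈ M.cell 0 K,
    ‖proj S.initial.carrier x - proj S.initial.carrier y‖ ≤ 2 * ‖x - y‖ ∧
    ‖x - y‖ ≤ 3 * ‖proj S.initial.carrier x - proj S.initial.carrier y‖

/-- The normal projection of the triangles of a sufficiently fine mesh is bi-Lipschitz. -/
lemma exists_isBiLipschitzProj (hT : 0 < T) (S : EvolvingSurface T) {ρ : ℝ} (hρ : 0 < ρ) :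
    ∃ h₀ : ℝ, 0 < h₀ ∧ h₀ ≤ 1 ∧ ∀ M : Mesh S, M.Assumptions ρ → M.size < h₀ →
      M.IsBiLipschitzProj := by
  obtain ⟨κ, hκ, hΓ⟩ := S.initial.exists_bounds
  have hd : 0 < 4 * (κ + (2 * κ / ρ + 2 * κ)) + 1 := by positivity
  refine ⟨1 / (4 * (κ + (2 * κ / ρ + 2 * κ)) + 1), by positivity, ?_, fun M hM hh => ?_⟩
  · rw [div_le_one hd]
    have : 0 ≤ κ + (2 * κ / ρ + 2 * κ) := by positivity
    linarith
  have hsize := hM.size_pos hT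
  rw [lt_div_iff₀ hd] at hh
  have n1 : 0 ≤ M.size * κ := by positivity
  have n2 : 0 ≤ M.size * (2 * κ / ρ + 2 * κ) := by positivity
  have s1 : κ * M.size ≤ 1 / 4 := by nlinarith
  have s2 : (2 * κ / ρ + 2 * κ) * M.size ≤ 1 / 4 := by nlinarith
  intro K hK x hx y hy
  have hx' := infDist_le_size hT hK hx
  have hy' := infDist_le_size hT hK hy
  refine ⟨Surface.norm_proj_sub_le hΓ s1 hx' hy', Surface.norm_sub_le_norm_proj_sub hΓ s1 hx' ?_⟩
  exact (abs_inner_normal_le hT hρ hM hκ hΓ hK hx hy hy).trans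
    (mul_le_mul_of_nonneg_right s2 (norm_nonneg _))

end Mesh

/-! ### The Dirichlet energy of the initial datum -/

lemma lintegral_ofReal_norm_sq {F : Type*} [NormedAddCommGroup F] (f : E3 → F) (μ : Measure E3) :
    ∫⁻ x, ENNReal.ofReal (‖f x‖ ^ 2) ∂μ = eLpNorm f 2 μ ^ 2 := by
  have h := eLpNorm_nnreal_pow_eq_lintegral (f := f) (μ := μ) (p := 2) two_ne_zero
  norm_num at h
  rw [h]
  refine lintegral_congr fun x => ?_
  rw [ENNReal.ofReal_pow (norm_nonneg _), ofReal_norm]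

lemma lintegral_triMap {x e f : E3} (h : gramDet e f ≠ 0) (s : Set E2) (F : E3 → ENNReal) :
    (∫⁻ p in s, F (triMap x e f p)) * ENNReal.ofReal (Real.sqrt (gramDet e f)) =
      ∫⁻ y in triMap x e f '' s, F y ∂area := by
  rw [area_restrict_image_triMap h, lintegral_smul_measure,
    (measurableEmbedding_triMap h).lintegral_map, smul_eq_mul, mul_comm]

namespace Mesh

variable {T : ℝ} {S : EvolvingSurface T} {M : Mesh S}

lemma fe_triMap {t : ℝ} (ht : t ∈ Icc 0 T) {i j k : Fin M.numNodes} (hij : i ≠ j)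
    (hik : i ≠ k) (hjk : j ≠ k) (hK : {i, j, k} ∈ M.triangles) (u : Fin M.numNodes → ℝ) {q : E2}
    (hq : q ∈ refTriangle) :
    M.fe t u (triMap (M.node t i) (M.edge t i j) (M.edge t i k) q) =
      u i + (u j - u i) * q 0 + (u k - u i) * q 1 := by
  have hx : triMap (M.node t i) (M.edge t i j) (M.edge t i k) q ∈ M.cell t {i, j, k} := by
    rw [cell_eq_image]; exact mem_image_of_mem _ hq
  obtain ⟨b1, b2, b3⟩ := basis_triMap ht hij hik hjk hK hq
  unfold fe
  rw [sum_triple hij hik hjk fun l hl => by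
    rw [basis_eq_zero_of_notMem ht hK hx hl, mul_zero], b1, b2, b3]
  ring

lemma Assumptions.bijOn_zero (hT : 0 < T) {ρ : ℝ} (hM : M.Assumptions ρ) :
    BijOn (proj S.initial.carrier) (M.surface 0) S.initial.carrier := by
  have := hM.exact 0 (left_mem_Icc.2 hT.le)
  rwa [S.at_zero] at this

variable (M) in
/-- The inverse of the normal projection of the initial triangulated surface. -/
def unproj : E3 → E3 := Function.invFunOn (proj S.initial.carrier) (M.surface 0)

lemma lift_zero_eq (η : E3 → ℝ) (y : E3) : M.lift 0 η y = η (M.unproj y) := by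
  unfold lift unproj; rw [S.at_zero]

lemma unproj_proj (hT : 0 < T) {ρ : ℝ} (hM : M.Assumptions ρ) {x : E3} (hx : x ∈ M.surface 0) :
    M.unproj (proj S.initial.carrier x) = x :=
  (hM.bijOn_zero hT).injOn.leftInvOn_invFunOn hx

lemma unproj_mem (hT : 0 < T) {ρ : ℝ} (hM : M.Assumptions ρ) {y : E3}
    (hy : y ∈ S.initial.carrier) : M.unproj y ∈ M.surface 0 := by
  obtain ⟨x, hx, rfl⟩ := (hM.bijOn_zero hT).surjOn hy
  rwa [unproj_proj hT hM hx]

lemma IsBiLipschitzProj.continuousOn (hp : M.IsBiLipschitzProj) {K : Finset (Fin M.numNodes)}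
    (hK : K ∈ M.triangles) : ContinuousOn (proj S.initial.carrier) (M.cell 0 K) := by
  refine (LipschitzOnWith.of_dist_le_mul (K := 2) fun x hx y hy => ?_).continuousOn
  rw [dist_eq_norm, dist_eq_norm]
  exact (hp K hK x hx y hy).1

/-- The change of variables from an initial triangle to its projection. -/
lemma IsBiLipschitzProj.lintegral_le (hT : 0 < T) {ρ : ℝ} (hM : M.Assumptions ρ)
    (hp : M.IsBiLipschitzProj) {K : Finset (Fin M.numNodes)} (hK : K ∈ M.triangles)
    (F : E3 → ENNReal) :
    MeasurableSet (proj S.initial.carrier '' M.openCell 0 K) ∧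
    ∫⁻ x in M.openCell 0 K, F x ∂area ≤
      9 * ∫⁻ y in proj S.initial.carrier '' M.openCell 0 K, F (M.unproj y) ∂area := by
  have h0 : (0 : ℝ) ∈ Icc 0 T := left_mem_Icc.2 hT.le
  have h := lintegral_le_of_expanding (c := 3) (measurableSet_openCell h0 hK)
    ((hp.continuousOn hK).mono (openCell_subset 0 K))
    (fun x hx => unproj_proj hT hM (cell_subset_surface hK hx.1))
    (fun x hx y hy => (hp K hK x hx.1 y hy.1).2) F
  refine ⟨h.1, h.2.trans_eq ?_⟩
  norm_num

/-- The projections of the open triangles are disjoint parts of the surface. -/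
lemma IsBiLipschitzProj.sum_lintegral_le (hT : 0 < T) {ρ : ℝ} (hM : M.Assumptions ρ)
    (hp : M.IsBiLipschitzProj) (F : E3 → ENNReal) :
    ∑ K ∈ M.triangles, ∫⁻ y in proj S.initial.carrier '' M.openCell 0 K, F y ∂area ≤
      ∫⁻ y in S.initial.carrier, F y ∂area := by
  have h0 : (0 : ℝ) ∈ Icc 0 T := left_mem_Icc.2 hT.le
  rw [← lintegral_biUnion_finset]
  · refine lintegral_mono_set (iUnion₂_subset fun K hK => ?_)
    rintro _ ⟨x, -, rfl⟩
    exact (S.initial.proj_spec x).1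
  · intro K hK L hL hne
    refine Set.disjoint_left.2 ?_
    rintro _ ⟨x, hx, rfl⟩ ⟨y, hy, hxy⟩
    have e := (hM.bijOn_zero hT).injOn (cell_subset_surface hL hy.1) (cell_subset_surface hK hx.1) hxy
    exact hne (eq_of_mem_openCell h0 hK hL hx (e ▸ hy))
  · exact fun K hK => (hp.lintegral_le hT hM hK F).1

/-- The difference of two nodal values is controlled by a smooth function `φ` on the surface and
by the distance of the lift of the finite element function to `φ`. -/
lemma IsBiLipschitzProj.ofReal_sq_sub_le (hT : 0 < T) {ρ : ℝ} (hM : M.Assumptions ρ)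
    (hp : M.IsBiLipschitzProj) {φ : E3 → ℝ} (hφ : ContDiff ℝ 1 φ) (u : Fin M.numNodes → ℝ)
    {i j k : Fin M.numNodes} (hij : i ≠ j) (hik : i ≠ k) (hjk : j ≠ k)
    (hK : {i, j, k} ∈ M.triangles) :
    ENNReal.ofReal (((u j - u i) / 2) ^ 2) * volume (openTriangle (1 / 2))
        * ENNReal.ofReal (Real.sqrt (gramDet (M.edge 0 i j) (M.edge 0 i k))) ≤
      54 * (∫⁻ y in proj S.initial.carrier '' M.openCell 0 {i, j, k},
          ENNReal.ofReal (‖M.fe 0 u (M.unproj y) - φ y‖ ^ 2) ∂area)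
        + ENNReal.ofReal (27 * M.size ^ 2)
          * ∫⁻ y in proj S.initial.carrier '' M.openCell 0 {i, j, k},
            ENNReal.ofReal (‖S.initial.tangentialGradient φ y‖ ^ 2) ∂area := by
  have h0 : (0 : ℝ) ∈ Icc 0 T := left_mem_Icc.2 hT.le
  have hh := hM.size_pos hT
  have hD := gramDet_edge_pos h0 hij hik hjk hK
  set X := triMap (M.node 0 i) (M.edge 0 i j) (M.edge 0 i k) with hX
  set p := proj S.initial.carrier with hpdef
  have hXmem : ∀ q ∈ refTriangle, X q ∈ M.cell 0 {i, j, k} := fun q hq => by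
    rw [cell_eq_image]; exact mem_image_of_mem _ hq
  have hsub := openTriangle_subset_refTriangle (le_refl (1 : ℝ))
  have hpX : ContinuousOn (fun q => p (X q)) (openTriangle 1) :=
    (hp.continuousOn hK).comp (continuous_triMap _ _ _).continuousOn fun q hq => hXmem q (hsub hq)
  have hpΓ : ∀ x, p x ∈ S.initial.carrier := fun x => (S.initial.proj_spec x).1
  have hfeX : ContinuousOn (fun q => M.fe 0 u (X q)) (openTriangle 1) :=
    ((isFE_fe h0 u).1).comp (continuous_triMap _ _ _).continuousOn fun q hq =>
      cell_subset_surface hK (hXmem q (hsub hq))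
  have key := ofReal_mul_volume_le (δ := (u j - u i) / 2) (D := (2 * M.size) ^ 2 * (1 / 2))
    (E := fun q => M.fe 0 u (X q) - φ (p (X q)))
    (G := fun q => ‖S.initial.tangentialGradient φ (p (X q))‖) (by positivity)
    (hfeX.fun_sub (hφ.continuous.comp_continuousOn hpX))
    (((S.initial.continuousOn_tangentialGradient hφ).comp hpX fun q _ => hpΓ _).norm) ?_
  · have hchange : ∀ F : E3 → ENNReal, (∫⁻ q in openTriangle 1, F (X q))
        * ENNReal.ofReal (Real.sqrt (gramDet (M.edge 0 i j) (M.edge 0 i k))) ≤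
        9 * ∫⁻ y in p '' M.openCell 0 {i, j, k}, F (M.unproj y) ∂area := by
      intro F
      rw [hX, lintegral_triMap hD.ne', ← openCell_eq_image h0 hij hik hjk hK]
      exact (hp.lintegral_le hT hM hK F).2
    have hback : ∀ F : E3 → E3 → ENNReal, ∫⁻ y in p '' M.openCell 0 {i, j, k},
        F (M.unproj y) (p (M.unproj y)) ∂area =
        ∫⁻ y in p '' M.openCell 0 {i, j, k}, F (M.unproj y) y ∂area := by
      intro F
      refine setLIntegral_congr_fun (hp.lintegral_le hT hM hK 0).1 ?_
      rintro _ ⟨x, hx, rfl⟩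
      simp only
      rw [unproj_proj hT hM (cell_subset_surface hK hx.1)]
    have c1 := hchange fun x => ENNReal.ofReal (‖M.fe 0 u x - φ (p x)‖ ^ 2)
    have c2 := hchange fun x => ENNReal.ofReal (‖S.initial.tangentialGradient φ (p x)‖ ^ 2)
    rw [hback fun x y => ENNReal.ofReal (‖M.fe 0 u x - φ y‖ ^ 2)] at c1
    rw [hback fun _ y => ENNReal.ofReal (‖S.initial.tangentialGradient φ y‖ ^ 2)] at c2
    simp only [Real.norm_eq_abs, sq_abs] at c1 ⊢
    refine (mul_le_mul_left key _).trans ?_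
    rw [add_mul, mul_assoc, mul_assoc]
    refine (add_le_add (mul_le_mul_right c1 _) (mul_le_mul_right c2 _)).trans_eq ?_
    rw [← mul_assoc, ← mul_assoc]
    congr 2
    · norm_num
    · rw [show (9 : ENNReal) = ENNReal.ofReal 9 by simp, ← ENNReal.ofReal_mul (by positivity)]
      congr 1
      ring
  · intro q hq
    have hq1 : q ∈ openTriangle 1 := by
      have := add_smul_unitVec_mem hq (s := 0) (by norm_num)
      rwa [zero_smul, add_zero] at this
    have hq2 := add_smul_unitVec_mem hq (s := 1 / 2) (by norm_num)
    have hγ := S.initial.sq_sub_le_integral_tangentialGradient hφ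
      (γ := fun s => p (X (q + s • unitVec))) (a := 1 / 2) (c := 2 * M.size) (by norm_num)
      (by positivity) (fun s _ => hpΓ _) ?_
    · have e1 := fe_triMap h0 hij hik hjk hK u (hsub hq1)
      have e2 := fe_triMap h0 hij hik hjk hK u (hsub hq2)
      have c0 : (q + (1 / 2 : ℝ) • unitVec) 0 = q 0 + 1 / 2 := by simp [unitVec]
      have c1 : (q + (1 / 2 : ℝ) • unitVec) 1 = q 1 := by simp [unitVec]
      rw [c0, c1] at e2
      simp only [zero_smul, add_zero] at hγ
      simp only [hX, e1, e2] at hγ ⊢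
      refine le_trans ?_ (add_le_add_right (mul_le_mul_of_nonneg_left hγ (by norm_num)) _)
      generalize φ (p (triMap (M.node 0 i) (M.edge 0 i j) (M.edge 0 i k)
        (q + (1 / 2 : ℝ) • unitVec))) = A
      generalize φ (p (triMap (M.node 0 i) (M.edge 0 i j) (M.edge 0 i k) q)) = B
      have hsum : ∀ a b c : ℝ, (a - b + c) ^ 2 ≤ 3 * a ^ 2 + 3 * b ^ 2 + 3 * c ^ 2 := fun a b c => by
        nlinarith [sq_nonneg (a + b), sq_nonneg (a - c), sq_nonneg (b + c)]
      refine le_trans (le_of_eq ?_) (hsum _ _ _)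
      ring
    · intro s hs s' hs'
      refine ((hp _ hK _ (hXmem _ (hsub (add_smul_unitVec_mem hq hs))) _
        (hXmem _ (hsub (add_smul_unitVec_mem hq hs')))).1).trans ?_
      have e : X (q + s • unitVec) - X (q + s' • unitVec) = (s - s') • M.edge 0 i j := by
        rw [hX]
        unfold triMap unitVec
        simp only [PiLp.add_apply, PiLp.smul_apply, PiLp.single_apply, smul_eq_mul]
        norm_num
        module
      rw [e, norm_smul, Real.norm_eq_abs, mul_assoc, mul_comm |s - s'|]
      have := norm_edge_le_size h0 hK (i := i) (j := j) (by simp) (by simp)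
      gcongr

/-- The Dirichlet energy on one triangle is bounded by the squared differences of the nodal values
along two of its edges, divided by `(ρ h)²`. -/
lemma IsBiLipschitzProj.ofReal_cellArea_mul_le (hT : 0 < T) {ρ : ℝ} (hρ : 0 < ρ)
    (hM : M.Assumptions ρ) (hp : M.IsBiLipschitzProj) {φ : E3 → ℝ} (hφ : ContDiff ℝ 1 φ)
    (u : Fin M.numNodes → ℝ) {K : Finset (Fin M.numNodes)} (hK : K ∈ M.triangles) :
    ENNReal.ofReal (M.cellArea 0 K * inner ℝ (M.grad 0 K (M.fe 0 u)) (M.grad 0 K (M.fe 0 u)))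
        * (volume (openTriangle (1 / 2)) * ENNReal.ofReal (ρ ^ 2 * M.size ^ 2)) ≤
      ENNReal.ofReal (16 * refArea) * (54 * (∫⁻ y in proj S.initial.carrier '' M.openCell 0 K,
          ENNReal.ofReal (‖M.fe 0 u (M.unproj y) - φ y‖ ^ 2) ∂area)
        + ENNReal.ofReal (27 * M.size ^ 2) * ∫⁻ y in proj S.initial.carrier '' M.openCell 0 K,
            ENNReal.ofReal (‖S.initial.tangentialGradient φ y‖ ^ 2) ∂area) := by
  have h0 : (0 : ℝ) ∈ Icc 0 T := left_mem_Icc.2 hT.le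
  have hh := hM.size_pos hT
  obtain ⟨i, j, k, hij, hik, hjk, rfl⟩ := exists_triple' hK
  have hK' : {i, k, j} ∈ M.triangles := by rwa [Finset.pair_comm]
  have b1 := hp.ofReal_sq_sub_le hT hM hφ u hij hik hjk hK
  have b2 := hp.ofReal_sq_sub_le hT hM hφ u hik hij hjk.symm hK'
  rw [gramDet_comm, Finset.pair_comm k j] at b2
  rw [grad_fe h0 hij hik hjk hK, cellArea_triple, real_inner_self_eq_norm_sq]
  set σ := Real.sqrt (gramDet (M.edge 0 i j) (M.edge 0 i k)) with hσ
  set R := 54 * (∫⁻ y in proj S.initial.carrier '' M.openCell 0 {i, j, k},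
          ENNReal.ofReal (‖M.fe 0 u (M.unproj y) - φ y‖ ^ 2) ∂area)
        + ENNReal.ofReal (27 * M.size ^ 2) * ∫⁻ y in proj S.initial.carrier '' M.openCell 0 {i, j, k},
            ENNReal.ofReal (‖S.initial.tangentialGradient φ y‖ ^ 2) ∂area with hR
  have hσ0 : 0 ≤ σ := Real.sqrt_nonneg _
  have ha := refArea_pos.le
  have hgrad : ‖M.triGrad 0 i j k u‖ ≤ (|u j - u i| + |u k - u i|) / (ρ * M.size) := by
    unfold triGrad
    refine (norm_add_le _ _).trans ?_
    rw [norm_smul, norm_smul, add_div, div_eq_mul_one_div, div_eq_mul_one_div |u k - u i|]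
    exact add_le_add
      (mul_le_mul_of_nonneg_left (hM.norm_dualVec_le hT hρ h0 hij hik hjk hK) (norm_nonneg _))
      (mul_le_mul_of_nonneg_left (hM.norm_dualVec_le hT hρ h0 hik hij hjk.symm hK') (norm_nonneg _))
  have hgrad2 : ‖M.triGrad 0 i j k u‖ ^ 2 * (ρ ^ 2 * M.size ^ 2) ≤
      8 * (((u j - u i) / 2) ^ 2 + ((u k - u i) / 2) ^ 2) := by
    rw [le_div_iff₀ (by positivity)] at hgrad
    have h1 := pow_le_pow_left₀ (by positivity) hgrad 2
    have h2 : (|u j - u i| + |u k - u i|) ^ 2 ≤ 2 * (|u j - u i| ^ 2 + |u k - u i| ^ 2) := by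
      nlinarith [sq_nonneg (|u j - u i| - |u k - u i|)]
    rw [sq_abs, sq_abs] at h2
    calc _ = (‖M.triGrad 0 i j k u‖ * (ρ * M.size)) ^ 2 := by ring
      _ ≤ _ := h1.trans h2
      _ = _ := by ring
  have hreal : refArea * σ * ‖M.triGrad 0 i j k u‖ ^ 2 * (ρ ^ 2 * M.size ^ 2) ≤
      8 * refArea * (((u j - u i) / 2) ^ 2 * σ + ((u k - u i) / 2) ^ 2 * σ) := by
    calc _ = refArea * σ * (‖M.triGrad 0 i j k u‖ ^ 2 * (ρ ^ 2 * M.size ^ 2)) := by ring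
      _ ≤ refArea * σ * (8 * (((u j - u i) / 2) ^ 2 + ((u k - u i) / 2) ^ 2)) := by gcongr
      _ = _ := by ring
  rw [mul_left_comm, ← ENNReal.ofReal_mul (by positivity)]
  refine (mul_le_mul_right (ENNReal.ofReal_le_ofReal hreal) _).trans ?_
  have eσ : ∀ x : ℝ, volume (openTriangle (1 / 2)) * ENNReal.ofReal (x ^ 2 * σ) =
      ENNReal.ofReal (x ^ 2) * volume (openTriangle (1 / 2)) * ENNReal.ofReal σ := fun x => by
    rw [ENNReal.ofReal_mul (sq_nonneg x), ← mul_assoc, mul_comm (volume _)]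
  rw [ENNReal.ofReal_mul (p := 8 * refArea) (by positivity),
    ENNReal.ofReal_add (by positivity) (by positivity), mul_left_comm, mul_add, eσ, eσ]
  refine (mul_le_mul_right (add_le_add b1 b2) _).trans_eq ?_
  rw [← two_mul, ← mul_assoc, show (2 : ENNReal) = ENNReal.ofReal 2 by simp,
    ← ENNReal.ofReal_mul (by positivity)]
  congr 2
  ring

lemma IsBiLipschitzProj.ofReal_stiff_le (hT : 0 < T) {ρ : ℝ} (hρ : 0 < ρ)
    (hM : M.Assumptions ρ) (hp : M.IsBiLipschitzProj) {φ : E3 → ℝ} (hφ : ContDiff ℝ 1 φ)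
    (u : Fin M.numNodes → ℝ) :
    ENNReal.ofReal (M.stiff 0 u u)
        * (volume (openTriangle (1 / 2)) * ENNReal.ofReal (ρ ^ 2 * M.size ^ 2)) ≤
      ENNReal.ofReal (16 * refArea) * (54 * (∫⁻ y in S.initial.carrier,
          ENNReal.ofReal (‖M.fe 0 u (M.unproj y) - φ y‖ ^ 2) ∂area)
        + ENNReal.ofReal (27 * M.size ^ 2) * ∫⁻ y in S.initial.carrier,
            ENNReal.ofReal (‖S.initial.tangentialGradient φ y‖ ^ 2) ∂area) := by
  unfold stiff
  rw [a_eq, ENNReal.ofReal_sum_of_nonneg fun K _ =>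
    mul_nonneg (cellArea_nonneg 0 K) real_inner_self_nonneg, Finset.sum_mul]
  refine (Finset.sum_le_sum fun K hK => hp.ofReal_cellArea_mul_le hT hρ hM hφ u hK).trans ?_
  rw [← Finset.mul_sum, Finset.sum_add_distrib, ← Finset.mul_sum, ← Finset.mul_sum]
  gcongr
  · exact hp.sum_lintegral_le hT hM _
  · exact hp.sum_lintegral_le hT hM _

/-- Discrete initial data that are `O(h²)` close in `L²` to a function of finite Dirichlet energy
have bounded Dirichlet energies. The smooth function `φ` to which the data are compared is an
approximation of the given function in `H¹`. -/
lemma exists_stiff_le (hT : 0 < T) (S : EvolvingSurface T) {ρ : ℝ} (hρ : 0 < ρ) {u₀ : E3 → ℝ}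
    {G : E3 → E3} (hG : S.initial.HasWeakGradient u₀ G) (C₀ : ℝ) :
    ∃ C : ℝ, ∀ M : Mesh S, M.Assumptions ρ → M.IsBiLipschitzProj → M.size ≤ 1 →
      ∀ U₀ : E3 → ℝ, M.IsFE 0 U₀ → M.Approximates C₀ u₀ U₀ →
        M.stiff 0 (fun i => U₀ (M.node 0 i)) (fun i => U₀ (M.node 0 i)) ≤ C := by
  have h0 : (0 : ℝ) ∈ Icc 0 T := left_mem_Icc.2 hT.le
  obtain ⟨hu, hGm, φ, hφ, hφ1, hφ2⟩ := hG
  set v := (volume (openTriangle (1 / 2))).toReal with hv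
  have hvne := volume_openTriangle_ne_top (r := 1 / 2) (by norm_num)
  have hv0 : 0 < v := ENNReal.toReal_pos (volume_openTriangle_pos (by norm_num)).ne' hvne
  set N := (eLpNorm G 2 S.initial.measure).toReal with hN
  refine ⟨16 * refArea * (54 * (1 + |C₀|) ^ 2 + 27 * (N + 1) ^ 2) / (v * ρ ^ 2),
    fun M hM hp hsize U₀ hU hA => ?_⟩
  have hh := hM.size_pos hT
  obtain ⟨G', ⟨hdiff, -, -⟩, hle⟩ := hA
  have ev1 := ENNReal.tendsto_nhds_zero.1 hφ1 (ENNReal.ofReal M.size) (by simpa using hh)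
  have ev2 := ENNReal.tendsto_nhds_zero.1 hφ2 1 (by simp)
  -- the index of the approximation depends on the mesh, the bound for its gradient does not
  obtain ⟨n, hn1, hn2⟩ := (ev1.and ev2).exists
  set u : Fin M.numNodes → ℝ := fun i => U₀ (M.node 0 i) with hudef
  have hΓm : MeasurableSet S.initial.carrier := S.initial.isCompact.measurableSet
  -- the distance of the lift of the datum to the smooth function
  have hL2 : eLpNorm (fun y => M.lift 0 U₀ y - φ n y) 2 S.initial.measure ≤
      ENNReal.ofReal ((1 + |C₀|) * M.size) := by
    have e : (fun y => M.lift 0 U₀ y - φ n y) =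
        (fun y => u₀ y - φ n y) - fun y => u₀ y - M.lift 0 U₀ y := by
      funext y; simp
    have hφm : AEStronglyMeasurable (fun y => u₀ y - φ n y) S.initial.measure :=
      hu.1.sub (hφ n).continuous.aestronglyMeasurable
    rw [e]
    refine (eLpNorm_sub_le hφm hdiff.1 (by norm_num)).trans ?_
    have hd : eLpNorm (fun y => u₀ y - M.lift 0 U₀ y) 2 S.initial.measure ≤
        ENNReal.ofReal (|C₀| * M.size) := by
      rw [← ENNReal.ofReal_toReal hdiff.2.ne]
      refine ENNReal.ofReal_le_ofReal ?_
      have h1 : 0 ≤ M.size * S.initial.normH1 (fun y => u₀ y - M.lift 0 U₀ y) G' :=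
        mul_nonneg hh.le (Real.sqrt_nonneg _)
      have h2 : S.initial.normL2 (fun y => u₀ y - M.lift 0 U₀ y) ≤ C₀ * M.size ^ 2 := by linarith
      refine h2.trans ?_
      calc C₀ * M.size ^ 2 ≤ |C₀| * M.size ^ 2 := by gcongr; exact le_abs_self _
        _ ≤ |C₀| * M.size := by
          refine mul_le_mul_of_nonneg_left ?_ (abs_nonneg _)
          rw [pow_two]; exact mul_le_of_le_one_left hh.le hsize
    refine (add_le_add hn1 hd).trans_eq ?_
    rw [← ENNReal.ofReal_add hh.le (by positivity)]
    congr 1; ring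
  have hgrad : eLpNorm (S.initial.tangentialGradient (φ n)) 2 S.initial.measure ≤
      ENNReal.ofReal (N + 1) := by
    have hm : AEStronglyMeasurable (S.initial.tangentialGradient (φ n)) S.initial.measure :=
      (S.initial.continuousOn_tangentialGradient (hφ n)).aestronglyMeasurable hΓm
    have e : S.initial.tangentialGradient (φ n) =
        G - fun y => G y - S.initial.tangentialGradient (φ n) y := by
      funext y; simp
    rw [e]
    refine (eLpNorm_sub_le hGm.1 (hGm.1.sub hm) (by norm_num)).trans ?_
    refine (add_le_add_right hn2 _).trans_eq ?_
    rw [ENNReal.ofReal_add ENNReal.toReal_nonneg zero_le_one, ENNReal.ofReal_one,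
      ENNReal.ofReal_toReal hGm.2.ne]
  have hI1 : ∫⁻ y in S.initial.carrier, ENNReal.ofReal (‖M.fe 0 u (M.unproj y) - φ n y‖ ^ 2) ∂area ≤
      ENNReal.ofReal (((1 + |C₀|) * M.size) ^ 2) := by
    rw [setLIntegral_congr_fun (g := fun y => ENNReal.ofReal (‖M.lift 0 U₀ y - φ n y‖ ^ 2)) hΓm
      fun y hy => by
        simp only
        rw [lift_zero_eq, hU.eq_fe h0 (unproj_mem hT hM hy)]]
    rw [lintegral_ofReal_norm_sq (fun y => M.lift 0 U₀ y - φ n y), ENNReal.ofReal_pow (by positivity)]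
    exact pow_le_pow_left₀ zero_le hL2 2
  have hI2 : ∫⁻ y in S.initial.carrier,
      ENNReal.ofReal (‖S.initial.tangentialGradient (φ n) y‖ ^ 2) ∂area ≤
      ENNReal.ofReal ((N + 1) ^ 2) := by
    rw [lintegral_ofReal_norm_sq, ENNReal.ofReal_pow (by positivity)]
    exact pow_le_pow_left₀ zero_le hgrad 2
  have key := (hp.ofReal_stiff_le hT hρ hM (hφ n) u).trans
    (mul_le_mul_right (add_le_add (mul_le_mul_right hI1 _) (mul_le_mul_right hI2 _)) _)
  have ha := refArea_pos.le
  rw [← ENNReal.ofReal_toReal hvne, ← hv, show (54 : ENNReal) = ENNReal.ofReal 54 by simp,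
    ← ENNReal.ofReal_mul (by positivity), ← ENNReal.ofReal_mul (stiff_self_nonneg 0 u),
    ← ENNReal.ofReal_mul (by positivity), ← ENNReal.ofReal_mul (by positivity),
    ← ENNReal.ofReal_add (by positivity) (by positivity), ← ENNReal.ofReal_mul (by positivity),
    ENNReal.ofReal_le_ofReal_iff (by positivity)] at key
  rw [le_div_iff₀ (by positivity)]
  refine le_of_mul_le_mul_right ?_ (pow_pos hh 2)
  calc _ = M.stiff 0 u u * (v * (ρ ^ 2 * M.size ^ 2)) := by ring
    _ ≤ _ := key
    _ = _ := by ring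

/-! ### The area and the nodal values of the initial mesh -/

lemma sum_mass (t : ℝ) : ∑ i, M.mass t i = ∑ K ∈ M.triangles, M.cellArea t K := by
  unfold mass
  rw [Finset.sum_comm]
  refine Finset.sum_congr rfl fun K hK => ?_
  rw [← Finset.sum_filter, Finset.filter_mem_eq_inter, Finset.univ_inter, Finset.sum_const,
    M.card_triangle K hK, nsmul_eq_mul]
  push_cast; ring

/-- The areas of initial triangulated surfaces are bounded. -/
lemma exists_sum_mass_le (hT : 0 < T) (S : EvolvingSurface T) (ρ : ℝ) :
    ∃ m₀ : ℝ, ∀ M : Mesh S, M.Assumptions ρ → M.IsBiLipschitzProj → ∑ i, M.mass 0 i ≤ m₀ := by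
  have h0 : (0 : ℝ) ∈ Icc 0 T := left_mem_Icc.2 hT.le
  set v := (volume (openTriangle 1)).toReal with hv
  have hvne := volume_openTriangle_ne_top (le_refl (1 : ℝ))
  have hv0 : 0 < v := ENNReal.toReal_pos (volume_openTriangle_pos (by norm_num)).ne' hvne
  have ha := refArea_pos.le
  refine ⟨9 * refArea * (area S.initial.carrier).toReal / v, fun M hM hp => ?_⟩
  rw [sum_mass, le_div_iff₀ hv0, ← ENNReal.ofReal_le_ofReal_iff (by positivity),
    ENNReal.ofReal_mul (Finset.sum_nonneg fun K _ => cellArea_nonneg 0 K),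
    ENNReal.ofReal_sum_of_nonneg fun K _ => cellArea_nonneg 0 K, Finset.sum_mul,
    ENNReal.ofReal_mul (by positivity), ENNReal.ofReal_toReal S.initial.area_lt_top.ne, hv,
    ENNReal.ofReal_toReal hvne]
  have hK : ∀ K ∈ M.triangles, ENNReal.ofReal (M.cellArea 0 K) * volume (openTriangle 1) ≤
      ENNReal.ofReal (9 * refArea) * ∫⁻ y in proj S.initial.carrier '' M.openCell 0 K, 1 ∂area := by
    intro K hK
    have h1 := (hp.lintegral_le hT hM hK fun _ => 1).2
    rw [setLIntegral_one] at h1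
    obtain ⟨i, j, k, hij, hik, hjk, rfl⟩ := exists_triple' hK
    rw [openCell_eq_image h0 hij hik hjk hK, area_image_triMap,
      ← openCell_eq_image h0 hij hik hjk hK] at h1
    rw [cellArea_triple, ENNReal.ofReal_mul ha, mul_assoc, mul_comm 9, ENNReal.ofReal_mul ha,
      mul_assoc, show ENNReal.ofReal 9 = 9 by simp]
    exact mul_le_mul_right h1 _
  refine (Finset.sum_le_sum hK).trans ?_
  rw [← Finset.mul_sum]
  refine mul_le_mul_right ((hp.sum_lintegral_le hT hM _).trans_eq ?_) _
  rw [setLIntegral_one]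

/-- A finite element function that is bounded by `1` almost everywhere is bounded by `1` at the
nodes. -/
lemma abs_node_le_one (hT : 0 < T) {U₀ : E3 → ℝ} (hU : M.IsFE 0 U₀)
    (h : ∀ᵐ x ∂area.restrict (M.surface 0), |U₀ x| ≤ 1) (i : Fin M.numNodes) :
    |U₀ (M.node 0 i)| ≤ 1 := by
  have h0 : (0 : ℝ) ∈ Icc 0 T := left_mem_Icc.2 hT.le
  obtain ⟨K, hK, hi⟩ := M.node_used i
  obtain ⟨j, k, hij, hik, hjk, rfl⟩ := exists_triple hK hi
  have hD := gramDet_edge_pos h0 hij hik hjk hK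
  set X := triMap (M.node 0 i) (M.edge 0 i j) (M.edge 0 i k) with hX
  set u : Fin M.numNodes → ℝ := fun i => U₀ (M.node 0 i) with hu
  have hval : ∀ q ∈ refTriangle, U₀ (X q) = u i + (u j - u i) * q 0 + (u k - u i) * q 1 := by
    intro q hq
    have hx : X q ∈ M.surface 0 := cell_subset_surface hK (by
      rw [cell_eq_image]; exact mem_image_of_mem _ hq)
    rw [hU.eq_fe h0 hx]
    exact fe_triMap h0 hij hik hjk hK u hq
  by_contra! hcon
  -- the set in the triangle where the bound fails is open and accumulates at the node
  set O : Set E2 := openTriangle 1 ∩ {q | 1 < |u i + (u j - u i) * q 0 + (u k - u i) * q 1|} with hO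
  have hOo : IsOpen O := (isOpen_openTriangle 1).inter (isOpen_lt (by fun_prop) (by fun_prop))
  have hOne : O.Nonempty := by
    have ht : Tendsto (fun r : ℝ => |u i + (u j - u i) * r + (u k - u i) * r|) (𝓝[>] 0)
        (𝓝 |u i + (u j - u i) * 0 + (u k - u i) * 0|) :=
      ((by fun_prop : Continuous fun r : ℝ =>
        |u i + (u j - u i) * r + (u k - u i) * r|).tendsto 0).mono_left nhdsWithin_le_nhds
    have h1 := ht.eventually_const_lt (u := 1) (by simpa using hcon)
    have h2 : ∀ᶠ r : ℝ in 𝓝[>] 0, r ∈ Ioo (0 : ℝ) (1 / 2) := Ioo_mem_nhdsGT (by norm_num)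
    obtain ⟨r, hr1, hr2⟩ := (h1.and h2).exists
    refine ⟨!₂[r, r], ⟨?_, ?_, ?_⟩, ?_⟩
    · simpa using hr2.1
    · simpa using hr2.1
    · simp; linarith [hr2.2]
    · simpa using hr1
  have hpos : 0 < area (X '' O) := by
    rw [hX, area_image_triMap]
    exact ENNReal.mul_pos (by simpa using Real.sqrt_pos.2 hD) (hOo.measure_pos volume hOne).ne'
  have hms : MeasurableSet (M.surface 0) :=
    M.triangles.measurableSet_biUnion fun K _ => (isCompact_cell 0 K).measurableSet
  rw [ae_restrict_iff' hms] at h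
  refine hpos.ne' (measure_mono_null ?_ (ae_iff.1 h))
  rintro _ ⟨q, ⟨hq1, hq2⟩, rfl⟩
  have hq := openTriangle_subset_refTriangle le_rfl hq1
  simp only [mem_ofPred_eq, Classical.not_imp, not_le]
  refine ⟨cell_subset_surface hK (by rw [cell_eq_image]; exact mem_image_of_mem _ hq), ?_⟩
  rw [hval q hq]
  exact hq2

/-! ### The initial energy -/

/-- As the regularised potential is bounded on `[-1, 1]` uniformly in `δ`, the initial energy is
controlled by the Dirichlet energy and the total mass. -/
lemma augmentedEnergy_zero_le (hT : 0 < T) {ε θ δ D m₀ : ℝ} (hε : 0 < ε) (hθ : 0 < θ)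
    (hδ : δ ∈ Ioo (0 : ℝ) 1) {u : Fin M.numNodes → ℝ} (hu : ∀ i, |u i| ≤ 1)
    (hD : M.stiff 0 u u ≤ D) (hm : ∑ i, M.mass 0 i ≤ m₀) :
    M.augmentedEnergy ε θ δ 0 u ≤
      ε / 2 * D + 1 / ε * (m₀ * (5 * θ / 2 + 1 / 2)) + 1 / ε * m₀ := by
  have h0 : (0 : ℝ) ∈ Icc 0 T := left_mem_Icc.2 hT.le
  unfold augmentedEnergy
  gcongr
  · refine le_trans ?_ (mul_le_mul_of_nonneg_right hm (by positivity))
    rw [Finset.sum_mul]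
    refine Finset.sum_le_sum fun i _ => mul_le_mul_of_nonneg_left ?_ (mass_pos h0 i).le
    have h1 := FlogReg_le_of_abs_le hδ (hu i)
    unfold potentialReg
    nlinarith [sq_nonneg (u i)]
  · refine le_trans (Finset.sum_le_sum fun i _ => ?_) hm
    have h1 : u i ^ 2 ≤ 1 := (sq_le_one_iff_abs_le_one _).2 (hu i)
    exact mul_le_of_le_one_right (mass_pos h0 i).le h1

end Mesh

end ESFEM

end

theorem mainTheorem4 {T : ℝ} (hT : 0 < T) (S : ESFEM.EvolvingSurface T) (ρ : ℝ) (hρ : 0 < ρ) :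
    (∀ M : ESFEM.Mesh S, M.Assumptions ρ →
      ∀ ε θ δ : ℝ, 0 < ε → θ ∈ Set.Ioo (0 : ℝ) 1 → δ ∈ Set.Ioo (0 : ℝ) 1 →
      ∀ U₀ : ESFEM.E3 → ℝ, M.IsAdmissibleDatum ε θ U₀ →
        ∃ U W : ℝ → ESFEM.E3 → ℝ, M.IsSolution ε θ δ U₀ U W ∧
          ∀ U' W' : ℝ → ESFEM.E3 → ℝ, M.IsSolution ε θ δ U₀ U' W' →
            ∀ t ∈ Set.Icc 0 T,
              Set.EqOn (U' t) (U t) (M.surface t) ∧ Set.EqOn (W' t) (W t) (M.surface t)) ∧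
    ∃ h₀ : ℝ, 0 < h₀ ∧
      ∀ ε θ : ℝ, 0 < ε → θ ∈ Set.Ioo (0 : ℝ) 1 →
      ∀ u₀ : ESFEM.E3 → ℝ, S.IsAdmissibleDatum ε θ u₀ → ∀ C₀ : ℝ,
        ∃ C : ℝ, ∀ M : ESFEM.Mesh S, M.Assumptions ρ → M.size < h₀ →
          ∀ U₀ : ESFEM.E3 → ℝ, M.IsAdmissibleDatum ε θ U₀ → M.Approximates C₀ u₀ U₀ →
          ∀ δ ∈ Set.Ioo (0 : ℝ) 1, ∀ U W : ℝ → ESFEM.E3 → ℝ, M.IsSolution ε θ δ U₀ U W →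
            IntervalIntegrable (fun t => M.a t (W t) (W t)) MeasureTheory.volume 0 T ∧
            ∀ t ∈ Set.Icc 0 T,
              M.energyReg ε θ δ t (U t) + ∫ s in (0 : ℝ)..T, M.a s (W s) (W s) ≤ C := by
  refine ⟨fun M _ ε θ δ hε _ hδ U₀ hU => M.exists_unique_solution hT hε hδ hU.1, ?_⟩
  obtain ⟨h₀, hh₀, hh₁, hproj⟩ := ESFEM.Mesh.exists_isBiLipschitzProj hT S hρ
  obtain ⟨Λ, Q, hΛ, hshape⟩ := ESFEM.Mesh.exists_shapeBounds hT S hρ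
  obtain ⟨m₁, hm₁⟩ := ESFEM.Mesh.exists_sum_mass_le hT S ρ
  refine ⟨h₀, hh₀, fun ε θ hε hθ u₀ hu₀ C₀ => ?_⟩
  obtain ⟨⟨G, hG, -⟩, -⟩ := hu₀
  obtain ⟨D, hD⟩ := ESFEM.Mesh.exists_stiff_le hT S hρ hG C₀
  -- The constant is fixed before a mesh is given, so `0 ≤ m₀` cannot come from a positive mass.
  obtain ⟨m₀, hm₀, hmm⟩ : ∃ m₀ : ℝ, 0 ≤ m₀ ∧ m₁ ≤ m₀ :=
    ⟨max m₁ 0, le_max_right _ _, le_max_left _ _⟩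
  refine ⟨3 * ((1 + (ε / 2 * D + 1 / ε * (m₀ * (5 * θ / 2 + 1 / 2)) + 1 / ε * m₀)) *
    Real.exp (ESFEM.Mesh.growthRate ε (4 * Λ / ρ ^ 2 + 2 * Λ / ρ) (2 * Λ / ρ)
      (1 / 2 + 12 * Q ^ 2 / ρ ^ 2) ((1 + m₀) * Real.exp (2 * Λ / ρ * T)) * T)),
    fun M hM hsize U₀ hU₀ hA δ hδ U W hUW => ?_⟩
  have hp := hproj M hM hsize
  have hm := (hm₁ M hM hp).trans hmm
  have hE := (hshape M hM).energyBounds hT (hM.size_pos hT) hρ hΛ hm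
  exact ESFEM.Mesh.energy_le_of_energyBounds hT hE (by positivity) (by positivity) (by positivity)
    (by positivity) hε hθ.1 hδ hUW (ESFEM.Mesh.augmentedEnergy_zero_le hT hε hθ.1 hδ
      (ESFEM.Mesh.abs_node_le_one hT hU₀.1 hU₀.2.1)
      (hD M hM hp (hsize.le.trans hh₁) U₀ hU₀.1 hA) hm)
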